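/- Let $d\ge 1$. For an interaction potential $W:\mathbb{R}^d\to\mathbb{R}\cup\{\infty\}$ (locally integrable, bounded from below, lower semicontinuous and even), write $$E[\mu]=\frac12\int_{\mathbb{R}^d}\int_{\mathbb{R}^d}W(x-y)\,d\mu(y)\,d\mu(x)$$ for finite positive measures $\mu$, and for finite signed measures $\mu$ with $E[|\mu|]<\infty$, where $|\mu|$ is the total variation measure of $\mu$. The LIC radius of $W$ is $$R_{\rm LIC}[W]=\sup\Big\{R\ge 0:\ \text{for any distinct probability measures }\rho_0,\rho_1\text{ on }\overline{B(0;R)}\text{ with }E[\rho_i]<\infty\text{ and }\int x\,d\rho_i(x)=0\ (i=0,1),$$ $$\text{the function }t\mapsto E[(1-t)\rho_0+t\rho_1]\text{ is strictly convex on }[0,1]\Big\}\in[0,\infty].$$ Let $W$ be one of the potentials $$W_{a,b}(x)=\frac{|x|^a}{a}-\frac{|x|^b}{b}\quad(-d<b<a),\qquad W_{b,\ln}(x)=\frac{|x|^b}{b}\ln|x|\quad(b>-d,\ b\ne 0),$$ where $\frac{|x|^0}{0}$ is understood as $\ln|x|$ and $W(0)=\lim_{x\to0}W(x)\in\mathbb{R}\cup\{\infty\}$.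 For $R\ge0$ let $\mathcal{A}_R$ be the set of all nonzero finite signed measures $\mu$ supported on $\overline{B(0;R)}$ with $E[|\mu|]<\infty$ and $\int d\mu(x)=0$, $\int x\,d\mu(x)=0$. Then $$R_{\rm LIC}[W]=\sup\big\{R\ge0:\ E[\mu]>0\ \text{ for all }\mu\in\mathcal{A}_R\big\}.$$ If moreover $a<4$ (for $W=W_{a,b}$), respectively $b<4$ (for $W=W_{b,\ln}$), then the Fourier transform $\hat W$ of $W$ as a tempered distribution is a locally integrable real-valued function on $\mathbb{R}^d\setminus\{0\}$, the function $\hat W|\hat\mu|^2$ is integrable on $\mathbb{R}^d\setminus\{0\}$ for every $R\ge 0$ and every $\mu\in\mathcal{A}_R$, and $$R_{\rm LIC}[W]=\sup\Big\{R\ge0:\ \int_{\mathbb{R}^d\setminus\{0\}}\hat W(\xi)|\hat\mu(\xi)|^2\,d\xi>0\ \text{ for all }\mu\in\mathcal{A}_R\Big\}.$$ Here the Fourier transform is normalized as $\hat\mu(\xi)=\int_{\mathbb{R}^d}e^{-2\pi i x\cdot\xi}\,d\mu(x)$. -/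

import Mathlib

open MeasureTheory Metric Set
open scoped ENNReal NNReal FourierTransform SchwartzMap InnerProductSpace

noncomputable section

/-- The Euclidean space `ℝ^d`. -/
abbrev Rd (d : ℕ) : Type := EuclideanSpace ℝ (Fin d)

/-- `r ^ p / p`, read as `log r` when `p = 0`. -/
def powerLaw (p r : ℝ) : ℝ :=
  if p = 0 then Real.log r else r ^ p / p

/-- `W_{a,b}(x) = |x|^a / a - |x|^b / b` with values in `ℝ ∪ {∞}`. The value at the origin is the
limit of the values at `x → 0`: it is `∞` when `b ≤ 0` (and `b < a`), and `0` when `b > 0`. -/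
def Wab {d : ℕ} (a b : ℝ) (x : Rd d) : EReal :=
  if x = 0 ∧ b ≤ 0 then ⊤ else ((powerLaw a ‖x‖ - powerLaw b ‖x‖ : ℝ) : EReal)

/-- `W_{b,ln}(x) = (|x|^b / b) * ln |x|` with values in `ℝ ∪ {∞}`. The value at the origin is the
limit of the values at `x → 0`: it is `∞` when `b < 0`, and `0` when `b > 0`. -/
def Wbln {d : ℕ} (b : ℝ) (x : Rd d) : EReal :=
  if x = 0 ∧ b < 0 then ⊤ else ((‖x‖ ^ b / b * Real.log ‖x‖ : ℝ) : EReal)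

/-- The interaction energy `E[ρ] = 1/2 ∬ W(x - y) dρ(y) dρ(x)` of a positive measure, as an
extended real number (positive part minus negative part; the negative part is finite when `W` is
bounded below and `ρ` is finite). -/
def energy {d : ℕ} (W : Rd d → EReal) (ρ : Measure (Rd d)) : EReal :=
  ((1 / 2 : ℝ) : EReal) *
    (((∫⁻ x, ∫⁻ y, (W (x - y)).toENNReal ∂ρ ∂ρ : ℝ≥0∞) : EReal) -
      ((∫⁻ x, ∫⁻ y, (-W (x - y)).toENNReal ∂ρ ∂ρ : ℝ≥0∞) : EReal))

/-- The interaction energy `E[μ] = 1/2 ∬ W(x - y) dμ(y) dμ(x)` of a signed measure. It is used only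
for `μ` with `E[|μ|] < ∞`, when `W(x - y)` is `|μ| ⊗ |μ|`-integrable (hence finite a.e.). -/
def signedEnergy {d : ℕ} (W : Rd d → EReal) (μ : SignedMeasure (Rd d)) : ℝ :=
  (1 / 2) * ∫ᵛ x, (∫ᵛ y, (W (x - y)).toReal ∂<•μ) ∂<•μ

/-- The measure `(1 - t) ρ₀ + t ρ₁`, for `t ∈ [0, 1]`. -/
def interp {d : ℕ} (ρ₀ ρ₁ : Measure (Rd d)) (t : ℝ) : Measure (Rd d) :=
  ENNReal.ofReal (1 - t) • ρ₀ + ENNReal.ofReal t • ρ₁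

/-- Strict convexity on `[0, 1]` of a function with values in the extended reals. -/
def StrictConvexOnUnit (f : ℝ → EReal) : Prop :=
  ∀ s ∈ Icc (0 : ℝ) 1, ∀ t ∈ Icc (0 : ℝ) 1, s ≠ t → ∀ l ∈ Ioo (0 : ℝ) 1,
    f ((1 - l) * s + l * t) < ((1 - l : ℝ) : EReal) * f s + (l : EReal) * f t

/-- The probability measures on the closed ball of radius `R` about `0` which have finite energy
and whose center of mass is `0`. -/
def IsCenteredProb {d : ℕ} (W : Rd d → EReal) (R : ℝ≥0) (ρ : Measure (Rd d)) : Prop :=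
  IsProbabilityMeasure ρ ∧ ρ (closedBall 0 (R : ℝ))ᶜ = 0 ∧ energy W ρ < ⊤ ∧ ∫ x, x ∂ρ = 0

/-- The LIC radius of `W`, in `[0, ∞]`. -/
def LICRadius {d : ℕ} (W : Rd d → EReal) : ℝ≥0∞ :=
  ⨆ (R : ℝ≥0) (_ : ∀ ρ₀ ρ₁ : Measure (Rd d), ρ₀ ≠ ρ₁ →
      IsCenteredProb W R ρ₀ → IsCenteredProb W R ρ₁ →
      StrictConvexOnUnit (fun t => energy W (interp ρ₀ ρ₁ t))), (R : ℝ≥0∞)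

/-- The nontrivial signed measures `μ` supported on the closed ball of radius `R` about `0`, with
`E[|μ|] < ∞`, zero total mass and zero first moment. -/
def IsAdmissible {d : ℕ} (W : Rd d → EReal) (R : ℝ≥0) (μ : SignedMeasure (Rd d)) : Prop :=
  μ ≠ 0 ∧ μ.variation (closedBall 0 (R : ℝ))ᶜ = 0 ∧ energy W μ.variation < ⊤ ∧
    μ univ = 0 ∧ ∫ᵛ x, x ∂<•μ = 0

/-- The supremum of the `R ≥ 0` such that `E[μ] > 0` for all admissible `μ` on the ball of
radius `R`. -/
def energyRadius {d : ℕ} (W : Rd d → EReal) : ℝ≥0∞ :=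
  ⨆ (R : ℝ≥0) (_ : ∀ μ : SignedMeasure (Rd d), IsAdmissible W R μ → 0 < signedEnergy W μ),
    (R : ℝ≥0∞)

/-- The Fourier transform `∫ exp(-2πi x·ξ) dμ(x)` of a signed measure. -/
def signedFourier {d : ℕ} (μ : SignedMeasure (Rd d)) (ξ : Rd d) : ℂ :=
  ∫ᵛ x, Complex.exp (((-2 * Real.pi * ⟪x, ξ⟫_ℝ : ℝ) : ℂ) * Complex.I) ∂<•μ

/-- `W` is a tempered distribution, and the restriction of its Fourier transform to the open set
`ℝ^d \ {0}` is the locally integrable function `g`. (The potentials considered are finite except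
possibly at the origin, so that `toReal` changes them on a null set only.) -/
def IsFourierOffZero {d : ℕ} (W : Rd d → EReal) (g : Rd d → ℝ) : Prop :=
  LocallyIntegrableOn g {0}ᶜ ∧
  ∃ T : 𝓢'(Rd d, ℂ),
    (∀ φ : 𝓢(Rd d, ℂ), Integrable (fun x => ((W x).toReal : ℂ) * φ x) ∧
      T φ = ∫ x, ((W x).toReal : ℂ) * φ x) ∧
    ∀ φ : 𝓢(Rd d, ℂ), HasCompactSupport φ → (0 : Rd d) ∉ tsupport φ →
      (𝓕 T) φ = ∫ ξ, (g ξ : ℂ) * φ ξ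

/-- The supremum of the `R ≥ 0` such that `∫_{ℝ^d \ {0}} g(ξ) |μ̂(ξ)|² dξ > 0` for all admissible
`μ` on the ball of radius `R`. -/
def fourierRadius {d : ℕ} (W : Rd d → EReal) (g : Rd d → ℝ) : ℝ≥0∞ :=
  ⨆ (R : ℝ≥0) (_ : ∀ μ : SignedMeasure (Rd d), IsAdmissible W R μ →
      0 < ∫ ξ in {0}ᶜ, g ξ * ‖signedFourier μ ξ‖ ^ 2), (R : ℝ≥0∞)

/-- The Fourier transform of `W` is a locally integrable function `Ŵ` off the origin, the integrals
of `Ŵ |μ̂|²` over `ℝ^d \ {0}` converge absolutely for all admissible `μ`, and the LIC radius is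
given by their sign. (`Ŵ` is only determined up to null sets, hence the quantification.) -/
def HasFourierLICRadius {d : ℕ} (W : Rd d → EReal) : Prop :=
  (∃ g, IsFourierOffZero W g) ∧
  ∀ g, IsFourierOffZero W g →
    (∀ (R : ℝ≥0) (μ : SignedMeasure (Rd d)), IsAdmissible W R μ →
      IntegrableOn (fun ξ => g ξ * ‖signedFourier μ ξ‖ ^ 2) {0}ᶜ) ∧
    LICRadius W = fourierRadius W g

end

/-! ### Mixtures of Gaussians are positive definite -/

/-! Everything rests on writing the potential as a mixture of Gaussians. In the variable `ρ = |x|²`,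
the radial profile equals `∫ gaussRem t ρ · m(t) dt + B + C ρ`, where `gaussRem` is `exp (-tρ)` with
its first order Taylor polynomial removed for small `t`. Only the second derivative in `ρ` has to be
matched, and it is the Laplace transform of `t² m(t)`. For the powers `|x|^p` with `p < 4`, and for
their products with a logarithm, this is a Gamma integral (`isMixture_powerLaw`,
`isMixture_rpow_mul_log`).

Energy criterion. Along a segment the energy is a quadratic polynomial in `t` whose leading
coefficient is `E[ρ₁ - ρ₀]`, so strict convexity means that this number is positive. For this the
mutual energies must be finite. A singular potential is, up to a bounded function on each ball, a
mixture of Gaussians with nonnegative density. Such a mixture is positive definite, so its cross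
terms are controlled by its self energies (`lintegral_gaussMix_cross_le`,
`IsGaussianLike.mutualPos_lt_top`). Conversely, an admissible `μ = α - β` becomes a positive
multiple of a difference of centered probability measures once the reflection of `α` is added to
both parts (`IsGaussianLike.LICRadius_eq_energyRadius`).

Fourier criterion. Zero mass and zero first moment annihilate `B + C|x - y|²` as well as the Taylor
polynomials, so the energy is a superposition of Gaussian energies. Each of these equals `∫ gaussHat
t |μ̂|²`, and exchanging the integrals gives `E[μ] = 1/2 ∫ mixHat m |μ̂|²`
(`HasMixture.signedEnergy_eq`). The exchange is legitimate because `gaussHat t |μ̂|²` is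
nonnegative. The same cancellation against test functions vanishing near `0` shows that `mixHat m`
is the Fourier transform of `W` off the origin (`HasMixture.isFourierOffZero_mixHat`), and
`IsFourierOffZero.ae_eq` makes the choice of representative irrelevant. -/

theorem lintegral_kernel_mul {X P : Type*} [MeasurableSpace X] [MeasurableSpace P]
    (τ : Measure P) [SFinite τ] (α β : Measure X) [SFinite α] [SFinite β]
    {g : P → X → ℝ≥0∞} (hg : Measurable (Function.uncurry g)) :
    ∫⁻ x, ∫⁻ y, ∫⁻ p, g p x * g p y ∂τ ∂β ∂α = ∫⁻ p, (∫⁻ x, g p x ∂α) * ∫⁻ y, g p y ∂β ∂τ := by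
  have hgx : ∀ x, Measurable fun p => g p x := fun x => hg.comp (measurable_id.prodMk measurable_const)
  have hgp : ∀ p, Measurable (g p) := fun p => hg.comp (measurable_const.prodMk measurable_id)
  have h1 : ∀ x, ∫⁻ y, ∫⁻ p, g p x * g p y ∂τ ∂β = ∫⁻ p, g p x * ∫⁻ y, g p y ∂β ∂τ := by
    intro x
    rw [lintegral_lintegral_swap]
    · exact lintegral_congr fun p => lintegral_const_mul _ (hgp p)
    · refine Measurable.aemeasurable ?_
      exact ((hgx x).comp measurable_snd).mul (hg.comp (measurable_snd.prodMk measurable_fst))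
  simp_rw [h1]
  rw [lintegral_lintegral_swap]
  · exact lintegral_congr fun p => lintegral_mul_const _ (hgp p)
  · refine Measurable.aemeasurable ?_
    refine (hg.comp (measurable_snd.prodMk measurable_fst)).mul ?_
    exact (Measurable.lintegral_prod_right' (ν := β) hg).comp measurable_snd

theorem ENNReal.mul_le_mul_self_add_mul_self (a b : ℝ≥0∞) : a * b ≤ a * a + b * b := by
  rcases le_total a b with h | h
  · exact (mul_le_mul_left h b).trans le_add_self
  · exact (mul_le_mul_right h a).trans le_self_add

/-- After Tonelli the cross term is `∫ A(p) B(p) dτ`, and `AB ≤ A² + B²` pointwise. The crude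
constant suffices because only finiteness is needed later. -/
theorem lintegral_kernel_cross_le {X P : Type*} [MeasurableSpace X] [MeasurableSpace P]
    (τ : Measure P) [SFinite τ] (α β : Measure X) [SFinite α] [SFinite β]
    {g : P → X → ℝ≥0∞} (hg : Measurable (Function.uncurry g)) :
    ∫⁻ x, ∫⁻ y, ∫⁻ p, g p x * g p y ∂τ ∂β ∂α ≤
      ∫⁻ x, ∫⁻ y, ∫⁻ p, g p x * g p y ∂τ ∂α ∂α + ∫⁻ x, ∫⁻ y, ∫⁻ p, g p x * g p y ∂τ ∂β ∂β := by
  simp_rw [lintegral_kernel_mul τ _ _ hg]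
  have hm : Measurable fun p => ∫⁻ x, g p x ∂α := Measurable.lintegral_prod_right' (ν := α) hg
  exact (lintegral_mono fun p => ENNReal.mul_le_mul_self_add_mul_self _ _).trans
    (lintegral_add_left (hm.mul hm) _).le

/-- By the parallelogram law `|x - z|² + |y - z|² = |x - y|² / 2 + 2 |z - (x + y)/2|²`. The product
of two Gaussians of rate `2t` centered at `z` is thus the kernel times a Gaussian of rate `4t` about
the midpoint, which integrates to a constant. This factorization is what makes the Gaussian kernel
positive definite. -/
theorem exp_neg_sq_dist_eq_lintegral {d : ℕ} {t : ℝ} (ht : 0 < t) (x y : Rd d) :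
    ENNReal.ofReal (Real.exp (-t * ‖x - y‖ ^ 2)) =
      ENNReal.ofReal ((Real.pi / (4 * t)) ^ (d / 2 : ℝ))⁻¹ *
        ∫⁻ z : Rd d, ENNReal.ofReal (Real.exp (-2 * t * ‖x - z‖ ^ 2)) *
          ENNReal.ofReal (Real.exp (-2 * t * ‖y - z‖ ^ 2)) := by
  have key : ∀ z : Rd d, ENNReal.ofReal (Real.exp (-2 * t * ‖x - z‖ ^ 2)) *
      ENNReal.ofReal (Real.exp (-2 * t * ‖y - z‖ ^ 2)) =
      ENNReal.ofReal (Real.exp (-t * ‖x - y‖ ^ 2)) *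
        ENNReal.ofReal (Real.exp (-(4 * t) * ‖z - (1 / 2 : ℝ) • (x + y)‖ ^ 2)) := by
    intro z
    rw [← ENNReal.ofReal_mul (Real.exp_nonneg _), ← ENNReal.ofReal_mul (Real.exp_nonneg _),
      ← Real.exp_add, ← Real.exp_add]
    have hp := parallelogram_law_with_norm ℝ (x - z) (y - z)
    have e1 : x - z - (y - z) = x - y := by abel
    have e2 : x - z + (y - z) = (-2 : ℝ) • (z - (1 / 2 : ℝ) • (x + y)) := by module
    rw [e1, e2, norm_smul] at hp
    norm_num at hp
    congr 2
    norm_num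
    linear_combination (t) * hp
  simp_rw [key]
  rw [lintegral_const_mul _ (by fun_prop),
    lintegral_sub_right_eq_self (fun z : Rd d => ENNReal.ofReal (Real.exp (-(4 * t) * ‖z‖ ^ 2)))]
  have hI := GaussianFourier.integral_rexp_neg_mul_sq_norm (V := Rd d) (b := 4 * t) (by positivity)
  rw [finrank_euclideanSpace, Fintype.card_fin] at hI
  have hpos : 0 < (Real.pi / (4 * t)) ^ (d / 2 : ℝ) := by positivity
  rw [← ofReal_integral_eq_lintegral_ofReal _ (Filter.Eventually.of_forall fun _ => Real.exp_nonneg _),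
    hI, mul_left_comm, ← ENNReal.ofReal_mul (by positivity), inv_mul_cancel₀ hpos.ne', ENNReal.ofReal_one,
    mul_one]
  by_contra h
  rw [integral_undef h] at hI
  exact hpos.ne hI

/-- The kernel `∫_{t > 0} exp (-t |x|²) k(t) dt`. -/
noncomputable def gaussMix {d : ℕ} (k : ℝ → ℝ≥0∞) (x : Rd d) : ℝ≥0∞ :=
  ∫⁻ t in Ioi 0, ENNReal.ofReal (Real.exp (-t * ‖x‖ ^ 2)) * k t

/-- The feature space is the set of pairs `(t, z)`, with the mixing weight and the Gaussian
normalization absorbed into the measure. -/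
theorem lintegral_gaussMix_cross_le {d : ℕ} {k : ℝ → ℝ≥0∞} (hk : Measurable k)
    (α β : Measure (Rd d)) [SFinite α] [SFinite β] :
    ∫⁻ x, ∫⁻ y, gaussMix k (x - y) ∂β ∂α ≤
      ∫⁻ x, ∫⁻ y, gaussMix k (x - y) ∂α ∂α + ∫⁻ x, ∫⁻ y, gaussMix k (x - y) ∂β ∂β := by
  let c : ℝ → ℝ≥0∞ := fun t => ENNReal.ofReal ((Real.pi / (4 * t)) ^ (d / 2 : ℝ))⁻¹
  have hc : Measurable c := by fun_prop
  let τ : Measure (ℝ × Rd d) :=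
    ((volume.restrict (Ioi 0)).withDensity (k * c)).prod volume
  let g : ℝ × Rd d → Rd d → ℝ≥0∞ := fun p x => ENNReal.ofReal (Real.exp (-2 * p.1 * ‖x - p.2‖ ^ 2))
  have hg : Measurable (Function.uncurry g) := by
    unfold g Function.uncurry
    fun_prop
  have key : ∀ x y : Rd d, gaussMix k (x - y) = ∫⁻ p, g p x * g p y ∂τ := by
    intro x y
    rw [lintegral_prod _ (by fun_prop), lintegral_withDensity_eq_lintegral_mul _ (hk.mul hc)]
    · refine setLIntegral_congr_fun measurableSet_Ioi fun t ht => ?_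
      simp only [Pi.mul_apply]
      rw [exp_neg_sq_dist_eq_lintegral ht]
      ring
    · exact Measurable.lintegral_prod_right' (f := fun p => g p x * g p y) (by fun_prop)
  simp_rw [key]
  exact lintegral_kernel_cross_le τ α β hg

/-! ### Energies for potentials comparable to a mixture of Gaussians -/

/-- An even potential which differs, on each ball, from a mixture of Gaussians by a bounded
function. -/
structure IsGaussianLike {d : ℕ} (W : Rd d → EReal) : Prop where
  measurable : Measurable W
  even : ∀ x, W (-x) = W x
  exists_mixture : ∃ k : ℝ → ℝ≥0∞, Measurable k ∧ ∀ R : ℝ, ∃ C : ℝ≥0, ∀ x, ‖x‖ ≤ R →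
    (W x).toENNReal ≤ gaussMix k x + C ∧ gaussMix k x ≤ (W x).toENNReal + C ∧
      (-W x).toENNReal ≤ C

theorem EReal.toReal_eq_toENNReal_sub (x : EReal) :
    x.toReal = x.toENNReal.toReal - (-x).toENNReal.toReal := by
  induction x with
  | bot => simp
  | top => simp
  | coe x =>
    rw [← EReal.coe_neg]
    simp only [EReal.toReal_coe, EReal.real_coe_toENNReal]
    rcases le_total 0 x with h | h
    · rw [ENNReal.toReal_ofReal h, ENNReal.ofReal_of_nonpos (neg_nonpos.2 h)]
      simp
    · rw [ENNReal.toReal_ofReal (neg_nonneg.2 h), ENNReal.ofReal_of_nonpos h]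
      simp

theorem integral_sub_toSignedMeasure {E : Type*} [NormedAddCommGroup E] [NormedSpace ℝ E]
    {X : Type*} [MeasurableSpace X] {α β : Measure X} [IsFiniteMeasure α]
    [IsFiniteMeasure β] {f : X → E} (hα : Integrable f α) (hβ : Integrable f β) :
    ∫ᵛ x, f x ∂<•(α.toSignedMeasure - β.toSignedMeasure) = ∫ x, f x ∂α - ∫ x, f x ∂β := by
  rw [VectorMeasure.integral_sub_vectorMeasure, VectorMeasure.integral_toSignedMeasure,
    VectorMeasure.integral_toSignedMeasure]
  · simpa [VectorMeasure.Integrable] using hα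
  · simpa [VectorMeasure.Integrable] using hβ

section Energy

variable {d : ℕ} {W : Rd d → EReal}

theorem ae_norm_le_of_closedBall_compl {R : ℝ} {α : Measure (Rd d)}
    (hα : α (closedBall 0 R)ᶜ = 0) : ∀ᵐ x ∂α, ‖x‖ ≤ R := by
  filter_upwards [measure_eq_zero_iff_ae_notMem.1 hα] with x hx
  simpa using hx

theorem lintegral_sub_le_of_le_on_ball {R : ℝ} {α β : Measure (Rd d)}
    (hα : ∀ᵐ x ∂α, ‖x‖ ≤ R) (hβ : ∀ᵐ x ∂β, ‖x‖ ≤ R)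
    {f g : Rd d → ℝ≥0∞} {C : ℝ≥0} (hfg : ∀ x, ‖x‖ ≤ 2 * R → f x ≤ g x + C) :
    ∫⁻ x, ∫⁻ y, f (x - y) ∂β ∂α ≤ ∫⁻ x, ∫⁻ y, g (x - y) ∂β ∂α + C * β univ * α univ := by
  calc ∫⁻ x, ∫⁻ y, f (x - y) ∂β ∂α
      ≤ ∫⁻ x, (∫⁻ y, g (x - y) ∂β + C * β univ) ∂α := by
        refine lintegral_mono_ae ?_
        filter_upwards [hα] with x hx
        rw [← lintegral_const, ← lintegral_add_right _ measurable_const]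
        refine lintegral_mono_ae ?_
        filter_upwards [hβ] with y hy
        exact hfg _ ((norm_sub_le x y).trans (by linarith))
    _ = _ := by rw [lintegral_add_right _ measurable_const, lintegral_const]

/-- The part of the mutual energy of two measures coming from the positive part of `W`. -/
noncomputable def mutualPos (W : Rd d → EReal) (α β : Measure (Rd d)) : ℝ≥0∞ :=
  ∫⁻ x, ∫⁻ y, (W (x - y)).toENNReal ∂β ∂α

/-- Twice the mutual energy of two measures. -/
noncomputable def mutualEnergy (W : Rd d → EReal) (α β : Measure (Rd d)) : ℝ :=
  ∫ p, (W (p.1 - p.2)).toReal ∂α.prod β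

theorem mutualPos_mono (W : Rd d → EReal) {α β α' β' : Measure (Rd d)} (hα : α ≤ α')
    (hβ : β ≤ β') : mutualPos W α β ≤ mutualPos W α' β' :=
  lintegral_mono' hα fun _ => lintegral_mono' hβ le_rfl

namespace IsGaussianLike

theorem measurable_sub (hW : IsGaussianLike W) :
    Measurable fun p : Rd d × Rd d => (W (p.1 - p.2)).toENNReal :=
  (hW.measurable.comp (measurable_fst.sub measurable_snd)).ereal_toENNReal

theorem measurable_neg_sub (hW : IsGaussianLike W) :
    Measurable fun p : Rd d × Rd d => (-W (p.1 - p.2)).toENNReal :=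
  (hW.measurable.comp (measurable_fst.sub measurable_snd)).neg.ereal_toENNReal

theorem mutualPos_eq_lintegral_prod (hW : IsGaussianLike W) (α β : Measure (Rd d)) [SFinite β] :
    mutualPos W α β = ∫⁻ p, (W (p.1 - p.2)).toENNReal ∂α.prod β :=
  (lintegral_prod _ hW.measurable_sub.aemeasurable).symm

variable {R : ℝ} {α β : Measure (Rd d)} [IsFiniteMeasure α] [IsFiniteMeasure β]

theorem lintegral_neg_lt_top (hW : IsGaussianLike W) (hα : ∀ᵐ x ∂α, ‖x‖ ≤ R)
    (hβ : ∀ᵐ x ∂β, ‖x‖ ≤ R) : ∫⁻ x, ∫⁻ y, (-W (x - y)).toENNReal ∂β ∂α < ⊤ := by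
  obtain ⟨k, -, hk⟩ := hW.exists_mixture
  obtain ⟨C, hC⟩ := hk (2 * R)
  refine (lintegral_sub_le_of_le_on_ball (f := fun z => (-W z).toENNReal) (g := 0) (C := C) hα hβ
    fun x hx => ?_).trans_lt ?_
  · simpa using (hC x hx).2.2
  · simpa using ENNReal.mul_lt_top (ENNReal.mul_lt_top ENNReal.coe_lt_top (measure_lt_top _ _))
      (measure_lt_top _ _)

/-- Passing from `W` to the Gaussian mixture and back costs a constant times the masses, on the ball
of radius `2R` containing all differences `x - y`. For the mixture itself, positive definiteness
bounds the cross term. -/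
theorem mutualPos_lt_top (hW : IsGaussianLike W) (hα : ∀ᵐ x ∂α, ‖x‖ ≤ R)
    (hβ : ∀ᵐ x ∂β, ‖x‖ ≤ R) (hαα : mutualPos W α α < ⊤) (hββ : mutualPos W β β < ⊤) :
    mutualPos W α β < ⊤ := by
  obtain ⟨k, hkm, hk⟩ := hW.exists_mixture
  obtain ⟨C, hC⟩ := hk (2 * R)
  have hfin : ∀ (γ δ : Measure (Rd d)) [IsFiniteMeasure γ] [IsFiniteMeasure δ],
      C * γ univ * δ univ < ⊤ := fun γ δ _ _ =>
    ENNReal.mul_lt_top (ENNReal.mul_lt_top ENNReal.coe_lt_top (measure_lt_top _ _))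
      (measure_lt_top _ _)
  refine (lintegral_sub_le_of_le_on_ball hα hβ fun x hx => (hC x hx).1).trans_lt ?_
  refine ENNReal.add_lt_top.2 ⟨?_, hfin _ _⟩
  refine (lintegral_gaussMix_cross_le hkm α β).trans_lt (ENNReal.add_lt_top.2 ⟨?_, ?_⟩)
  · exact (lintegral_sub_le_of_le_on_ball hα hα fun x hx => (hC x hx).2.1).trans_lt
      (ENNReal.add_lt_top.2 ⟨hαα, hfin _ _⟩)
  · exact (lintegral_sub_le_of_le_on_ball hβ hβ fun x hx => (hC x hx).2.1).trans_lt
      (ENNReal.add_lt_top.2 ⟨hββ, hfin _ _⟩)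

theorem mutualPos_add_self_lt_top (hW : IsGaussianLike W) (hα : ∀ᵐ x ∂α, ‖x‖ ≤ R)
    (hβ : ∀ᵐ x ∂β, ‖x‖ ≤ R) (hαα : mutualPos W α α < ⊤) (hββ : mutualPos W β β < ⊤) :
    mutualPos W (α + β) (α + β) < ⊤ := by
  have h1 := hW.mutualPos_lt_top hα hβ hαα hββ
  have h2 := hW.mutualPos_lt_top hβ hα hββ hαα
  rw [hW.mutualPos_eq_lintegral_prod] at h1 h2 hαα hββ ⊢
  simp only [Measure.prod_add, Measure.add_prod, lintegral_add_measure, ENNReal.add_lt_top]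
  tauto

theorem mutualPos_smul_self_lt_top (hW : IsGaussianLike W) (c : ℝ≥0)
    (hαα : mutualPos W α α < ⊤) : mutualPos W (c • α) (c • α) < ⊤ := by
  rw [hW.mutualPos_eq_lintegral_prod] at hαα ⊢
  rw [Measure.prod_smul_left, Measure.prod_smul_right, lintegral_smul_measure,
    lintegral_smul_measure]
  exact ENNReal.mul_lt_top ENNReal.coe_lt_top (ENNReal.mul_lt_top ENNReal.coe_lt_top hαα)

theorem mutualPos_map_neg (hW : IsGaussianLike W) :
    mutualPos W (α.map Neg.neg) (α.map Neg.neg) = mutualPos W α α := by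
  have hm : ∀ x, Measurable fun y => (W (x - y)).toENNReal := fun x =>
    hW.measurable_sub.comp (measurable_const.prodMk measurable_id)
  unfold mutualPos
  rw [lintegral_map (Measurable.lintegral_prod_right' hW.measurable_sub) measurable_neg]
  refine lintegral_congr fun x => ?_
  rw [lintegral_map (hm _) measurable_neg]
  refine lintegral_congr fun y => ?_
  rw [← hW.even (x - y)]
  congr 2
  abel

theorem integrable_prod (hW : IsGaussianLike W) (hα : ∀ᵐ x ∂α, ‖x‖ ≤ R)
    (hβ : ∀ᵐ x ∂β, ‖x‖ ≤ R) (h : mutualPos W α β < ⊤) :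
    Integrable (fun p : Rd d × Rd d => (W (p.1 - p.2)).toReal) (α.prod β) := by
  simp_rw [EReal.toReal_eq_toENNReal_sub]
  refine Integrable.sub ?_ ?_
  · refine integrable_toReal_of_lintegral_ne_top hW.measurable_sub.aemeasurable ?_
    rw [← hW.mutualPos_eq_lintegral_prod]
    exact h.ne
  · refine integrable_toReal_of_lintegral_ne_top hW.measurable_neg_sub.aemeasurable ?_
    rw [lintegral_prod _ hW.measurable_neg_sub.aemeasurable]
    exact (hW.lintegral_neg_lt_top hα hβ).ne

theorem energy_eq (hW : IsGaussianLike W) (hα : ∀ᵐ x ∂α, ‖x‖ ≤ R) (h : mutualPos W α α < ⊤) :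
    energy W α = ((1 / 2 * mutualEnergy W α α : ℝ) : EReal) := by
  have hN := hW.lintegral_neg_lt_top hα hα
  have e : mutualEnergy W α α = (∫⁻ x, ∫⁻ y, (W (x - y)).toENNReal ∂α ∂α).toReal -
      (∫⁻ x, ∫⁻ y, (-W (x - y)).toENNReal ∂α ∂α).toReal := by
    have hP' := h
    rw [hW.mutualPos_eq_lintegral_prod] at hP'
    have hN' := hN
    rw [← lintegral_prod _ hW.measurable_neg_sub.aemeasurable] at hN'
    rw [← lintegral_prod _ hW.measurable_neg_sub.aemeasurable,
      ← lintegral_prod _ hW.measurable_sub.aemeasurable,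
      ← integral_toReal hW.measurable_sub.aemeasurable (ae_lt_top hW.measurable_sub hP'.ne),
      ← integral_toReal hW.measurable_neg_sub.aemeasurable (ae_lt_top hW.measurable_neg_sub hN'.ne),
      ← integral_sub]
    · exact integral_congr_ae (.of_forall fun p => EReal.toReal_eq_toENNReal_sub _)
    · exact integrable_toReal_of_lintegral_ne_top hW.measurable_sub.aemeasurable hP'.ne
    · exact integrable_toReal_of_lintegral_ne_top hW.measurable_neg_sub.aemeasurable hN'.ne
  rw [mutualPos] at h
  rw [energy, e, EReal.coe_mul, EReal.coe_sub, EReal.coe_ennreal_toReal h.ne,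
    EReal.coe_ennreal_toReal hN.ne]

theorem energy_lt_top_iff (hW : IsGaussianLike W) (hα : ∀ᵐ x ∂α, ‖x‖ ≤ R) :
    energy W α < ⊤ ↔ mutualPos W α α < ⊤ := by
  refine ⟨fun h => ?_, fun h => ?_⟩
  · by_contra hn
    have hP : ∫⁻ x, ∫⁻ y, (W (x - y)).toENNReal ∂α ∂α = ⊤ := not_lt_top_iff.1 hn
    rw [energy, hP, ← EReal.coe_ennreal_toReal (hW.lintegral_neg_lt_top hα hα).ne,
      EReal.coe_ennreal_top, EReal.top_sub_coe, EReal.coe_mul_top_of_pos (by norm_num)] at h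
    exact lt_irrefl _ h
  · rw [hW.energy_eq hα h]
    exact EReal.coe_lt_top _

theorem mutualEnergy_interp (hW : IsGaussianLike W) (hα : ∀ᵐ x ∂α, ‖x‖ ≤ R)
    (hβ : ∀ᵐ x ∂β, ‖x‖ ≤ R) (hαα : mutualPos W α α < ⊤) (hββ : mutualPos W β β < ⊤) (a b : ℝ≥0) :
    mutualEnergy W (a • α + b • β) (a • α + b • β) =
      a ^ 2 * mutualEnergy W α α + a * b * (mutualEnergy W α β + mutualEnergy W β α) +
        b ^ 2 * mutualEnergy W β β := by
  have i1 := hW.integrable_prod hα hα hαα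
  have i2 := hW.integrable_prod hα hβ (hW.mutualPos_lt_top hα hβ hαα hββ)
  have i3 := hW.integrable_prod hβ hα (hW.mutualPos_lt_top hβ hα hββ hαα)
  have i4 := hW.integrable_prod hβ hβ hββ
  have s : ∀ {γ : Measure (Rd d × Rd d)} (c : ℝ≥0),
      Integrable (fun p : Rd d × Rd d => (W (p.1 - p.2)).toReal) γ →
      Integrable (fun p : Rd d × Rd d => (W (p.1 - p.2)).toReal) (c • γ) := fun c h =>
    h.smul_measure_nnreal
  unfold mutualEnergy
  rw [Measure.prod_add, Measure.add_prod, Measure.add_prod]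
  simp only [Measure.prod_smul_left, Measure.prod_smul_right]
  rw [integral_add_measure ((s _ (s _ i1)).add_measure (s _ (s _ i3)))
      ((s _ (s _ i2)).add_measure (s _ (s _ i4))),
    integral_add_measure (s _ (s _ i1)) (s _ (s _ i3)),
    integral_add_measure (s _ (s _ i2)) (s _ (s _ i4))]
  simp only [integral_smul_nnreal_measure, NNReal.smul_def, smul_eq_mul]
  ring

theorem signedEnergy_sub (hW : IsGaussianLike W) (hα : ∀ᵐ x ∂α, ‖x‖ ≤ R)
    (hβ : ∀ᵐ x ∂β, ‖x‖ ≤ R) (hαα : mutualPos W α α < ⊤) (hββ : mutualPos W β β < ⊤) :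
    signedEnergy W (α.toSignedMeasure - β.toSignedMeasure) =
      1 / 2 * (mutualEnergy W α α - (mutualEnergy W α β + mutualEnergy W β α) +
        mutualEnergy W β β) := by
  have i1 := hW.integrable_prod hα hα hαα
  have i2 := hW.integrable_prod hα hβ (hW.mutualPos_lt_top hα hβ hαα hββ)
  have i3 := hW.integrable_prod hβ hα (hW.mutualPos_lt_top hβ hα hββ hαα)
  have i4 := hW.integrable_prod hβ hβ hββ
  have hae : ∀ᵐ x ∂(α.toSignedMeasure - β.toSignedMeasure).variation,
      ∫ᵛ y, (W (x - y)).toReal ∂<•(α.toSignedMeasure - β.toSignedMeasure) =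
        ∫ y, (W (x - y)).toReal ∂α - ∫ y, (W (x - y)).toReal ∂β := by
    -- The inner integral splits only where both slices are integrable. This holds almost everywhere
    -- for `α` and for `β`, hence for the variation, which `α + β` dominates.
    have hle : (α.toSignedMeasure - β.toSignedMeasure).variation ≤ α + β := by
      refine VectorMeasure.variation_sub_le.trans_eq ?_
      simp
    refine (Measure.absolutelyContinuous_of_le hle).ae_le (ae_add_measure_iff.2 ⟨?_, ?_⟩)
    · filter_upwards [i1.prod_right_ae, i2.prod_right_ae] with x h1 h2 using integral_sub_toSignedMeasure h1 h2
    · filter_upwards [i3.prod_right_ae, i4.prod_right_ae] with x h1 h2 using integral_sub_toSignedMeasure h1 h2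
  have j1 : Integrable (fun x => ∫ y, (W (x - y)).toReal ∂α) α := i1.integral_prod_left
  have j2 : Integrable (fun x => ∫ y, (W (x - y)).toReal ∂β) α := i2.integral_prod_left
  have j3 : Integrable (fun x => ∫ y, (W (x - y)).toReal ∂α) β := i3.integral_prod_left
  have j4 : Integrable (fun x => ∫ y, (W (x - y)).toReal ∂β) β := i4.integral_prod_left
  rw [signedEnergy, VectorMeasure.integral_congr_ae hae,
    integral_sub_toSignedMeasure
      (f := fun x => ∫ y, (W (x - y)).toReal ∂α - ∫ y, (W (x - y)).toReal ∂β)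
      (j1.sub j2) (j3.sub j4),
    integral_sub j1 j2, integral_sub j3 j4]
  simp only [mutualEnergy, integral_prod _ i1, integral_prod _ i2, integral_prod _ i3,
    integral_prod _ i4]
  ring

end IsGaussianLike

end Energy

/-! ### Strict convexity along segments and positivity of the energy -/

section LIC

variable {d : ℕ} {W : Rd d → EReal}

/-- The convexity gap of a quadratic is `l (1 - l) (s - t)²` times its leading coefficient, here `(D
- M + A) / 2`. The midpoint of `0` and `1` already detects the sign. -/
theorem strictConvexOnUnit_iff_of_quadratic {f : ℝ → EReal} {A M D : ℝ}
    (hf : ∀ t ∈ Icc (0 : ℝ) 1,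
      f t = ((1 / 2 * ((1 - t) ^ 2 * A + (1 - t) * t * M + t ^ 2 * D) : ℝ) : EReal)) :
    StrictConvexOnUnit f ↔ 0 < D - M + A := by
  constructor
  · intro h
    have h0 := h 0 (by simp) 1 (by simp) (by simp) (1 / 2) (by norm_num)
    rw [hf _ (by norm_num), hf 0 (by simp), hf 1 (by simp), ← EReal.coe_mul, ← EReal.coe_mul,
      ← EReal.coe_add, EReal.coe_lt_coe_iff] at h0
    norm_num at h0
    linarith
  · intro h s hs t ht hst l hl
    have hm : (1 - l) * s + l * t ∈ Icc (0 : ℝ) 1 := by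
      have h1 : 0 ≤ 1 - l := by linarith [hl.2]
      constructor
      · nlinarith [hs.1, ht.1, hl.1, mul_nonneg h1 hs.1, mul_nonneg hl.1.le ht.1]
      · nlinarith [hs.2, ht.2, hl.1, mul_nonneg h1 (sub_nonneg.2 hs.2),
          mul_nonneg hl.1.le (sub_nonneg.2 ht.2)]
    rw [hf _ hm, hf s hs, hf t ht, ← EReal.coe_mul, ← EReal.coe_mul, ← EReal.coe_add,
      EReal.coe_lt_coe_iff]
    have hpos : 0 < l * (1 - l) * (s - t) ^ 2 * (D - M + A) := by
      have h1 : 0 < 1 - l := by linarith [hl.2]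
      have h2 : 0 < (s - t) ^ 2 := by
        have := sub_ne_zero.2 hst
        positivity
      have h3 := hl.1
      positivity
    linear_combination (1 / 2) * hpos

theorem signedEnergy_smul (W : Rd d → EReal) (c : ℝ≥0) (μ : SignedMeasure (Rd d)) :
    signedEnergy W (c • μ) = c ^ 2 * signedEnergy W μ := by
  have h : ∀ f : Rd d → ℝ, ∫ᵛ x, (c : ℝ) * f x ∂<•μ = c * ∫ᵛ x, f x ∂<•μ := fun f =>
    VectorMeasure.integral_fun_smul _ _ (c : ℝ) f
  simp only [signedEnergy, VectorMeasure.integral_smul_nnreal_vectorMeasure]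
  simp only [NNReal.smul_def, smul_eq_mul, h]
  ring

theorem Integrable.id_of_ae_norm_le {R : ℝ} {α : Measure (Rd d)} [IsFiniteMeasure α]
    (hα : ∀ᵐ x ∂α, ‖x‖ ≤ R) : Integrable (fun x : Rd d => x) α :=
  Integrable.of_bound measurable_id.aestronglyMeasurable R hα

namespace IsGaussianLike

theorem strictConvexOnUnit_iff (hW : IsGaussianLike W) {R : ℝ} {α β : Measure (Rd d)}
    [IsFiniteMeasure α] [IsFiniteMeasure β] (hα : ∀ᵐ x ∂α, ‖x‖ ≤ R) (hβ : ∀ᵐ x ∂β, ‖x‖ ≤ R)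
    (hαα : mutualPos W α α < ⊤) (hββ : mutualPos W β β < ⊤) :
    StrictConvexOnUnit (fun t => energy W (interp α β t)) ↔
      0 < signedEnergy W (β.toSignedMeasure - α.toSignedMeasure) := by
  rw [hW.signedEnergy_sub hβ hα hββ hαα]
  have hf : ∀ t ∈ Icc (0 : ℝ) 1, energy W (interp α β t) =
      ((1 / 2 * ((1 - t) ^ 2 * mutualEnergy W α α +
        (1 - t) * t * (mutualEnergy W α β + mutualEnergy W β α) +
        t ^ 2 * mutualEnergy W β β) : ℝ) : EReal) := by
    intro t ht
    have e : interp α β t = (1 - t).toNNReal • α + t.toNNReal • β := rfl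
    have hs : ∀ {γ : Measure (Rd d)} (c : ℝ≥0), (∀ᵐ x ∂γ, ‖x‖ ≤ R) → ∀ᵐ x ∂(c • γ), ‖x‖ ≤ R :=
      fun c h => Measure.ae_smul_measure h c
    rw [e, hW.energy_eq (ae_add_measure_iff.2 ⟨hs _ hα, hs _ hβ⟩)
      (hW.mutualPos_add_self_lt_top (hs _ hα) (hs _ hβ) (hW.mutualPos_smul_self_lt_top _ hαα)
        (hW.mutualPos_smul_self_lt_top _ hββ)), hW.mutualEnergy_interp hα hβ hαα hββ,
      Real.coe_toNNReal _ (sub_nonneg.2 ht.2), Real.coe_toNNReal _ ht.1]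
  rw [strictConvexOnUnit_iff_of_quadratic hf, add_comm (mutualEnergy W α β)]
  constructor <;> intro h <;> linarith

/-- The two conditions agree for each `R` separately. Differences of centered probability measures
are admissible, and every admissible measure is such a difference up to a positive factor. -/
theorem LICRadius_eq_energyRadius (hW : IsGaussianLike W) : LICRadius W = energyRadius W := by
  refine iSup_congr fun R => iSup_congr_Prop ?_ fun _ => rfl
  constructor
  · intro h μ hμ
    obtain ⟨hμ0, hμR, hμE, hμ1, hμx⟩ := hμ
    set α := μ.toJordanDecomposition.posPart
    set β := μ.toJordanDecomposition.negPart
    have hvar : μ.variation = α + β := μ.totalVariation_eq_variation.symm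
    have hsub : α.toSignedMeasure - β.toSignedMeasure = μ :=
      μ.toSignedMeasure_toJordanDecomposition
    have hae := ae_norm_le_of_closedBall_compl hμR
    rw [hvar] at hae hμE
    have hαβ := (hW.energy_lt_top_iff hae).1 hμE
    obtain ⟨hα, hβ⟩ := ae_add_measure_iff.1 hae
    have hαα := (mutualPos_mono W (Measure.le_add_right le_rfl) (Measure.le_add_right le_rfl)).trans_lt hαβ
    have hββ := (mutualPos_mono W (Measure.le_add_left le_rfl) (Measure.le_add_left le_rfl)).trans_lt hαβ
    -- Adding the reflection of `α` to both `α` and `β` leaves the difference unchanged and moves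
    -- both centers of mass to `0`, since `α` and `β` have the same first moment. The ball and the
    -- finiteness of the energy are preserved because both are invariant under reflection.
    set σ := α.map Neg.neg
    have hσ : ∀ᵐ x ∂σ, ‖x‖ ≤ R := by
      rw [ae_map_iff measurable_neg.aemeasurable (measurableSet_le measurable_norm measurable_const)]
      simpa using hα
    have hσσ : mutualPos W σ σ < ⊤ := by rwa [hW.mutualPos_map_neg]
    have hmass : α univ = β univ := by
      rw [← hsub, Measure.toSignedMeasure_sub_apply MeasurableSet.univ, sub_eq_zero] at hμ1
      exact (measureReal_eq_measureReal_iff).1 hμ1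
    have hα0 : α univ ≠ 0 := by
      intro h0
      have h1 : β = 0 := Measure.measure_univ_eq_zero.1 (hmass ▸ h0)
      have h2 : α = 0 := Measure.measure_univ_eq_zero.1 h0
      apply hμ0
      rw [← hsub]
      simp [h1, h2]
    have hσu : σ univ = α univ := by simp [σ, Measure.map_apply measurable_neg MeasurableSet.univ]
    have hM0 : α univ + α univ ≠ 0 := by simpa using hα0
    have hMt : α univ + α univ ≠ ⊤ := by simp
    -- All of `α`, `β` and `σ` have the same mass, so this factor normalizes both sums.
    set c : ℝ≥0 := (α univ + α univ).toNNReal⁻¹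
    have hN0 : (α univ + α univ).toNNReal ≠ 0 := by simp [ENNReal.toNNReal_eq_zero_iff, hM0, hMt]
    have hc0 : c ≠ 0 := inv_ne_zero hN0
    have hcM : (c : ℝ≥0∞) * (α univ + α univ) = 1 := by
      rw [← ENNReal.coe_toNNReal hMt, ← ENNReal.coe_mul, inv_mul_cancel₀ hN0, ENNReal.coe_one]
    have hρ : (c • (α + σ)).toSignedMeasure - (c • (β + σ)).toSignedMeasure = c • μ := by
      rw [Measure.toSignedMeasure_smul, Measure.toSignedMeasure_smul, Measure.toSignedMeasure_add,
        Measure.toSignedMeasure_add]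
      refine Eq.trans ?_ (congrArg (c • ·) hsub)
      ext i hi
      simp only [sub_apply, smul_apply, add_apply,
        NNReal.smul_def, smul_eq_mul]
      ring
    have hcμ : c • μ ≠ 0 := by
      rw [NNReal.smul_def]
      exact smul_ne_zero (NNReal.coe_ne_zero.2 hc0) hμ0
    have hiα := Integrable.id_of_ae_norm_le hα
    have hiβ := Integrable.id_of_ae_norm_le hβ
    have hiσ := Integrable.id_of_ae_norm_le hσ
    have hxσ : ∫ x, x ∂σ = -∫ x, x ∂α := by
      have h := integral_map (μ := α) (f := fun x : Rd d => x) measurable_neg.aemeasurable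
        measurable_id.aestronglyMeasurable
      rw [h, integral_neg]
    have hxβ : ∫ x, x ∂α = ∫ x, x ∂β := by
      rw [← hsub, integral_sub_toSignedMeasure hiα hiβ] at hμx
      exact sub_eq_zero.1 hμx
    have hs : ∀ {γ : Measure (Rd d)}, (∀ᵐ x ∂γ, ‖x‖ ≤ R) → ∀ᵐ x ∂(c • γ), ‖x‖ ≤ R :=
      fun h => Measure.ae_smul_measure h c
    have hcent : ∀ (γ : Measure (Rd d)) [IsFiniteMeasure γ], (∀ᵐ x ∂γ, ‖x‖ ≤ R) →
        mutualPos W γ γ < ⊤ → γ univ = α univ → ∫ x, x ∂γ = ∫ x, x ∂α →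
        IsCenteredProb W R (c • (γ + σ)) ∧ mutualPos W (c • (γ + σ)) (c • (γ + σ)) < ⊤ := by
      intro γ _ hγ hγγ hγu hγx
      have hE := hW.mutualPos_smul_self_lt_top c (hW.mutualPos_add_self_lt_top hγ hσ hγγ hσσ)
      have hb := hs (ae_add_measure_iff.2 ⟨hγ, hσ⟩)
      refine ⟨⟨⟨?_⟩, ?_, (hW.energy_lt_top_iff hb).2 hE, ?_⟩, hE⟩
      · rw [Measure.smul_apply, Measure.add_apply, hγu, hσu, ← hcM]
        rfl
      · rw [measure_eq_zero_iff_ae_notMem]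
        filter_upwards [hb] with x hx
        simpa using hx
      · rw [integral_smul_nnreal_measure, integral_add_measure (Integrable.id_of_ae_norm_le hγ) hiσ,
          hxσ, hγx, add_neg_cancel, smul_zero]
    obtain ⟨p1, q1⟩ := hcent α hα hαα rfl rfl
    obtain ⟨p0, q0⟩ := hcent β hβ hββ hmass.symm hxβ.symm
    have hlic := h (c • (β + σ)) (c • (α + σ)) (fun h0 => hcμ (by simp only [← hρ, h0, sub_self])) p0 p1
    rw [hW.strictConvexOnUnit_iff (hs (ae_add_measure_iff.2 ⟨hβ, hσ⟩))
      (hs (ae_add_measure_iff.2 ⟨hα, hσ⟩)) q0 q1, hρ, signedEnergy_smul] at hlic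
    exact pos_of_mul_pos_right hlic (by positivity)
  · intro h ρ₀ ρ₁ hne h0 h1
    obtain ⟨p0, b0, e0, c0⟩ := h0
    obtain ⟨p1, b1, e1, c1⟩ := h1
    have a0 := ae_norm_le_of_closedBall_compl b0
    have a1 := ae_norm_le_of_closedBall_compl b1
    rw [hW.energy_lt_top_iff a0] at e0
    rw [hW.energy_lt_top_iff a1] at e1
    rw [hW.strictConvexOnUnit_iff a0 a1 e0 e1]
    have hle : (ρ₁.toSignedMeasure - ρ₀.toSignedMeasure).variation ≤ ρ₁ + ρ₀ := by
      refine VectorMeasure.variation_sub_le.trans_eq ?_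
      simp
    have hfin : IsFiniteMeasure (ρ₁.toSignedMeasure - ρ₀.toSignedMeasure).variation :=
      isFiniteMeasure_of_le _ hle
    have hae : ∀ᵐ x ∂(ρ₁.toSignedMeasure - ρ₀.toSignedMeasure).variation, ‖x‖ ≤ R :=
      (Measure.absolutelyContinuous_of_le hle).ae_le (ae_add_measure_iff.2 ⟨a1, a0⟩)
    refine h _ ⟨?_, ?_, ?_, ?_, ?_⟩
    · intro h0
      exact hne (Measure.toSignedMeasure_eq_toSignedMeasure_iff.1 (sub_eq_zero.1 h0)).symm
    · exact le_antisymm ((hle _).trans (by simp [b0, b1])) zero_le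
    · rw [hW.energy_lt_top_iff hae]
      exact (mutualPos_mono W hle hle).trans_lt (hW.mutualPos_add_self_lt_top a1 a0 e1 e0)
    · rw [Measure.toSignedMeasure_sub_apply MeasurableSet.univ]
      simp
    · rw [integral_sub_toSignedMeasure (Integrable.id_of_ae_norm_le a1)
        (Integrable.id_of_ae_norm_le a0), c0, c1, sub_zero]

end IsGaussianLike

end LIC

/-! ### Representation of radial functions by Gaussians -/

/-- `exp (-tρ)`, minus its first order Taylor polynomial in `ρ` when `t ≤ 1`. -/
noncomputable def gaussRem (t ρ : ℝ) : ℝ := Real.exp (-(t * ρ)) - if t ≤ 1 then 1 - t * ρ else 0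

/-- The derivative of `gaussRem t` in `ρ`. -/
noncomputable def gaussRemDeriv (t ρ : ℝ) : ℝ :=
  -t * Real.exp (-(t * ρ)) + if t ≤ 1 then t else 0

theorem measurable_gaussRem : Measurable fun p : ℝ × ℝ => gaussRem p.1 p.2 := by
  refine Measurable.sub (by fun_prop) (Measurable.ite ?_ (by fun_prop) measurable_const)
  exact measurableSet_le measurable_fst measurable_const

theorem measurable_gaussRemDeriv (ρ : ℝ) : Measurable fun t => gaussRemDeriv t ρ :=
  Measurable.add (by fun_prop) (Measurable.ite measurableSet_Iic measurable_id measurable_const)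

theorem abs_exp_neg_sub_le_sq {s : ℝ} (hs : 0 ≤ s) : |Real.exp (-s) - (1 - s)| ≤ s ^ 2 := by
  rcases le_total s 1 with h | h
  · have := Real.abs_exp_sub_one_sub_id_le (x := -s) (by rwa [abs_neg, abs_of_nonneg hs])
    rw [neg_sq] at this
    convert this using 2
    ring
  · rw [abs_of_nonneg (by linarith [Real.one_sub_le_exp_neg s])]
    nlinarith [Real.exp_le_one_iff.2 (neg_nonpos.2 hs)]

theorem abs_gaussRem_le_sq {t ρ : ℝ} (ht : 0 ≤ t) (ht1 : t ≤ 1) (hρ : 0 ≤ ρ) :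
    |gaussRem t ρ| ≤ ρ ^ 2 * t ^ 2 := by
  rw [gaussRem, if_pos ht1]
  refine (abs_exp_neg_sub_le_sq (mul_nonneg ht hρ)).trans_eq (by ring)

theorem gaussRem_of_one_lt {t : ℝ} (ht : 1 < t) (ρ : ℝ) :
    gaussRem t ρ = Real.exp (-(t * ρ)) := by
  rw [gaussRem, if_neg ht.not_ge, sub_zero]

/-- Lets the small-`t` bound `t²` and the large-`t` exponential decay be expressed through the
single weight `t² exp (-εt)` of `IsMixingDensity`. -/
theorem sq_le_exp_mul {t ε : ℝ} (ht1 : t ≤ 1) (hε : 0 ≤ ε) :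
    t ^ 2 ≤ Real.exp ε * (t ^ 2 * Real.exp (-(ε * t))) := by
  have h : 1 ≤ Real.exp ε * Real.exp (-(ε * t)) := by
    rw [← Real.exp_add]
    exact Real.one_le_exp (by nlinarith)
  nlinarith [sq_nonneg t]

theorem abs_gaussRem_le {t ε ρ M : ℝ} (ht : 0 < t) (hε : 0 ≤ ε) (h1 : ε ≤ ρ) (h2 : ρ ≤ M) :
    |gaussRem t ρ| ≤ (M ^ 2 * Real.exp ε + 1) * (t ^ 2 * Real.exp (-(ε * t))) := by
  have hρ : 0 ≤ ρ := hε.trans h1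
  have hnn : 0 ≤ t ^ 2 * Real.exp (-(ε * t)) := by positivity
  rcases le_or_gt t 1 with h | h
  · refine (abs_gaussRem_le_sq ht.le h hρ).trans ?_
    have h3 := sq_le_exp_mul h hε
    have h4 : ρ ^ 2 ≤ M ^ 2 := by gcongr
    have h5 := mul_le_mul h4 h3 (sq_nonneg t) (sq_nonneg M)
    nlinarith
  · rw [gaussRem_of_one_lt h, abs_of_nonneg (Real.exp_nonneg _)]
    have h3 : Real.exp (-(t * ρ)) ≤ Real.exp (-(ε * t)) := Real.exp_le_exp.2 (by nlinarith)
    have h4 : 0 ≤ M ^ 2 * Real.exp ε := by positivity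
    have h5 : Real.exp (-(ε * t)) ≤ t ^ 2 * Real.exp (-(ε * t)) :=
      le_mul_of_one_le_left (Real.exp_nonneg _) (by nlinarith)
    nlinarith [mul_nonneg h4 hnn]

theorem abs_gaussRemDeriv_le {t ε ρ M : ℝ} (ht : 0 < t) (hε : 0 ≤ ε) (h1 : ε ≤ ρ) (h2 : ρ ≤ M) :
    |gaussRemDeriv t ρ| ≤ (M * Real.exp ε + 1) * (t ^ 2 * Real.exp (-(ε * t))) := by
  have hρ : 0 ≤ ρ := hε.trans h1
  have hM : 0 ≤ M := hρ.trans h2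
  have hnn : 0 ≤ t ^ 2 * Real.exp (-(ε * t)) := by positivity
  rcases le_or_gt t 1 with h | h
  · rw [gaussRemDeriv, if_pos h]
    have h6 : Real.exp (-(t * ρ)) ≤ 1 := Real.exp_le_one_iff.2 (by nlinarith)
    have h7 := Real.one_sub_le_exp_neg (t * ρ)
    rw [abs_of_nonneg (by nlinarith)]
    have h8 : -t * Real.exp (-(t * ρ)) + t ≤ ρ * t ^ 2 := by nlinarith
    have h5 := mul_le_mul h2 (sq_le_exp_mul h hε) (sq_nonneg t) hM
    nlinarith
  · rw [gaussRemDeriv, if_neg h.not_ge, add_zero, abs_mul, abs_neg, abs_of_pos ht,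
      abs_of_nonneg (Real.exp_nonneg _)]
    have h3 : Real.exp (-(t * ρ)) ≤ Real.exp (-(ε * t)) := Real.exp_le_exp.2 (by nlinarith)
    have h4 : 0 ≤ M * Real.exp ε := by positivity
    have h5 : t * Real.exp (-(ε * t)) ≤ t ^ 2 * Real.exp (-(ε * t)) :=
      mul_le_mul_of_nonneg_right (by nlinarith) (Real.exp_nonneg _)
    nlinarith [mul_nonneg h4 hnn, mul_le_mul_of_nonneg_left h3 ht.le]

theorem hasDerivAt_exp_neg_mul (t x : ℝ) :
    HasDerivAt (fun x => Real.exp (-(t * x))) (-t * Real.exp (-(t * x))) x := by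
  have := ((hasDerivAt_id x).const_mul t).neg.exp
  simpa [mul_comm] using this

/-- The integrability condition on a density `m` under which `∫ gaussRem t ρ m(t) dt` exists
for all `ρ > 0`. -/
structure IsMixingDensity (m : ℝ → ℝ) : Prop where
  measurable : Measurable m
  integrableOn : ∀ ε : ℝ, 0 < ε → IntegrableOn (fun t => t ^ 2 * Real.exp (-(ε * t)) * m t) (Ioi 0)

namespace IsMixingDensity

variable {m m' : ℝ → ℝ}

theorem integrableOn_of_le (hm : IsMixingDensity m) {ε C : ℝ} (hε : 0 < ε) {g : ℝ → ℝ}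
    (hg : Measurable g) (h : ∀ t, 0 < t → |g t| ≤ C * (t ^ 2 * Real.exp (-(ε * t)))) :
    IntegrableOn (fun t => g t * m t) (Ioi 0) := by
  refine ((hm.integrableOn ε hε).norm.const_mul C).mono'
    (hg.mul hm.measurable).aestronglyMeasurable ?_
  refine (ae_restrict_iff' measurableSet_Ioi).2 (.of_forall fun t ht => ?_)
  rw [norm_mul, Real.norm_eq_abs, norm_mul _ (m t), ← mul_assoc,
    Real.norm_of_nonneg (r := t ^ 2 * Real.exp (-(ε * t))) (by positivity)]
  exact mul_le_mul_of_nonneg_right (h t ht) (norm_nonneg _)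

theorem integrableOn_gaussRem (hm : IsMixingDensity m) {ρ : ℝ} (hρ : 0 < ρ) :
    IntegrableOn (fun t => gaussRem t ρ * m t) (Ioi 0) :=
  hm.integrableOn_of_le hρ (measurable_gaussRem.comp (measurable_id.prodMk measurable_const))
    fun _ ht => abs_gaussRem_le ht hρ.le le_rfl le_rfl

theorem hasDerivAt_gaussRem (hm : IsMixingDensity m) {ρ : ℝ} (hρ : 0 < ρ) :
    HasDerivAt (fun ρ => ∫ t in Ioi 0, gaussRem t ρ * m t)
      (∫ t in Ioi 0, gaussRemDeriv t ρ * m t) ρ := by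
  have hmeas : ∀ ρ, Measurable fun t => gaussRem t ρ := fun ρ =>
    measurable_gaussRem.comp (measurable_id.prodMk measurable_const)
  -- The lower end of the interval supplies the exponential decay of the dominating function, and
  -- the upper end the factor from the Taylor remainder.
  refine (hasDerivAt_integral_of_dominated_loc_of_deriv_le (s := Ioo (ρ / 2) (2 * ρ))
    (μ := volume.restrict (Ioi 0)) (F := fun ρ t => gaussRem t ρ * m t) (x₀ := ρ)
    (F' := fun ρ t => gaussRemDeriv t ρ * m t)
    (bound := fun t => (2 * ρ * Real.exp (ρ / 2) + 1) *
      ‖t ^ 2 * Real.exp (-(ρ / 2 * t)) * m t‖)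
    (Ioo_mem_nhds (by linarith) (by linarith)) ?_ (hm.integrableOn_gaussRem hρ) ?_ ?_ ?_ ?_).2
  · exact .of_forall fun x => ((hmeas x).mul hm.measurable).aestronglyMeasurable
  · exact ((measurable_gaussRemDeriv ρ).mul hm.measurable).aestronglyMeasurable
  · refine (ae_restrict_iff' measurableSet_Ioi).2 (.of_forall fun t ht x hx => ?_)
    rw [norm_mul, Real.norm_eq_abs, norm_mul _ (m t), ← mul_assoc,
      Real.norm_of_nonneg (r := t ^ 2 * Real.exp (-(ρ / 2 * t))) (by positivity)]
    exact mul_le_mul_of_nonneg_right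
      (abs_gaussRemDeriv_le ht (by linarith) hx.1.le hx.2.le) (norm_nonneg _)
  · exact (hm.integrableOn _ (by linarith)).norm.const_mul _
  · refine .of_forall fun t x _ => HasDerivAt.mul_const ?_ _
    unfold gaussRem gaussRemDeriv
    have h1 := hasDerivAt_exp_neg_mul t x
    split_ifs with h
    · have h2 : HasDerivAt (fun x => 1 - t * x) (-t) x := by
        simpa using ((hasDerivAt_id x).const_mul t).const_sub 1
      simpa using! h1.sub h2
    · simpa using h1

/-- The subtracted polynomial is affine in `ρ`, so it drops out of the second derivative, which is a
plain Laplace transform whatever the cutoff at `t = 1`. -/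
theorem hasDerivAt_gaussRemDeriv (hm : IsMixingDensity m) {ρ : ℝ} (hρ : 0 < ρ) :
    HasDerivAt (fun ρ => ∫ t in Ioi 0, gaussRemDeriv t ρ * m t)
      (∫ t in Ioi 0, t ^ 2 * Real.exp (-(ρ * t)) * m t) ρ := by
  refine (hasDerivAt_integral_of_dominated_loc_of_deriv_le (s := Ioi (ρ / 2))
    (μ := volume.restrict (Ioi 0)) (F := fun ρ t => gaussRemDeriv t ρ * m t) (x₀ := ρ)
    (F' := fun ρ t => t ^ 2 * Real.exp (-(ρ * t)) * m t)
    (bound := fun t => ‖t ^ 2 * Real.exp (-(ρ / 2 * t)) * m t‖)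
    (Ioi_mem_nhds (by linarith)) ?_ ?_ ?_ ?_ ?_ ?_).2
  · exact .of_forall fun x =>
      ((measurable_gaussRemDeriv x).mul hm.measurable).aestronglyMeasurable
  · exact hm.integrableOn_of_le hρ (measurable_gaussRemDeriv ρ)
      fun _ ht => abs_gaussRemDeriv_le ht hρ.le le_rfl le_rfl
  · exact (hm.integrableOn ρ hρ).aestronglyMeasurable
  · refine (ae_restrict_iff' measurableSet_Ioi).2 (.of_forall fun t ht x hx => ?_)
    have ht' : 0 < t := ht
    have hx' : ρ / 2 < x := hx
    rw [norm_mul, norm_mul _ (m t)]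
    refine mul_le_mul_of_nonneg_right ?_ (norm_nonneg _)
    rw [Real.norm_of_nonneg (by positivity), Real.norm_of_nonneg (by positivity)]
    gcongr
  · exact (hm.integrableOn _ (by linarith)).norm
  · refine .of_forall fun t x _ => HasDerivAt.mul_const ?_ _
    unfold gaussRemDeriv
    refine (((hasDerivAt_exp_neg_mul t x).const_mul (-t)).add_const
      (if t ≤ 1 then t else 0)).congr_deriv ?_
    rw [mul_comm x t]
    ring

theorem sub (hm : IsMixingDensity m) (hm' : IsMixingDensity m') :
    IsMixingDensity fun t => m t - m' t :=
  ⟨hm.measurable.sub hm'.measurable, fun ε hε => by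
    simpa only [mul_sub] using! (hm.integrableOn ε hε).sub (hm'.integrableOn ε hε)⟩

end IsMixingDensity

theorem exists_affine_of_hasDerivAt_two {f f' f'' g g' : ℝ → ℝ}
    (hf : ∀ x, 0 < x → HasDerivAt f (f' x) x) (hf' : ∀ x, 0 < x → HasDerivAt f' (f'' x) x)
    (hg : ∀ x, 0 < x → HasDerivAt g (g' x) x) (hg' : ∀ x, 0 < x → HasDerivAt g' (f'' x) x) :
    ∃ B C : ℝ, ∀ x, 0 < x → f x = g x + B + C * x := by
  have key : ∀ D : ℝ → ℝ, (∀ x, 0 < x → HasDerivAt D 0 x) → ∃ a, ∀ x, 0 < x → D x = a := by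
    intro D hD
    obtain ⟨a, ha⟩ := isOpen_Ioi.exists_is_const_of_deriv_eq_zero (𝕜 := ℝ) (f := D) (s := Ioi 0)
      isPreconnected_Ioi (fun x hx => (hD x hx).differentiableAt.differentiableWithinAt)
      (fun x hx => (hD x hx).deriv)
    exact ⟨a, ha⟩
  obtain ⟨C, hC⟩ := key (fun x => f' x - g' x) fun x hx => by
    simpa using (hf' x hx).fun_sub (hg' x hx)
  obtain ⟨B, hB⟩ := key (fun x => f x - g x - C * x) fun x hx => by
    have := ((hf x hx).fun_sub (hg x hx)).fun_sub ((hasDerivAt_id x).const_mul C)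
    simpa [hC x hx] using this
  exact ⟨B, C, fun x hx => by linarith [hB x hx]⟩

/-- `w` is represented on `(0, ∞)`, up to an affine function, by the mixing density `m`. -/
def IsMixture (m w : ℝ → ℝ) : Prop :=
  ∃ B C : ℝ, ∀ ρ, 0 < ρ → w ρ = (∫ t in Ioi 0, gaussRem t ρ * m t) + B + C * ρ

theorem IsMixture.sub {m m' w w' : ℝ → ℝ} (hm : IsMixingDensity m) (hm' : IsMixingDensity m')
    (h : IsMixture m w) (h' : IsMixture m' w') :
    IsMixture (fun t => m t - m' t) fun ρ => w ρ - w' ρ := by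
  obtain ⟨B, C, h⟩ := h
  obtain ⟨B', C', h'⟩ := h'
  refine ⟨B - B', C - C', fun ρ hρ => ?_⟩
  simp only [mul_sub]
  rw [integral_sub (hm.integrableOn_gaussRem hρ) (hm'.integrableOn_gaussRem hρ), h ρ hρ, h' ρ hρ]
  ring

/-- The regularized integral never has to be evaluated: equality of second derivatives on the
connected set `(0, ∞)` leaves an affine ambiguity, which is exactly what `IsMixture` permits. -/
theorem IsMixingDensity.isMixture {m w w' : ℝ → ℝ} (hm : IsMixingDensity m)
    (hw : ∀ ρ, 0 < ρ → HasDerivAt w (w' ρ) ρ)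
    (hw' : ∀ ρ, 0 < ρ → HasDerivAt w' (∫ t in Ioi 0, t ^ 2 * Real.exp (-(ρ * t)) * m t) ρ) :
    IsMixture m w :=
  exists_affine_of_hasDerivAt_two hw hw' (fun _ hρ => hm.hasDerivAt_gaussRem hρ)
    (fun _ hρ => hm.hasDerivAt_gaussRemDeriv hρ)

/-! ### Mixing densities of powers, with and without a logarithm -/

section Powers

theorem abs_log_le_rpow_add_rpow {t δ : ℝ} (ht : 0 < t) (hδ : 0 < δ) :
    |Real.log t| ≤ (t ^ δ + t ^ (-δ)) / δ := by
  have h1 := Real.log_le_rpow_div ht.le hδ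
  have h2 := Real.log_le_rpow_div (inv_pos.2 ht).le hδ
  rw [Real.log_inv, Real.inv_rpow ht.le, ← Real.rpow_neg ht.le] at h2
  have p1 : 0 ≤ t ^ δ / δ := by positivity
  have p2 : 0 ≤ t ^ (-δ) / δ := by positivity
  rw [add_div, abs_le]
  constructor <;> linarith

theorem integrableOn_rpow_mul_exp_neg {s ρ : ℝ} (hs : -1 < s) (hρ : 0 < ρ) :
    IntegrableOn (fun t => t ^ s * Real.exp (-(ρ * t))) (Ioi 0) := by
  simpa using integrableOn_rpow_mul_exp_neg_mul_rpow hs one_pos hρ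

theorem integrableOn_rpow_mul_log_mul_exp_neg {s ρ : ℝ} (hs : -1 < s) (hρ : 0 < ρ) :
    IntegrableOn (fun t => t ^ s * Real.log t * Real.exp (-(ρ * t))) (Ioi 0) := by
  -- Half of the available room, so that `s - δ` is still above `-1`.
  set δ := (s + 1) / 2
  have hδ : 0 < δ := by simp only [δ]; linarith
  refine (((integrableOn_rpow_mul_exp_neg (s := s + δ) (by linarith) hρ).add
    (integrableOn_rpow_mul_exp_neg (s := s - δ) (by simp only [δ]; linarith) hρ)).div_const δ).mono'
    (by fun_prop) ?_
  refine (ae_restrict_iff' measurableSet_Ioi).2 (.of_forall fun t ht => ?_)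
  have ht' : 0 < t := ht
  have h := abs_log_le_rpow_add_rpow ht' hδ
  rw [norm_mul, norm_mul, Real.norm_of_nonneg (Real.exp_nonneg _), Real.norm_eq_abs (Real.log t),
    Real.norm_of_nonneg (by positivity)]
  simp only [Pi.add_apply]
  rw [sub_eq_add_neg, Real.rpow_add ht', Real.rpow_add ht']
  have hnn : 0 ≤ t ^ s * Real.exp (-(ρ * t)) := by positivity
  have := mul_le_mul_of_nonneg_left h hnn
  refine (le_of_eq ?_).trans (this.trans (le_of_eq ?_)) <;> ring

theorem integral_rpow_mul_exp_neg {s ρ : ℝ} (hs : -1 < s) (hρ : 0 < ρ) :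
    ∫ t in Ioi 0, t ^ s * Real.exp (-(ρ * t)) = ρ ^ (-(s + 1)) * Real.Gamma (s + 1) := by
  have := Real.integral_rpow_mul_exp_neg_mul_Ioi (a := s + 1) (by linarith) hρ
  rw [add_sub_cancel_right] at this
  rw [this, one_div, Real.inv_rpow hρ.le, Real.rpow_neg hρ.le]

/-- Scaling `t` by `ρ` and splitting `log (ρt)` isolates the dependence on `ρ`. The integral at `ρ =
1` can stay unevaluated, since `logConst` absorbs it. -/
theorem integral_rpow_mul_log_mul_exp_neg {s ρ : ℝ} (hs : -1 < s) (hρ : 0 < ρ) :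
    ∫ t in Ioi 0, t ^ s * Real.log t * Real.exp (-(ρ * t)) = ρ ^ (-(s + 1)) *
      ((∫ t in Ioi 0, t ^ s * Real.log t * Real.exp (-t)) - Real.log ρ * Real.Gamma (s + 1)) := by
  have h := integral_comp_mul_left_Ioi (fun u => (u ^ s * Real.log u * Real.exp (-u))) 0 hρ
  rw [mul_zero, smul_eq_mul] at h
  have e : ∫ t in Ioi 0, (ρ * t) ^ s * Real.log (ρ * t) * Real.exp (-(ρ * t)) =
      ∫ t in Ioi 0, (ρ ^ s * (t ^ s * Real.log t * Real.exp (-(ρ * t))) +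
        ρ ^ s * Real.log ρ * (t ^ s * Real.exp (-(ρ * t)))) := by
    refine setIntegral_congr_fun measurableSet_Ioi fun t ht => ?_
    have ht' : 0 < t := ht
    rw [Real.mul_rpow hρ.le ht'.le, Real.log_mul hρ.ne' ht'.ne']
    ring
  rw [e, integral_add ((integrableOn_rpow_mul_log_mul_exp_neg hs hρ).const_mul _)
    ((integrableOn_rpow_mul_exp_neg hs hρ).const_mul _), integral_const_mul, integral_const_mul,
    integral_rpow_mul_exp_neg hs hρ] at h
  have hp : ρ ^ (-(s + 1)) = (ρ ^ s)⁻¹ * ρ⁻¹ := by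
    rw [neg_add, Real.rpow_add hρ, Real.rpow_neg hρ.le, Real.rpow_neg_one]
  have hne : ρ ^ s ≠ 0 := (Real.rpow_pos_of_pos hρ s).ne'
  have hρ0 := hρ.ne'
  rw [hp] at h ⊢
  field_simp at h ⊢
  linear_combination h

theorem sq_mul_rpow {t : ℝ} (ht : 0 < t) (q : ℝ) : t ^ 2 * t ^ (-q - 1) = t ^ (1 - q) := by
  rw [← Real.rpow_natCast, ← Real.rpow_add ht]
  congr 1
  push_cast
  ring

/-- The weight `t²` turns the density into `t ^ (1 - q)` near `0`, which is integrable because `q <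
2`. With `q = a / 2` or `q = b / 2` this is the restriction to exponents below `4`. -/
theorem isMixingDensity_log_rpow {q : ℝ} (hq : q < 2) (α γ : ℝ) :
    IsMixingDensity fun t => (α * Real.log t + γ) * t ^ (-q - 1) := by
  refine ⟨by fun_prop, fun ε hε => ?_⟩
  refine IntegrableOn.congr_fun
    (((integrableOn_rpow_mul_log_mul_exp_neg (s := 1 - q) (by linarith) hε).const_mul α).add
      ((integrableOn_rpow_mul_exp_neg (s := 1 - q) (by linarith) hε).const_mul γ))
    (fun t ht => ?_) measurableSet_Ioi
  simp only [Pi.add_apply]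
  rw [← sq_mul_rpow ht]
  ring

theorem integral_sq_mul_log_rpow {q ρ : ℝ} (hq : q < 2) (hρ : 0 < ρ) (α γ : ℝ) :
    ∫ t in Ioi 0, t ^ 2 * Real.exp (-(ρ * t)) * ((α * Real.log t + γ) * t ^ (-q - 1)) =
      ρ ^ (q - 2) * (α * ((∫ t in Ioi 0, t ^ (1 - q) * Real.log t * Real.exp (-t)) -
        Real.log ρ * Real.Gamma (2 - q)) + γ * Real.Gamma (2 - q)) := by
  have e : ∫ t in Ioi 0, t ^ 2 * Real.exp (-(ρ * t)) * ((α * Real.log t + γ) * t ^ (-q - 1)) =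
      ∫ t in Ioi 0, (α * (t ^ (1 - q) * Real.log t * Real.exp (-(ρ * t))) +
        γ * (t ^ (1 - q) * Real.exp (-(ρ * t)))) := by
    refine setIntegral_congr_fun measurableSet_Ioi fun t ht => ?_
    rw [← sq_mul_rpow ht]
    ring
  have hs : -1 < 1 - q := by linarith
  rw [e, integral_add ((integrableOn_rpow_mul_log_mul_exp_neg hs hρ).const_mul _)
    ((integrableOn_rpow_mul_exp_neg hs hρ).const_mul _), integral_const_mul, integral_const_mul,
    integral_rpow_mul_exp_neg hs hρ, integral_rpow_mul_log_mul_exp_neg hs hρ,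
    show -(1 - q + 1) = q - 2 by ring, show 1 - q + 1 = 2 - q by ring]
  ring

/-- The coefficient of the mixing density of `|x| ^ (2 * q) / (2 * q)`. -/
noncomputable def powCoeff (q : ℝ) : ℝ := (q - 1) / (2 * Real.Gamma (2 - q))

/-- The mixing density of `|x| ^ (2 * q) / (2 * q)` in the variable `|x| ^ 2`. -/
noncomputable def powDensity (q t : ℝ) : ℝ := powCoeff q * t ^ (-q - 1)

theorem isMixingDensity_powDensity {q : ℝ} (hq : q < 2) : IsMixingDensity (powDensity q) := by
  simpa [powDensity] using! isMixingDensity_log_rpow hq 0 (powCoeff q)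

/-- In the variable `ρ` the first derivative is `ρ ^ (p / 2 - 1) / 2` for every `p`, the logarithmic
case `p = 0` included. The next derivative fixes `powCoeff` through `Γ(2 - p / 2)`. -/
theorem isMixture_powerLaw {p : ℝ} (hp : p < 4) :
    IsMixture (powDensity (p / 2)) fun ρ => powerLaw p (Real.sqrt ρ) := by
  have hq : p / 2 < 2 := by linarith
  refine (isMixingDensity_powDensity hq).isMixture (w' := fun ρ => 1 / 2 * ρ ^ (p / 2 - 1)) ?_ ?_
  · intro ρ hρ
    by_cases h0 : p = 0
    · have h := (Real.hasDerivAt_log hρ.ne').div_const 2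
      refine (h.congr_of_eventuallyEq ?_).congr_deriv ?_
      · filter_upwards [Ioi_mem_nhds hρ] with x hx
        rw [powerLaw, if_pos h0, Real.log_sqrt (le_of_lt hx)]
      · rw [h0, zero_div, zero_sub, Real.rpow_neg_one]
        ring
    · have h := (Real.hasDerivAt_rpow_const (p := p / 2) (Or.inl hρ.ne')).div_const p
      refine (h.congr_of_eventuallyEq ?_).congr_deriv ?_
      · filter_upwards [Ioi_mem_nhds hρ] with x hx
        rw [powerLaw, if_neg h0, Real.sqrt_eq_rpow, ← Real.rpow_mul (le_of_lt hx)]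
        congr 2
        ring
      · field_simp
  · intro ρ hρ
    have h := (Real.hasDerivAt_rpow_const (p := p / 2 - 1) (Or.inl hρ.ne')).const_mul (1 / 2)
    refine h.congr_deriv ?_
    have hi := integral_sq_mul_log_rpow hq hρ 0 (powCoeff (p / 2))
    simp only [zero_mul, zero_add] at hi
    have hΓ : Real.Gamma (2 - p / 2) ≠ 0 := (Real.Gamma_pos_of_pos (by linarith)).ne'
    simp only [powDensity]
    rw [hi, powCoeff, show p / 2 - 1 - 1 = p / 2 - 2 by ring]
    generalize Real.Gamma (2 - p / 2) = G at hΓ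
    field_simp

/-- The coefficient of `log t` in the mixing density of `|x| ^ (2 * q) / (2 * q) * log |x|`. -/
noncomputable def logCoeff (q : ℝ) : ℝ := (1 - q) / (4 * Real.Gamma (2 - q))

/-- The constant coefficient in the mixing density of `|x| ^ (2 * q) / (2 * q) * log |x|`. -/
noncomputable def logConst (q : ℝ) : ℝ :=
  ((2 * q - 1) / (4 * q) -
    logCoeff q * ∫ t in Ioi 0, t ^ (1 - q) * Real.log t * Real.exp (-t)) / Real.Gamma (2 - q)

/-- The mixing density of `|x| ^ (2 * q) / (2 * q) * log |x|` in the variable `|x| ^ 2`. -/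
noncomputable def logDensity (q t : ℝ) : ℝ := (logCoeff q * Real.log t + logConst q) * t ^ (-q - 1)

theorem isMixingDensity_logDensity {q : ℝ} (hq : q < 2) : IsMixingDensity (logDensity q) :=
  isMixingDensity_log_rpow hq _ _

/-- The second derivative is `ρ ^ (b / 2 - 2)` times an affine function of `log ρ`. Its slope
determines `logCoeff`, and its constant term then determines `logConst`. -/
theorem isMixture_rpow_mul_log {b : ℝ} (hb : b < 4) (hb0 : b ≠ 0) :
    IsMixture (logDensity (b / 2)) fun ρ => Real.sqrt ρ ^ b / b * Real.log (Real.sqrt ρ) := by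
  have hq : b / 2 < 2 := by linarith
  refine (isMixingDensity_logDensity hq).isMixture
    (w' := fun ρ => (b / 2 * ρ ^ (b / 2 - 1) * Real.log ρ + ρ ^ (b / 2 - 1)) / (2 * b)) ?_ ?_
  · intro ρ hρ
    have h := ((Real.hasDerivAt_rpow_const (p := b / 2) (Or.inl hρ.ne')).mul
      (Real.hasDerivAt_log hρ.ne')).div_const (2 * b)
    refine (h.congr_of_eventuallyEq ?_).congr_deriv ?_
    · filter_upwards [Ioi_mem_nhds hρ] with x hx
      simp only [Pi.mul_apply]
      rw [Real.sqrt_eq_rpow, ← Real.rpow_mul (le_of_lt hx), Real.log_rpow hx]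
      rw [show 1 / 2 * b = b / 2 by ring]
      field_simp
    · rw [Real.rpow_sub_one hρ.ne']
      field_simp
  · intro ρ hρ
    have h1 := Real.hasDerivAt_rpow_const (p := b / 2 - 1) (Or.inl hρ.ne')
    have h := (((h1.const_mul (b / 2)).mul (Real.hasDerivAt_log hρ.ne')).add h1).div_const (2 * b)
    refine h.congr_deriv ?_
    have hΓ : Real.Gamma (2 - b / 2) ≠ 0 := (Real.Gamma_pos_of_pos (by linarith)).ne'
    simp only [logDensity]
    rw [integral_sq_mul_log_rpow hq hρ]
    simp only [logConst, logCoeff]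
    rw [show b / 2 - 1 - 1 = b / 2 - 2 by ring, show b / 2 - 1 = b / 2 - 2 + 1 by ring,
      Real.rpow_add_one hρ.ne']
    generalize Real.Gamma (2 - b / 2) = G at hΓ
    generalize (∫ t in Ioi 0, t ^ (1 - b / 2) * Real.log t * Real.exp (-t)) = I
    have hρ0 := hρ.ne'
    field_simp
    ring

end Powers

/-! ### Potentials given by mixtures of Gaussians -/

/-- Off its infinities, `W` is given by the mixing density `m` up to a quadratic polynomial, and
the mixture is absolutely controlled by `W` on balls. -/
structure HasMixture {d : ℕ} (W : Rd d → EReal) (m : ℝ → ℝ) (B C : ℝ) : Prop where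
  measurable : Measurable m
  integrableOn_Ioc : IntegrableOn (fun t => t ^ 2 * m t) (Ioc 0 1)
  integrableOn_Ioi : IntegrableOn (fun t => t ^ (-(d / 2 : ℝ)) * m t) (Ioi 1)
  ne_top : ∀ x, x ≠ 0 → W x ≠ ⊤
  toReal_eq : ∀ x, W x ≠ ⊤ →
    (W x).toReal = (∫ t in Ioi 0, gaussRem t (‖x‖ ^ 2) * m t) + B + C * ‖x‖ ^ 2
  lintegral_le : ∀ R : ℝ, ∃ K : ℝ≥0, ∀ x, ‖x‖ ≤ R →
    ∫⁻ t in Ioi 0, ‖gaussRem t (‖x‖ ^ 2) * m t‖ₑ ≤ (W x).toENNReal + K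

/-! ### Comparing a potential with the mixture given by its density -/

section GaussianLike

variable {d : ℕ} {W : Rd d → EReal} {m : ℝ → ℝ}

theorem IsMixingDensity.lintegral_Ioo_lt_top (hm : IsMixingDensity m) (T : ℝ) :
    ∫⁻ t in Ioo 0 T, ‖t ^ 2 * m t‖ₑ < ⊤ := by
  have h := ((hm.integrableOn 1 one_pos).mono_set (s := Ioo 0 T) fun t ht => ht.1).norm.const_mul
    (Real.exp T)
  refine (h.mono' (((measurable_id.pow_const 2).mul hm.measurable).aestronglyMeasurable)
    ((ae_restrict_iff' measurableSet_Ioo).2 (.of_forall fun t ht => ?_))).2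
  change ‖t ^ 2 * m t‖ ≤ Real.exp T * ‖t ^ 2 * Real.exp (-(1 * t)) * m t‖
  have h1 : 1 ≤ Real.exp T * Real.exp (-(1 * t)) := by
    rw [← Real.exp_add]
    exact Real.one_le_exp (by linarith [ht.2])
  rw [norm_mul, norm_mul, norm_mul, Real.norm_of_nonneg (Real.exp_nonneg _)]
  calc ‖t ^ 2‖ * ‖m t‖ ≤ ‖t ^ 2‖ * ‖m t‖ * (Real.exp T * Real.exp (-(1 * t))) :=
        le_mul_of_one_le_right (by positivity) h1
    _ = _ := by ring

theorem enorm_gaussRem_mul_le {R t r : ℝ} (ht : 0 < t) (hr : 0 ≤ r) (hrR : r ≤ R) :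
    ‖gaussRem t (r ^ 2) * m t‖ₑ ≤ ENNReal.ofReal (R ^ 4 + 1) * ‖t ^ 2 * m t‖ₑ := by
  rw [enorm_mul, enorm_mul, ← mul_assoc]
  gcongr
  rw [Real.enorm_eq_ofReal (by positivity : 0 ≤ t ^ 2), ← ENNReal.ofReal_mul (by positivity),
    Real.enorm_eq_ofReal_abs]
  refine ENNReal.ofReal_le_ofReal ?_
  rcases le_or_gt t 1 with h | h
  · refine (abs_gaussRem_le_sq ht.le h (sq_nonneg r)).trans ?_
    have h1 : (r ^ 2) ^ 2 ≤ R ^ 4 + 1 := by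
      have : r ^ 4 ≤ R ^ 4 := by gcongr
      nlinarith
    exact mul_le_mul_of_nonneg_right h1 (sq_nonneg t)
  · rw [gaussRem_of_one_lt h, abs_of_nonneg (Real.exp_nonneg _)]
    refine (Real.exp_le_one_iff.2 (by nlinarith [sq_nonneg r])).trans ?_
    have : 0 ≤ R ^ 4 := by positivity
    nlinarith [sq_nonneg t, mul_nonneg this (sq_nonneg t)]

theorem lintegral_Ioo_gaussRem_le (hm : IsMixingDensity m) (R T : ℝ) :
    ∃ K : ℝ≥0, ∀ x : Rd d, ‖x‖ ≤ R →
      ∫⁻ t in Ioo 0 T, ‖gaussRem t (‖x‖ ^ 2) * m t‖ₑ ≤ K := by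
  have hfin : ENNReal.ofReal (R ^ 4 + 1) * ∫⁻ t in Ioo 0 T, ‖t ^ 2 * m t‖ₑ < ⊤ :=
    ENNReal.mul_lt_top ENNReal.ofReal_lt_top (hm.lintegral_Ioo_lt_top T)
  refine ⟨(ENNReal.ofReal (R ^ 4 + 1) * ∫⁻ t in Ioo 0 T, ‖t ^ 2 * m t‖ₑ).toNNReal,
    fun x hx => ?_⟩
  rw [ENNReal.coe_toNNReal hfin.ne, ← lintegral_const_mul' _ _ ENNReal.ofReal_ne_top]
  exact setLIntegral_mono' measurableSet_Ioo fun t ht =>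
    enorm_gaussRem_mul_le ht.1 (norm_nonneg _) hx

/-- Nothing needs to be mixed here: the zero density works, with the bound of `W` on the ball as the
constant. -/
theorem isGaussianLike_of_bounded (hWm : Measurable W) (heven : ∀ x, W (-x) = W x)
    (hbdd : ∀ R : ℝ, ∃ K : ℝ, ∀ x, ‖x‖ ≤ R → ∃ w : ℝ, W x = w ∧ |w| ≤ K) :
    IsGaussianLike W := by
  refine ⟨hWm, heven, 0, measurable_const, fun R => ?_⟩
  obtain ⟨K, hK⟩ := hbdd R
  refine ⟨K.toNNReal, fun x hx => ?_⟩
  obtain ⟨w, hw, hwK⟩ := hK x hx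
  have hcoe : ((K.toNNReal : ℝ≥0) : ℝ≥0∞) = ENNReal.ofReal K := rfl
  rw [hw, ← EReal.coe_neg, EReal.real_coe_toENNReal, EReal.real_coe_toENNReal, hcoe]
  refine ⟨?_, ?_, ?_⟩
  · exact (ENNReal.ofReal_le_ofReal ((le_abs_self w).trans hwK)).trans le_add_self
  · simp [gaussMix]
  · exact ENNReal.ofReal_le_ofReal ((neg_le_abs w).trans hwK)

/-- A potential with an infinite value at the origin which is, up to a bounded function, a mixture
of Gaussians with an eventually positive density is comparable to a positive mixture. -/
theorem gaussianLike_of_mixture (hWm : Measurable W) (heven : ∀ x, W (-x) = W x)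
    (hm : IsMixingDensity m) {v : Rd d → ℝ}
    (hrep : ∀ x, x ≠ 0 → W x = ((∫ t in Ioi 0, gaussRem t (‖x‖ ^ 2) * m t) + v x : ℝ))
    (hv : ∀ R : ℝ, ∃ K : ℝ, ∀ x, ‖x‖ ≤ R → |v x| ≤ K) (h0 : W 0 = ⊤) {c : ℝ} (hc : 0 < c)
    (hpos : ∀ᶠ t in Filter.atTop, c / t ≤ m t) :
    IsGaussianLike W ∧ ∀ R : ℝ, ∃ K : ℝ≥0, ∀ x, ‖x‖ ≤ R →
      ∫⁻ t in Ioi 0, ‖gaussRem t (‖x‖ ^ 2) * m t‖ₑ ≤ (W x).toENNReal + K := by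
  -- Beyond `T > 1` no Taylor polynomial is subtracted and `m` is nonnegative, so the tail of the
  -- mixture is a genuine positive mixture. The part below `T` is bounded on balls.
  obtain ⟨T, hT1, hT⟩ : ∃ T, 1 < T ∧ ∀ t, T ≤ t → c / t ≤ m t := by
    obtain ⟨T, hT⟩ := Filter.eventually_atTop.1 hpos
    exact ⟨max T 2, lt_max_of_lt_right one_lt_two, fun t ht => hT t ((le_max_left _ _).trans ht)⟩
  have hm0 : ∀ t, T ≤ t → 0 ≤ m t := fun t ht =>
    (div_nonneg hc.le (by linarith)).trans (hT t ht)
  have hIoi : Ioi (0 : ℝ) = Ioo 0 T ∪ Ici T := by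
    ext t
    simp only [mem_Ioi, mem_union, mem_Ioo, mem_Ici]
    constructor
    · intro h
      rcases lt_or_ge t T with h' | h'
      · exact Or.inl ⟨h, h'⟩
      · exact Or.inr h'
    · rintro (h | h)
      · exact h.1
      · linarith
  have hdisj : Disjoint (Ioo 0 T) (Ici T) := by
    rw [Set.disjoint_left]
    exact fun t ht ht' => ht.2.not_ge ht'
  set k : ℝ → ℝ≥0∞ := (Ici T).indicator fun t => ENNReal.ofReal (m t)
  have hk : Measurable k := hm.measurable.ennreal_ofReal.indicator measurableSet_Ici
  have hmix : ∀ x : Rd d, gaussMix k x = ∫⁻ t in Ici T, ‖gaussRem t (‖x‖ ^ 2) * m t‖ₑ := by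
    intro x
    have e : ∀ t, ENNReal.ofReal (Real.exp (-t * ‖x‖ ^ 2)) * k t =
        (Ici T).indicator (fun t => ‖gaussRem t (‖x‖ ^ 2) * m t‖ₑ) t := by
      intro t
      by_cases ht : t ∈ Ici T
      · rw [indicator_of_mem ht, show k t = _ from indicator_of_mem ht _, gaussRem_of_one_lt (hT1.trans_le ht),
          ← ENNReal.ofReal_mul (Real.exp_nonneg _), neg_mul,
          Real.enorm_of_nonneg (mul_nonneg (Real.exp_nonneg _) (hm0 t ht))]
      · rw [indicator_of_notMem ht, show k t = _ from indicator_of_notMem ht _, mul_zero]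
    rw [gaussMix]
    simp_rw [e]
    rw [lintegral_indicator measurableSet_Ici, Measure.restrict_restrict measurableSet_Ici,
      inter_eq_left.2]
    intro t ht
    exact lt_of_lt_of_le (zero_lt_one.trans hT1) ht
  -- At the origin the exponential is `1`, so finiteness would make `c / t` integrable at infinity.
  -- The infinite values of `W` and of the mixture at `0` therefore match.
  have hmix0 : gaussMix k (0 : Rd d) = ⊤ := by
    by_contra hne
    rw [hmix] at hne
    have hi : IntegrableOn (fun t : ℝ => t⁻¹) (Ioi T) := by
      have h1 : IntegrableOn (fun t => c⁻¹ * (gaussRem t (‖(0 : Rd d)‖ ^ 2) * m t)) (Ici T) := by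
        refine Integrable.const_mul ⟨?_, lt_top_iff_ne_top.2 hne⟩ _
        exact ((measurable_gaussRem.comp (measurable_id.prodMk measurable_const)).mul
          hm.measurable).aestronglyMeasurable
      refine (h1.mono_set Ioi_subset_Ici_self).mono' measurable_inv.aestronglyMeasurable ?_
      refine (ae_restrict_iff' measurableSet_Ioi).2 (.of_forall fun t ht => ?_)
      have ht' : T < t := ht
      have ht0 : 0 < t := by linarith
      rw [gaussRem_of_one_lt (hT1.trans ht'), Real.norm_of_nonneg (by positivity)]
      have := hT t ht'.le
      simp only [norm_zero, ne_eq, OfNat.ofNat_ne_zero, not_false_eq_true, zero_pow, mul_zero,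
        neg_zero, Real.exp_zero, one_mul]
      rw [div_eq_mul_inv] at this
      exact (le_inv_mul_iff₀ hc).2 this
    exact not_integrableOn_Ioi_inv hi
  have main : ∀ R : ℝ, ∃ K : ℝ≥0, ∀ x : Rd d, ‖x‖ ≤ R →
      ((W x).toENNReal ≤ gaussMix k x + K ∧ gaussMix k x ≤ (W x).toENNReal + K ∧
        (-W x).toENNReal ≤ K) ∧
      ∫⁻ t in Ioi 0, ‖gaussRem t (‖x‖ ^ 2) * m t‖ₑ ≤ gaussMix k x + K := by
    intro R
    obtain ⟨K₁, hK₁⟩ := lintegral_Ioo_gaussRem_le (d := d) hm R T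
    obtain ⟨K₂, hK₂⟩ := hv R
    refine ⟨K₁ + K₂.toNNReal, fun x hx => ⟨?_, ?_⟩⟩
    · rcases eq_or_ne x 0 with rfl | hx0
      · simp [h0, hmix0]
      · have hρ : 0 < ‖x‖ ^ 2 := by positivity
        have hi := hm.integrableOn_gaussRem hρ
        rw [hIoi] at hi
        have hi1 := hi.mono_set subset_union_left
        have hi2 := hi.mono_set subset_union_right
        set κ := ∫ t in Ici T, gaussRem t (‖x‖ ^ 2) * m t
        set e := (∫ t in Ioo 0 T, gaussRem t (‖x‖ ^ 2) * m t) + v x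
        have hnn : ∀ t ∈ Ici T, 0 ≤ gaussRem t (‖x‖ ^ 2) * m t := by
          intro t ht
          rw [gaussRem_of_one_lt (hT1.trans_le ht)]
          exact mul_nonneg (Real.exp_nonneg _) (hm0 t ht)
        have hκ0 : 0 ≤ κ := setIntegral_nonneg measurableSet_Ici hnn
        have hκ : gaussMix k x = ENNReal.ofReal κ := by
          rw [hmix, ofReal_integral_eq_lintegral_ofReal hi2
            ((ae_restrict_iff' measurableSet_Ici).2 (.of_forall hnn))]
          exact setLIntegral_congr_fun measurableSet_Ici fun t ht =>
            Real.enorm_of_nonneg (hnn t ht)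
        have he : |e| ≤ K₁ + K₂.toNNReal := by
          refine (abs_add_le _ _).trans (add_le_add ?_ ((hK₂ x hx).trans (Real.le_coe_toNNReal _)))
          have h1 := (enorm_integral_le_lintegral_enorm _).trans (hK₁ x hx)
          rw [← Real.norm_eq_abs]
          exact_mod_cast h1
        have hWx : W x = ((κ + e : ℝ) : EReal) := by
          rw [hrep x hx0, hIoi, setIntegral_union hdisj measurableSet_Ici hi1 hi2]
          simp only [e, κ]
          congr 1
          ring
        have hcoe : ((K₁ + K₂.toNNReal : ℝ≥0) : ℝ≥0∞) = ENNReal.ofReal (K₁ + K₂.toNNReal) := by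
          rw [← NNReal.coe_add, ENNReal.ofReal_coe_nnreal]
        have he1 := (le_abs_self e).trans he
        have he2 := (neg_le_abs e).trans he
        have hK0 : (0 : ℝ) ≤ K₁ + K₂.toNNReal := by positivity
        rw [hWx, ← EReal.coe_neg, EReal.real_coe_toENNReal, EReal.real_coe_toENNReal, hκ, hcoe]
        refine ⟨?_, ?_, ?_⟩
        · rw [← ENNReal.ofReal_add hκ0 hK0]
          exact ENNReal.ofReal_le_ofReal (by linarith)
        · refine (ENNReal.ofReal_le_ofReal (by linarith : κ ≤ κ + e + (K₁ + K₂.toNNReal))).trans ?_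
          exact ENNReal.ofReal_add_le
        · exact ENNReal.ofReal_le_ofReal (by linarith)
    · rw [hIoi, lintegral_union measurableSet_Ici hdisj, hmix, add_comm]
      gcongr
      exact (hK₁ x hx).trans (by exact_mod_cast le_self_add)
  constructor
  · refine ⟨hWm, heven, k, hk, fun R => ?_⟩
    obtain ⟨K, hK⟩ := main R
    exact ⟨K, fun x hx => (hK x hx).1⟩
  · intro R
    obtain ⟨K, hK⟩ := main R
    refine ⟨K + K, fun x hx => (hK x hx).2.trans ?_⟩
    rw [ENNReal.coe_add, ← add_assoc]
    gcongr
    exact (hK x hx).1.2.1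

/-- A bound uniform over the ball, including its center, where no exponential decay is left:
quadratic decay for small `t`, and `m` itself for large `t`. The two ranges overlap harmlessly. -/
theorem enorm_gaussRem_mul_le_add {R t r : ℝ} (ht : 0 < t) (hr : 0 ≤ r) (hrR : r ≤ R) :
    ‖gaussRem t (r ^ 2) * m t‖ₑ ≤ ENNReal.ofReal (R ^ 4 + 1) *
      ((Ioo 0 2).indicator (fun t => ‖t ^ 2 * m t‖ₑ) t + (Ioi 1).indicator (fun t => ‖m t‖ₑ) t) := by
  rcases le_or_gt t 1 with h | h
  · rw [indicator_of_mem (show t ∈ Ioo (0 : ℝ) 2 from ⟨ht, by linarith⟩)]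
    refine (enorm_gaussRem_mul_le ht hr hrR).trans ?_
    gcongr
    exact le_self_add
  · rw [indicator_of_mem (show t ∈ Ioi (1 : ℝ) from h), gaussRem_of_one_lt h, enorm_mul]
    refine mul_le_mul' ?_ le_add_self
    rw [Real.enorm_of_nonneg (Real.exp_nonneg _)]
    refine ENNReal.ofReal_le_ofReal ?_
    refine (Real.exp_le_one_iff.2 (by nlinarith [sq_nonneg r])).trans ?_
    have : 0 ≤ R ^ 4 := by positivity
    linarith

theorem lintegral_bound_lt_top (hm : IsMixingDensity m) (hm1 : IntegrableOn m (Ioi 1)) (R : ℝ) :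
    ∫⁻ t in Ioi 0, ENNReal.ofReal (R ^ 4 + 1) * ((Ioo 0 2).indicator (fun t => ‖t ^ 2 * m t‖ₑ) t +
      (Ioi 1).indicator (fun t => ‖m t‖ₑ) t) < ⊤ := by
  rw [lintegral_const_mul' _ _ ENNReal.ofReal_ne_top, lintegral_add_right _
    (hm.measurable.enorm.indicator measurableSet_Ioi), lintegral_indicator measurableSet_Ioo,
    lintegral_indicator measurableSet_Ioi, Measure.restrict_restrict measurableSet_Ioo,
    Measure.restrict_restrict measurableSet_Ioi, inter_eq_left.2 (fun t ht => ht.1),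
    inter_eq_left.2 (Ioi_subset_Ioi zero_le_one)]
  exact ENNReal.mul_lt_top ENNReal.ofReal_lt_top
    (ENNReal.add_lt_top.2 ⟨hm.lintegral_Ioo_lt_top 2, hm1.2⟩)

theorem lintegral_gaussRem_le_of_integrableOn (hm : IsMixingDensity m)
    (hm1 : IntegrableOn m (Ioi 1)) (R : ℝ) : ∃ K : ℝ≥0, ∀ x : Rd d, ‖x‖ ≤ R →
      ∫⁻ t in Ioi 0, ‖gaussRem t (‖x‖ ^ 2) * m t‖ₑ ≤ K := by
  refine ⟨ENNReal.toNNReal (∫⁻ t in Ioi 0, ENNReal.ofReal (R ^ 4 + 1) *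
    ((Ioo 0 2).indicator (fun t => ‖t ^ 2 * m t‖ₑ) t +
      (Ioi 1).indicator (fun t => ‖m t‖ₑ) t)), fun x hx => ?_⟩
  rw [ENNReal.coe_toNNReal (lintegral_bound_lt_top hm hm1 R).ne]
  exact setLIntegral_mono' measurableSet_Ioi fun t ht =>
    enorm_gaussRem_mul_le_add ht (norm_nonneg _) hx

/-- A representation on `(0, ∞)` extends to the origin by continuity. -/
theorem integral_gaussRem_zero (hm : IsMixingDensity m) (hm1 : IntegrableOn m (Ioi 1)) {w : ℝ → ℝ}
    {B C : ℝ} (hw : ∀ r, 0 < r → w r = (∫ t in Ioi 0, gaussRem t (r ^ 2) * m t) + B + C * r ^ 2)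
    (hc : ContinuousAt w 0) :
    w 0 = (∫ t in Ioi 0, gaussRem t (0 ^ 2) * m t) + B + C * 0 ^ 2 := by
  have hF : Filter.Tendsto (fun r : ℝ => ∫ t in Ioi 0, gaussRem t (r ^ 2) * m t) (nhdsWithin 0 (Ioi 0))
      (nhds (∫ t in Ioi 0, gaussRem t (0 ^ 2) * m t)) := by
    refine tendsto_integral_filter_of_dominated_convergence
      (fun t => (ENNReal.ofReal ((1 : ℝ) ^ 4 + 1) * ((Ioo 0 2).indicator (fun t => ‖t ^ 2 * m t‖ₑ) t +
        (Ioi 1).indicator (fun t => ‖m t‖ₑ) t)).toReal) ?_ ?_ ?_ ?_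
    · exact .of_forall fun r => ((measurable_gaussRem.comp
        (measurable_id.prodMk measurable_const)).mul hm.measurable).aestronglyMeasurable
    · filter_upwards [Ioo_mem_nhdsGT zero_lt_one] with r hr
      refine (ae_restrict_iff' measurableSet_Ioi).2 (.of_forall fun t ht => ?_)
      rw [← toReal_enorm]
      refine ENNReal.toReal_mono ?_ (enorm_gaussRem_mul_le_add ht hr.1.le hr.2.le)
      refine ENNReal.mul_ne_top ENNReal.ofReal_ne_top (ENNReal.add_ne_top.2 ⟨?_, ?_⟩)
      · exact ((indicator_le_self _ (fun t => ‖t ^ 2 * m t‖ₑ) t).trans_lt enorm_lt_top).ne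
      · exact ((indicator_le_self _ (fun t => ‖m t‖ₑ) t).trans_lt enorm_lt_top).ne
    · refine integrable_toReal_of_lintegral_ne_top (Measurable.aemeasurable ?_)
        (lintegral_bound_lt_top hm hm1 1).ne
      exact (((((measurable_id.pow_const 2).mul hm.measurable).enorm).indicator
        measurableSet_Ioo).add (hm.measurable.enorm.indicator measurableSet_Ioi)).const_mul _
    · refine .of_forall fun t => Filter.Tendsto.mul_const _ ?_
      have : Continuous fun r : ℝ => gaussRem t (r ^ 2) := by
        unfold gaussRem
        split_ifs <;> fun_prop
      exact (this.tendsto 0).mono_left nhdsWithin_le_nhds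
  have hR : Filter.Tendsto (fun r : ℝ => (∫ t in Ioi 0, gaussRem t (r ^ 2) * m t) + B + C * r ^ 2)
      (nhdsWithin 0 (Ioi 0)) (nhds ((∫ t in Ioi 0, gaussRem t (0 ^ 2) * m t) + B + C * 0 ^ 2)) := by
    have : Continuous fun r : ℝ => C * r ^ 2 := by fun_prop
    exact (hF.add_const B).add ((this.tendsto 0).mono_left nhdsWithin_le_nhds)
  refine tendsto_nhds_unique (hc.tendsto.mono_left nhdsWithin_le_nhds) (hR.congr' ?_)
  filter_upwards [self_mem_nhdsWithin] with r hr using (hw r hr).symm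

end GaussianLike

/-! ### Application to the potentials `Wab` and `Wbln` -/

section Potentials

theorem integrableOn_Ioi_one_log_rpow {s q : ℝ} (h : s < q) (α γ : ℝ) :
    IntegrableOn (fun t => t ^ s * ((α * Real.log t + γ) * t ^ (-q - 1))) (Ioi 1) := by
  -- Half of the gap absorbs the logarithm, and the other half keeps the exponent below `-1`.
  set δ := (q - s) / 2
  have hδ : 0 < δ := by simp only [δ]; linarith
  have hi : IntegrableOn (fun t : ℝ => t ^ (δ + (s + (-q - 1)))) (Ioi 1) :=
    integrableOn_Ioi_rpow_of_lt (by simp only [δ]; linarith) one_pos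
  refine (hi.const_mul (|α| / δ + |γ|)).mono' (by fun_prop)
    ((ae_restrict_iff' measurableSet_Ioi).2 (.of_forall fun t ht => ?_))
  have ht1 : 1 < t := ht
  have ht0 : 0 < t := by linarith
  have hlog := Real.log_le_rpow_div ht0.le hδ
  have h1 : 1 ≤ t ^ δ := Real.one_le_rpow ht1.le hδ.le
  have habs : |α * Real.log t + γ| ≤ (|α| / δ + |γ|) * t ^ δ := by
    refine (abs_add_le _ _).trans ?_
    rw [abs_mul, abs_of_nonneg (Real.log_nonneg ht1.le), add_mul]
    refine add_le_add ?_ (le_mul_of_one_le_right (abs_nonneg _) h1)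
    calc |α| * Real.log t ≤ |α| * (t ^ δ / δ) := by gcongr
      _ = _ := by ring
  rw [norm_mul, norm_mul, Real.norm_of_nonneg (by positivity), Real.norm_of_nonneg
    (r := t ^ (-q - 1)) (by positivity), Real.rpow_add ht0, Real.rpow_add ht0, Real.norm_eq_abs]
  have hnn : 0 ≤ t ^ s * t ^ (-q - 1) := by positivity
  linear_combination (t ^ s * t ^ (-q - 1)) * habs

theorem integrableOn_Ioi_one_powDensity {s q : ℝ} (h : s < q) :
    IntegrableOn (fun t => t ^ s * powDensity q t) (Ioi 1) := by
  simpa [powDensity] using integrableOn_Ioi_one_log_rpow h 0 (powCoeff q)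

theorem powCoeff_neg {q : ℝ} (hq : q < 1) : powCoeff q < 0 := by
  have := Real.Gamma_pos_of_pos (s := 2 - q) (by linarith)
  exact div_neg_of_neg_of_pos (by linarith) (by positivity)

theorem logCoeff_pos {q : ℝ} (hq : q < 1) : 0 < logCoeff q := by
  have := Real.Gamma_pos_of_pos (s := 2 - q) (by linarith)
  exact div_pos (by linarith) (by positivity)

/-- For `q ≤ 0` the power `t ^ (-q - 1)` is at least `1 / t` when `t > 1`. The other term is of
lower order, and half of `β` is given up to absorb it. -/
theorem eventually_div_le_rpow_add {q q' β : ℝ} (A : ℝ) (hq : q ≤ 0) (hqq' : q < q') (hβ : 0 < β) :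
    ∀ᶠ t in Filter.atTop, β / 2 / t ≤ A * t ^ (-q' - 1) + β * t ^ (-q - 1) := by
  have h1 : Filter.Tendsto (fun t : ℝ => A * t ^ (-(q' - q))) Filter.atTop (nhds (A * 0)) :=
    (tendsto_rpow_neg_atTop (by linarith)).const_mul A
  rw [mul_zero] at h1
  filter_upwards [h1.eventually (lt_mem_nhds (show -(β / 2) < 0 by linarith)),
    Filter.eventually_gt_atTop 1] with t ht ht1
  have ht0 : 0 < t := by linarith
  have h2 : t⁻¹ ≤ t ^ (-q - 1) := by
    rw [← Real.rpow_neg_one]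
    exact Real.rpow_le_rpow_of_exponent_le ht1.le (by linarith)
  have h3 : t ^ (-q' - 1) = t ^ (-(q' - q)) * t ^ (-q - 1) := by
    rw [← Real.rpow_add ht0]
    congr 1
    ring
  have h4 : 0 ≤ t ^ (-q - 1) := by positivity
  rw [h3, div_eq_mul_inv]
  nlinarith

theorem eventually_div_le_logDensity {q : ℝ} (hq : q ≤ 0) :
    ∀ᶠ t in Filter.atTop, 1 / t ≤ logDensity q t := by
  have h1 : Filter.Tendsto (fun t : ℝ => logCoeff q * Real.log t + logConst q) Filter.atTop
      Filter.atTop :=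
    Filter.tendsto_atTop_add_const_right _ _
      (Real.tendsto_log_atTop.const_mul_atTop (logCoeff_pos (by linarith)))
  filter_upwards [h1.eventually_ge_atTop 1, Filter.eventually_gt_atTop 1] with t ht ht1
  have h2 : t⁻¹ ≤ t ^ (-q - 1) := by
    rw [← Real.rpow_neg_one]
    exact Real.rpow_le_rpow_of_exponent_le ht1.le (by linarith)
  have h3 : 0 ≤ t⁻¹ := by positivity
  rw [logDensity, one_div]
  nlinarith

theorem measurable_powerLaw (p : ℝ) : Measurable (powerLaw p) := by
  unfold powerLaw
  split_ifs <;> fun_prop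

theorem continuous_powerLaw {p : ℝ} (hp : 0 < p) : Continuous (powerLaw p) := by
  have h : powerLaw p = fun r => r ^ p / p := funext fun r => if_neg hp.ne'
  rw [h]
  exact (Real.continuous_rpow_const hp.le).div_const p

/-- Writing the function as a multiple of `Real.negMulLog (|r| ^ b)` gives continuity at `0` too.
The absolute value extends the profile continuously to the whole line. -/
theorem continuous_rpow_mul_log {b : ℝ} (hb : 0 < b) :
    Continuous fun r : ℝ => |r| ^ b / b * Real.log r := by
  have h : ∀ r : ℝ, |r| ^ b / b * Real.log r =
      Real.negMulLog (|r| ^ b) * (-(b⁻¹ * b⁻¹)) := by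
    intro r
    rcases eq_or_ne r 0 with rfl | hr
    · simp [Real.zero_rpow hb.ne']
    · rw [Real.negMulLog, Real.log_rpow (abs_pos.2 hr), Real.log_abs]
      field_simp
  simp_rw [h]
  exact (Real.continuous_negMulLog.comp
    ((Real.continuous_rpow_const hb.le).comp continuous_abs)).mul continuous_const

theorem exists_bound_comp_norm {d : ℕ} {w : ℝ → ℝ} (hw : Continuous w) (R : ℝ) :
    ∃ K : ℝ, ∀ x : Rd d, ‖x‖ ≤ R → |w ‖x‖| ≤ K := by
  obtain ⟨K, hK⟩ := (isCompact_Icc (a := 0) (b := R)).exists_bound_of_continuousOn hw.continuousOn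
  exact ⟨K, fun x hx => hK _ ⟨norm_nonneg x, hx⟩⟩

variable {d : ℕ}

theorem IsMixture.exists_eq_sq {m w v : ℝ → ℝ} (h : IsMixture m w)
    (hv : ∀ r, 0 < r → w (r ^ 2) = v r) :
    ∃ B C : ℝ, ∀ r, 0 < r → v r = (∫ t in Ioi 0, gaussRem t (r ^ 2) * m t) + B + C * r ^ 2 := by
  obtain ⟨B, C, h⟩ := h
  exact ⟨B, C, fun r hr => by rw [← hv r hr, h _ (by positivity)]⟩

theorem IsMixingDensity.integrableOn_Ioc {m : ℝ → ℝ} (hm : IsMixingDensity m) :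
    IntegrableOn (fun t => t ^ 2 * m t) (Ioc 0 1) := by
  refine IntegrableOn.mono_set (t := Ioo 0 2) ⟨?_, hm.lintegral_Ioo_lt_top 2⟩ fun t ht =>
    ⟨ht.1, ht.2.trans_lt one_lt_two⟩
  exact ((measurable_id.pow_const 2).mul hm.measurable).aestronglyMeasurable

/-- A radial potential which is infinite at the origin and given by a mixture up to a bounded
function. -/
theorem gaussianLike_of_singular {W : Rd d → EReal} {m w v : ℝ → ℝ} (hWm : Measurable W)
    (heven : ∀ x, W (-x) = W x) (hm : IsMixingDensity m)
    (hW : ∀ x, x ≠ 0 → W x = (w ‖x‖ : ℝ)) (h0 : W 0 = ⊤) (hv : Continuous v)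
    (hw : ∀ r, 0 < r → w r = (∫ t in Ioi 0, gaussRem t (r ^ 2) * m t) + v r)
    {c : ℝ} (hc : 0 < c) (hpos : ∀ᶠ t in Filter.atTop, c / t ≤ m t) :
    IsGaussianLike W ∧ ∀ R : ℝ, ∃ K : ℝ≥0, ∀ x, ‖x‖ ≤ R →
      ∫⁻ t in Ioi 0, ‖gaussRem t (‖x‖ ^ 2) * m t‖ₑ ≤ (W x).toENNReal + K :=
  gaussianLike_of_mixture (v := fun x => v ‖x‖) hWm heven hm
    (fun x hx => by rw [hW x hx, hw _ (norm_pos_iff.2 hx)]) (exists_bound_comp_norm hv) h0 hc hpos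

theorem hasMixture_of_singular {W : Rd d → EReal} {m w : ℝ → ℝ} {B C : ℝ} (hWm : Measurable W)
    (heven : ∀ x, W (-x) = W x) (hm : IsMixingDensity m)
    (hm1 : IntegrableOn (fun t => t ^ (-(d / 2 : ℝ)) * m t) (Ioi 1))
    (hW : ∀ x, x ≠ 0 → W x = (w ‖x‖ : ℝ)) (h0 : W 0 = ⊤)
    (hw : ∀ r, 0 < r → w r = (∫ t in Ioi 0, gaussRem t (r ^ 2) * m t) + B + C * r ^ 2)
    {c : ℝ} (hc : 0 < c) (hpos : ∀ᶠ t in Filter.atTop, c / t ≤ m t) :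
    IsGaussianLike W ∧ HasMixture W m B C := by
  obtain ⟨h1, h2⟩ := gaussianLike_of_singular (v := fun r => B + C * r ^ 2) hWm heven hm hW h0
    (by fun_prop) (fun r hr => by rw [hw r hr, add_assoc]) hc hpos
  refine ⟨h1, hm.measurable, hm.integrableOn_Ioc, hm1, fun x hx => ?_, fun x hx => ?_, h2⟩
  · rw [hW x hx]
    exact EReal.coe_ne_top _
  · have hx0 : x ≠ 0 := by
      rintro rfl
      exact hx h0
    rw [hW x hx0, EReal.toReal_coe, hw _ (norm_pos_iff.2 hx0)]

theorem isGaussianLike_of_continuous {W : Rd d → EReal} {w : ℝ → ℝ} (hWm : Measurable W)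
    (heven : ∀ x, W (-x) = W x) (hW : ∀ x, W x = (w ‖x‖ : ℝ)) (hwc : Continuous w) :
    IsGaussianLike W := by
  refine isGaussianLike_of_bounded hWm heven fun R => ?_
  obtain ⟨K, hK⟩ := exists_bound_comp_norm (d := d) hwc R
  exact ⟨K, fun x hx => ⟨_, hW x, hK x hx⟩⟩

theorem hasMixture_of_continuous {W : Rd d → EReal} {m w : ℝ → ℝ} {B C : ℝ}
    (hm : IsMixingDensity m) (hd1 : IntegrableOn (fun t => t ^ (-(d / 2 : ℝ)) * m t) (Ioi 1))
    (hm1 : IntegrableOn m (Ioi 1)) (hW : ∀ x, W x = (w ‖x‖ : ℝ)) (hwc : Continuous w)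
    (hw : ∀ r, 0 < r → w r = (∫ t in Ioi 0, gaussRem t (r ^ 2) * m t) + B + C * r ^ 2) :
    HasMixture W m B C := by
  refine ⟨hm.measurable, hm.integrableOn_Ioc, hd1, fun x hx => ?_, fun x _ => ?_, fun R => ?_⟩
  · rw [hW x]
    exact EReal.coe_ne_top _
  · rw [hW x, EReal.toReal_coe]
    rcases (norm_nonneg x).eq_or_lt with h | h
    · rw [← h]
      exact integral_gaussRem_zero hm hm1 hw hwc.continuousAt
    · exact hw _ h
  · obtain ⟨K, hK⟩ := lintegral_gaussRem_le_of_integrableOn (d := d) hm hm1 R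
    exact ⟨K, fun x hx => (hK x hx).trans le_add_self⟩

theorem measurable_Wab (a b : ℝ) : Measurable (Wab (d := d) a b) := by
  unfold Wab
  refine Measurable.ite ?_ measurable_const ?_
  · by_cases h : b ≤ 0 <;> simp [h]
  · exact measurable_coe_real_ereal.comp (((measurable_powerLaw a).comp measurable_norm).sub
      ((measurable_powerLaw b).comp measurable_norm))

theorem Wab_neg (a b : ℝ) (x : Rd d) : Wab a b (-x) = Wab a b x := by simp [Wab]

theorem Wab_of_ne (a b : ℝ) {x : Rd d} (hx : x ≠ 0) :
    Wab a b x = ((powerLaw a ‖x‖ - powerLaw b ‖x‖ : ℝ) : EReal) := by simp [Wab, hx]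

theorem Wab_zero {a b : ℝ} (hb : b ≤ 0) : Wab a b (0 : Rd d) = ⊤ := by simp [Wab, hb]

theorem Wab_of_pos {a b : ℝ} (hb : 0 < b) (x : Rd d) :
    Wab a b x = ((powerLaw a ‖x‖ - powerLaw b ‖x‖ : ℝ) : EReal) := by simp [Wab, hb.not_ge]

theorem isMixture_Wab {a b : ℝ} (hab : b < a) (ha : a < 4) :
    IsMixingDensity (fun t => powDensity (a / 2) t - powDensity (b / 2) t) ∧
    ∃ B C : ℝ, ∀ r, 0 < r → powerLaw a r - powerLaw b r =
      (∫ t in Ioi 0, gaussRem t (r ^ 2) * (powDensity (a / 2) t - powDensity (b / 2) t)) +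
        B + C * r ^ 2 := by
  have hma := isMixingDensity_powDensity (q := a / 2) (by linarith)
  have hmb := isMixingDensity_powDensity (q := b / 2) (by linarith)
  refine ⟨hma.sub hmb, ((isMixture_powerLaw ha).sub hma hmb
    (isMixture_powerLaw (by linarith))).exists_eq_sq fun r hr => ?_⟩
  rw [Real.sqrt_sq hr.le]

/-- For `b > 0` the potential is continuous. For `b ≤ 0` the singular term `-|x|^b / b` carries a
positive density because `powCoeff (b / 2) < 0`. -/
theorem isGaussianLike_Wab {a b : ℝ} (hab : b < a) : IsGaussianLike (Wab (d := d) a b) := by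
  rcases le_or_gt b 0 with hb | hb
  · have hβ : 0 < -powCoeff (b / 2) := neg_pos.2 (powCoeff_neg (by linarith))
    rcases lt_or_ge a 4 with ha | ha
    · obtain ⟨hm, B, C, hw⟩ := isMixture_Wab hab ha
      refine (gaussianLike_of_singular (v := fun r => B + C * r ^ 2)
        (w := fun r => powerLaw a r - powerLaw b r) (measurable_Wab a b) (Wab_neg a b) hm (fun x => Wab_of_ne a b) (Wab_zero hb) (by fun_prop)
        (fun r hr => by rw [hw r hr, add_assoc]) (half_pos hβ) ?_).1
      filter_upwards [eventually_div_le_rpow_add (powCoeff (a / 2)) (by linarith : b / 2 ≤ 0)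
        (by linarith : b / 2 < a / 2) hβ] with t ht
      rw [powDensity, powDensity]
      linarith
    -- For `a ≥ 4` the term `|x|^a / a` is not represented by this mixture, but it is continuous. It
    -- joins the bounded remainder, and the zero density takes its place.
    · have hmb := isMixingDensity_powDensity (q := b / 2) (by linarith)
      have hm0 : IsMixingDensity fun _ => 0 := ⟨measurable_const, by simp⟩
      have h0 : IsMixture (fun _ => 0) fun _ => 0 := ⟨0, 0, by simp⟩
      obtain ⟨B, C, hw⟩ := (h0.sub hm0 hmb (isMixture_powerLaw (by linarith))).exists_eq_sq
        (v := fun r => 0 - powerLaw b r) fun r hr => by rw [Real.sqrt_sq hr.le]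
      refine (gaussianLike_of_singular (v := fun r => B + C * r ^ 2 + powerLaw a r)
        (w := fun r => powerLaw a r - powerLaw b r)
        (measurable_Wab a b) (Wab_neg a b) (hm0.sub hmb) (fun x => Wab_of_ne a b) (Wab_zero hb)
        ?_ (fun r hr => ?_) (half_pos hβ) ?_).1
      · have := continuous_powerLaw (p := a) (by linarith)
        fun_prop
      · linarith [hw r hr]
      · filter_upwards [eventually_div_le_rpow_add 0 (by linarith : b / 2 ≤ 0)
          (by linarith : b / 2 < a / 2) hβ] with t ht
        rw [powDensity]
        linarith
  · exact isGaussianLike_of_continuous (w := fun r => powerLaw a r - powerLaw b r)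
      (measurable_Wab a b) (Wab_neg a b) (Wab_of_pos hb)
      ((continuous_powerLaw (hb.trans hab)).sub (continuous_powerLaw hb))

theorem hasMixture_Wab {a b : ℝ} (hdb : -(d : ℝ) < b) (hab : b < a) (ha : a < 4) :
    ∃ m B C, HasMixture (Wab (d := d) a b) m B C := by
  obtain ⟨hm, B, C, hw⟩ := isMixture_Wab hab ha
  -- Used with `s = -d / 2`, where the condition reads `b > -d`, and for `b > 0` also with `s = 0`.
  have hi : ∀ s : ℝ, s < b / 2 →
      IntegrableOn (fun t => t ^ s * (powDensity (a / 2) t - powDensity (b / 2) t)) (Ioi 1) := by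
    intro s hs
    simpa only [mul_sub] using! (integrableOn_Ioi_one_powDensity (hs.trans (by linarith))).sub
      (integrableOn_Ioi_one_powDensity hs)
  refine ⟨fun t => powDensity (a / 2) t - powDensity (b / 2) t, B, C, ?_⟩
  rcases le_or_gt b 0 with hb | hb
  · have hβ : 0 < -powCoeff (b / 2) := neg_pos.2 (powCoeff_neg (by linarith))
    refine (hasMixture_of_singular (measurable_Wab a b) (Wab_neg a b) hm (hi _ (by linarith))
      (w := fun r => powerLaw a r - powerLaw b r)
      (fun x => Wab_of_ne a b) (Wab_zero hb) hw (half_pos hβ) ?_).2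
    filter_upwards [eventually_div_le_rpow_add (powCoeff (a / 2)) (by linarith : b / 2 ≤ 0)
      (by linarith : b / 2 < a / 2) hβ] with t ht
    rw [powDensity, powDensity]
    linarith
  · exact hasMixture_of_continuous hm (hi _ (by linarith))
      (by simpa using hi 0 (by linarith)) (Wab_of_pos hb)
      ((continuous_powerLaw (hb.trans hab)).sub (continuous_powerLaw hb)) hw

theorem measurable_Wbln (b : ℝ) : Measurable (Wbln (d := d) b) := by
  unfold Wbln
  refine Measurable.ite ?_ measurable_const ?_
  · by_cases h : b < 0 <;> simp [h]
  · exact measurable_coe_real_ereal.comp (by fun_prop)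

theorem Wbln_neg (b : ℝ) (x : Rd d) : Wbln b (-x) = Wbln b x := by simp [Wbln]

theorem Wbln_of_ne (b : ℝ) {x : Rd d} (hx : x ≠ 0) :
    Wbln b x = ((‖x‖ ^ b / b * Real.log ‖x‖ : ℝ) : EReal) := by simp [Wbln, hx]

theorem Wbln_zero {b : ℝ} (hb : b < 0) : Wbln b (0 : Rd d) = ⊤ := by simp [Wbln, hb]

theorem Wbln_of_pos {b : ℝ} (hb : 0 < b) (x : Rd d) :
    Wbln b x = ((|‖x‖| ^ b / b * Real.log ‖x‖ : ℝ) : EReal) := by simp [Wbln, hb.not_gt]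

theorem isMixture_Wbln {b : ℝ} (hb0 : b ≠ 0) (hb : b < 4) :
    ∃ B C : ℝ, ∀ r, 0 < r → r ^ b / b * Real.log r =
      (∫ t in Ioi 0, gaussRem t (r ^ 2) * logDensity (b / 2) t) + B + C * r ^ 2 :=
  (isMixture_rpow_mul_log hb hb0).exists_eq_sq fun r hr => by rw [Real.sqrt_sq hr.le]

theorem isGaussianLike_Wbln {b : ℝ} (hb0 : b ≠ 0) : IsGaussianLike (Wbln (d := d) b) := by
  rcases hb0.lt_or_gt with hb | hb
  · obtain ⟨B, C, hw⟩ := isMixture_Wbln hb0 (by linarith)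
    exact (gaussianLike_of_singular (v := fun r => B + C * r ^ 2)
      (w := fun r => r ^ b / b * Real.log r) (measurable_Wbln b) (Wbln_neg b)
      (isMixingDensity_logDensity (q := b / 2) (by linarith)) (fun x => Wbln_of_ne b) (Wbln_zero hb)
      (by fun_prop) (fun r hr => by rw [hw r hr, add_assoc]) one_pos
      (eventually_div_le_logDensity (by linarith))).1
  · exact isGaussianLike_of_continuous (w := fun r => |r| ^ b / b * Real.log r)
      (measurable_Wbln b) (Wbln_neg b) (Wbln_of_pos hb) (continuous_rpow_mul_log hb)

theorem hasMixture_Wbln {b : ℝ} (hdb : -(d : ℝ) < b) (hb0 : b ≠ 0) (hb : b < 4) :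
    ∃ m B C, HasMixture (Wbln (d := d) b) m B C := by
  obtain ⟨B, C, hw⟩ := isMixture_Wbln hb0 hb
  have hm := isMixingDensity_logDensity (q := b / 2) (by linarith)
  have hi : ∀ s : ℝ, s < b / 2 →
      IntegrableOn (fun t => t ^ s * logDensity (b / 2) t) (Ioi 1) := fun s hs =>
    integrableOn_Ioi_one_log_rpow hs _ _
  refine ⟨logDensity (b / 2), B, C, ?_⟩
  rcases hb0.lt_or_gt with hb' | hb'
  · exact (hasMixture_of_singular (measurable_Wbln b) (Wbln_neg b) hm (hi _ (by linarith))
      (w := fun r => r ^ b / b * Real.log r)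
      (fun x => Wbln_of_ne b) (Wbln_zero hb') hw one_pos
      (eventually_div_le_logDensity (by linarith))).2
  · exact hasMixture_of_continuous hm (hi _ (by linarith))
      (by simpa using hi 0 (by linarith)) (Wbln_of_pos hb') (continuous_rpow_mul_log hb')
      fun r hr => by rw [abs_of_pos hr, hw r hr]

end Potentials

/-! ### The Fourier transform of a mixture of Gaussians -/

section GaussHat

variable {d : ℕ}

/-- The Fourier transform of `x ↦ exp (-t |x|²)`. -/
noncomputable def gaussHat (t : ℝ) (ξ : Rd d) : ℝ :=
  (Real.pi / t) ^ (d / 2 : ℝ) * Real.exp (-(Real.pi ^ 2 * ‖ξ‖ ^ 2 / t))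

theorem measurable_gaussHat : Measurable fun p : Rd d × ℝ => gaussHat p.2 p.1 := by
  unfold gaussHat
  fun_prop

theorem gaussHat_nonneg {t : ℝ} (ht : 0 < t) (ξ : Rd d) : 0 ≤ gaussHat t ξ := by
  unfold gaussHat
  positivity

theorem integral_exp_neg_mul_sq_norm {t : ℝ} (ht : 0 < t) :
    ∫ x : Rd d, Real.exp (-(t * ‖x‖ ^ 2)) = (Real.pi / t) ^ (d / 2 : ℝ) := by
  have := GaussianFourier.integral_rexp_neg_mul_sq_norm (V := Rd d) ht
  simpa using this

theorem integrable_exp_neg_mul_sq_norm {t : ℝ} (ht : 0 < t) :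
    Integrable fun x : Rd d => Real.exp (-(t * ‖x‖ ^ 2)) := by
  by_contra h
  have h1 := integral_exp_neg_mul_sq_norm (d := d) ht
  rw [integral_undef h] at h1
  have : 0 < (Real.pi / t) ^ (d / 2 : ℝ) := by positivity
  exact this.ne h1

theorem integrable_gaussHat {t : ℝ} (ht : 0 < t) : Integrable fun ξ : Rd d => gaussHat t ξ := by
  have h := (integrable_exp_neg_mul_sq_norm (d := d) (t := Real.pi ^ 2 / t)
    (by positivity)).const_mul ((Real.pi / t) ^ (d / 2 : ℝ))
  refine h.congr (.of_forall fun ξ => ?_)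
  simp only [gaussHat]
  congr 3
  ring

theorem integral_gaussHat_mul_exp {t : ℝ} (ht : 0 < t) (x : Rd d) :
    ∫ ξ : Rd d, (gaussHat t ξ : ℂ) * Complex.exp (((-2 * Real.pi * ⟪x, ξ⟫_ℝ : ℝ) : ℂ) * Complex.I) =
      (Real.exp (-(t * ‖x‖ ^ 2)) : ℝ) := by
  have hb : 0 < Real.pi ^ 2 / t := by positivity
  have h := GaussianFourier.integral_cexp_neg_mul_sq_norm_add (V := Rd d)
    (b := ((Real.pi ^ 2 / t : ℝ) : ℂ)) (by rwa [Complex.ofReal_re]) (-2 * Real.pi * Complex.I) x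
  have e : ∀ ξ : Rd d, (gaussHat t ξ : ℂ) *
      Complex.exp (((-2 * Real.pi * ⟪x, ξ⟫_ℝ : ℝ) : ℂ) * Complex.I) =
      ((Real.pi / t) ^ (d / 2 : ℝ) : ℝ) * Complex.exp (-((Real.pi ^ 2 / t : ℝ) : ℂ) * ‖ξ‖ ^ 2 +
        -2 * Real.pi * Complex.I * ⟪x, ξ⟫_ℝ) := by
    intro ξ
    rw [gaussHat, Complex.ofReal_mul, Complex.ofReal_exp, mul_assoc, ← Complex.exp_add]
    congr 2
    push_cast
    ring
  simp_rw [e]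
  rw [integral_const_mul, h, finrank_euclideanSpace, Fintype.card_fin]
  have h1 : ((Real.pi : ℂ) / ((Real.pi ^ 2 / t : ℝ) : ℂ)) ^ ((d : ℂ) / 2) =
      (((t / Real.pi) ^ (d / 2 : ℝ) : ℝ) : ℂ) := by
    rw [Complex.ofReal_cpow (by positivity)]
    have hpi : (Real.pi : ℂ) ≠ 0 := Complex.ofReal_ne_zero.2 Real.pi_ne_zero
    have htc : (t : ℂ) ≠ 0 := Complex.ofReal_ne_zero.2 ht.ne'
    push_cast
    congr 1
    field_simp
  have h2 : (-2 * (Real.pi : ℂ) * Complex.I) ^ 2 * (‖x‖ : ℂ) ^ 2 /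
      (4 * ((Real.pi ^ 2 / t : ℝ) : ℂ)) = ((-(t * ‖x‖ ^ 2) : ℝ) : ℂ) := by
    have hpi : (Real.pi : ℂ) ≠ 0 := Complex.ofReal_ne_zero.2 Real.pi_ne_zero
    have htc : (t : ℂ) ≠ 0 := Complex.ofReal_ne_zero.2 ht.ne'
    push_cast
    rw [mul_pow, Complex.I_sq]
    field_simp
    ring
  rw [h1, h2, ← Complex.ofReal_exp, ← mul_assoc, ← Complex.ofReal_mul,
    ← Real.mul_rpow (by positivity) (by positivity)]
  have h3 : Real.pi / t * (t / Real.pi) = 1 := by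
    field_simp
  rw [h3, Real.one_rpow, Complex.ofReal_one, one_mul]

theorem integral_exp_mul_fourier {t : ℝ} (ht : 0 < t) (φ : 𝓢(Rd d, ℂ)) :
    ∫ x, (Real.exp (-(t * ‖x‖ ^ 2)) : ℂ) * 𝓕 φ x = ∫ ξ, (gaussHat t ξ : ℂ) * φ ξ := by
  have hi : Integrable fun x : Rd d => Complex.exp (-(t : ℂ) * ‖x‖ ^ 2) := by
    refine (integrable_exp_neg_mul_sq_norm (d := d) ht).ofReal (𝕜 := ℂ) |>.congr
      (.of_forall fun x => ?_)
    simp [Complex.ofReal_exp]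
  have h := VectorFourier.integral_fourierIntegral_smul_eq_flip (L := innerₗ (Rd d)) (μ := volume)
    (ν := volume) Real.continuous_fourierChar continuous_inner hi φ.integrable
  have hg := fun w : Rd d => fourier_gaussian_innerProductSpace (b := (t : ℂ))
    (by rwa [Complex.ofReal_re]) w
  have e1 : ∀ w : Rd d, 𝓕 (fun v : Rd d => Complex.exp (-(t : ℂ) * ‖v‖ ^ 2)) w = (gaussHat t w : ℂ) := by
    intro w
    rw [hg w, gaussHat, Complex.ofReal_mul, Complex.ofReal_exp, Complex.ofReal_cpow (by positivity),
      finrank_euclideanSpace, Fintype.card_fin]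
    push_cast
    congr 2
    ring
  have e2 : ∫ ξ, (gaussHat t ξ : ℂ) * φ ξ =
      ∫ x, Complex.exp (-(t : ℂ) * ‖x‖ ^ 2) * 𝓕 φ x := by
    simp_rw [← e1]
    simpa using! h
  rw [e2]
  refine integral_congr_ae (.of_forall fun x => ?_)
  simp [Complex.ofReal_exp]

/-- Away from the origin `exp (-c / t)` beats every power of `t` as `t → 0`. The power `d + 2` pays
for the prefactor, bounded by a multiple of `t ^ (-d)`, and leaves `t²`. For `t > 1` the prefactor
alone gives the bound. The two rates are the weights integrated in `HasMixture`. -/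
theorem exists_gaussHat_le {δ : ℝ} (hδ : 0 < δ) : ∃ K : ℝ, 0 ≤ K ∧ ∀ ξ : Rd d, δ ≤ ‖ξ‖ →
    (∀ t, 0 < t → t ≤ 1 → gaussHat t ξ ≤ K * t ^ 2) ∧
      ∀ t, 1 < t → gaussHat t ξ ≤ K * t ^ (-(d / 2 : ℝ)) := by
  set c := Real.pi ^ 2 * δ ^ 2
  have hc : 0 < c := by positivity
  set P := Real.pi ^ (d / 2 : ℝ)
  have hP : 0 ≤ P := by positivity
  set N : ℝ := ((d + 2).factorial : ℝ) / c ^ (d + 2)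
  have hN : 0 ≤ N := by positivity
  have hsplit : ∀ t, 0 < t → (Real.pi / t) ^ (d / 2 : ℝ) = P * t⁻¹ ^ (d / 2 : ℝ) := fun t ht => by
    rw [div_eq_mul_inv, Real.mul_rpow Real.pi_pos.le (inv_pos.2 ht).le]
  refine ⟨P * (N + 1), by positivity, fun ξ hξ => ⟨fun t ht ht1 => ?_, fun t ht => ?_⟩⟩
  · have hs : 1 ≤ t⁻¹ := (one_le_inv₀ ht).2 ht1
    have h1 : Real.exp (-(Real.pi ^ 2 * ‖ξ‖ ^ 2 / t)) ≤ Real.exp (-(c * t⁻¹)) := by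
      rw [div_eq_mul_inv]
      gcongr
      simp only [c]
      gcongr
    have h2 : t⁻¹ ^ (d + 2) * Real.exp (-(c * t⁻¹)) ≤ N := by
      have h3 := Real.pow_div_factorial_le_exp (c * t⁻¹) (by positivity) (d + 2)
      rw [Real.exp_neg, ← div_eq_mul_inv, div_le_iff₀ (Real.exp_pos _)]
      simp only [N]
      rw [div_le_iff₀ (by positivity), mul_pow] at h3
      rw [div_mul_eq_mul_div, le_div_iff₀ (by positivity)]
      linarith
    have h4 : t⁻¹ ^ (d / 2 : ℝ) ≤ t⁻¹ ^ d := by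
      rw [← Real.rpow_natCast]
      exact Real.rpow_le_rpow_of_exponent_le hs (by linarith [(Nat.cast_nonneg d : (0 : ℝ) ≤ d)])
    have h5 : t⁻¹ ^ (d + 2) * t ^ 2 = t⁻¹ ^ d := by
      rw [pow_add, mul_assoc, ← mul_pow, inv_mul_cancel₀ ht.ne', one_pow, mul_one]
    rw [gaussHat, hsplit t ht]
    calc P * t⁻¹ ^ (d / 2 : ℝ) * Real.exp (-(Real.pi ^ 2 * ‖ξ‖ ^ 2 / t))
        ≤ P * t⁻¹ ^ d * Real.exp (-(c * t⁻¹)) := by gcongr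
      _ = P * (t⁻¹ ^ (d + 2) * Real.exp (-(c * t⁻¹))) * t ^ 2 := by rw [← h5]; ring
      _ ≤ P * (N + 1) * t ^ 2 := by
        gcongr
        linarith
  · have ht0 : 0 < t := by linarith
    rw [gaussHat, hsplit t ht0, Real.inv_rpow ht0.le, ← Real.rpow_neg ht0.le]
    have h1 : Real.exp (-(Real.pi ^ 2 * ‖ξ‖ ^ 2 / t)) ≤ 1 :=
      Real.exp_le_one_iff.2 (neg_nonpos.2 (by positivity))
    have h2 : 0 ≤ t ^ (-(d / 2 : ℝ)) := by positivity
    calc P * t ^ (-(d / 2 : ℝ)) * Real.exp (-(Real.pi ^ 2 * ‖ξ‖ ^ 2 / t))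
        ≤ P * t ^ (-(d / 2 : ℝ)) * 1 := by gcongr
      _ ≤ P * (N + 1) * t ^ (-(d / 2 : ℝ)) := by nlinarith [mul_nonneg (mul_nonneg hP h2) hN]

end GaussHat

/-! ### Absolute convergence of mixtures against integrable functions -/

namespace HasMixture

variable {d : ℕ} {W : Rd d → EReal} {m : ℝ → ℝ} {B C : ℝ}

/-- Tonelli with the `x` integral done first: Fubini is thereby reduced to bounding this integral by
`t²` for small `t` and by `t ^ (-d / 2)` for large `t`. -/
theorem integrable_prod (h : HasMixture W m B C) {X : Type*} [MeasurableSpace X] {ν : Measure X}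
    [SFinite ν] {a : X → ℝ → ℂ} (ha : Measurable (Function.uncurry a)) {K : ℝ≥0∞} (hK : K ≠ ⊤)
    (h1 : ∀ t, 0 < t → t ≤ 1 → ∫⁻ x, ‖a x t‖ₑ ∂ν ≤ K * ‖t ^ 2‖ₑ)
    (h2 : ∀ t, 1 < t → ∫⁻ x, ‖a x t‖ₑ ∂ν ≤ K * ‖t ^ (-(d / 2 : ℝ))‖ₑ) :
    Integrable (fun p : X × ℝ => a p.1 p.2 * (m p.2 : ℂ)) (ν.prod (volume.restrict (Ioi 0))) := by
  have hmeas : Measurable fun p : X × ℝ => a p.1 p.2 * (m p.2 : ℂ) :=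
    ha.mul (Complex.measurable_ofReal.comp (h.measurable.comp measurable_snd))
  refine ⟨hmeas.aestronglyMeasurable, ?_⟩
  rw [hasFiniteIntegral_iff_enorm, lintegral_prod_symm' _ hmeas.enorm]
  have e : ∀ t, ∫⁻ x, ‖a x t * (m t : ℂ)‖ₑ ∂ν = (∫⁻ x, ‖a x t‖ₑ ∂ν) * ‖m t‖ₑ := by
    intro t
    simp_rw [enorm_mul]
    rw [lintegral_mul_const' _ _ enorm_ne_top]
    congr 1
    simp [← ofReal_norm]
  simp_rw [e]
  rw [← Ioc_union_Ioi_eq_Ioi zero_le_one]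
  refine (lintegral_union_le _ _ _).trans_lt (ENNReal.add_lt_top.2 ⟨?_, ?_⟩)
  · calc ∫⁻ t in Ioc 0 1, (∫⁻ x, ‖a x t‖ₑ ∂ν) * ‖m t‖ₑ
        ≤ ∫⁻ t in Ioc 0 1, K * ‖t ^ 2 * m t‖ₑ := by
          refine setLIntegral_mono' measurableSet_Ioc fun t ht => ?_
          rw [enorm_mul, ← mul_assoc]
          gcongr
          exact h1 t ht.1 ht.2
      _ < ⊤ := by
          rw [lintegral_const_mul' _ _ hK]
          exact ENNReal.mul_lt_top hK.lt_top h.integrableOn_Ioc.2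
  · calc ∫⁻ t in Ioi 1, (∫⁻ x, ‖a x t‖ₑ ∂ν) * ‖m t‖ₑ
        ≤ ∫⁻ t in Ioi 1, K * ‖t ^ (-(d / 2 : ℝ)) * m t‖ₑ := by
          refine setLIntegral_mono' measurableSet_Ioi fun t ht => ?_
          rw [enorm_mul, ← mul_assoc]
          gcongr
          exact h2 t ht
      _ < ⊤ := by
          rw [lintegral_const_mul' _ _ hK]
          exact ENNReal.mul_lt_top hK.lt_top h.integrableOn_Ioi.2

/-- For small `t` the Taylor remainder is at most `t² |x|⁴`, whence the fourth moment. For large `t`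
the total mass of the Gaussian provides `t ^ (-d / 2)`. -/
theorem integrable_gaussRem_mul (h : HasMixture W m B C) {f : Rd d → ℂ} (hf : Measurable f)
    {M : ℝ} (hM : ∀ x, ‖f x‖ ≤ M) (hf4 : Integrable fun x => ‖x‖ ^ 4 * ‖f x‖) :
    Integrable (fun p : Rd d × ℝ => (gaussRem p.2 (‖p.1‖ ^ 2) : ℂ) * f p.1 * (m p.2 : ℂ))
      (volume.prod (volume.restrict (Ioi 0))) := by
  have hM0 : 0 ≤ M := (norm_nonneg _).trans (hM 0)
  refine h.integrable_prod (a := fun x t => (gaussRem t (‖x‖ ^ 2) : ℂ) * f x) ?_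
    (K := (∫⁻ x, ‖‖x‖ ^ 4 * ‖f x‖‖ₑ) + ENNReal.ofReal (M * Real.pi ^ (d / 2 : ℝ)))
    (ENNReal.add_ne_top.2 ⟨hf4.2.ne, ENNReal.ofReal_ne_top⟩) ?_ ?_
  · refine (Complex.measurable_ofReal.comp (measurable_gaussRem.comp
      (measurable_snd.prodMk (measurable_fst.norm.pow_const 2)))).mul (hf.comp measurable_fst)
  · intro t ht ht1
    rw [add_mul]
    refine le_trans ?_ le_self_add
    rw [← lintegral_mul_const' _ _ enorm_ne_top]
    refine lintegral_mono fun x => ?_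
    rw [← ofReal_norm, ← ofReal_norm, ← ofReal_norm, ← ENNReal.ofReal_mul (norm_nonneg _)]
    refine ENNReal.ofReal_le_ofReal ?_
    rw [norm_mul, Complex.norm_real, norm_mul, norm_norm, Real.norm_eq_abs,
      Real.norm_of_nonneg (by positivity), Real.norm_of_nonneg (by positivity)]
    have := mul_le_mul_of_nonneg_right
      (abs_gaussRem_le_sq ht.le ht1 (sq_nonneg ‖x‖)) (norm_nonneg (f x))
    refine this.trans_eq (by ring)
  · intro t ht
    have ht0 : 0 < t := by linarith
    refine le_trans ?_ (mul_le_mul_left (le_add_self) _)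
    calc ∫⁻ x : Rd d, ‖(gaussRem t (‖x‖ ^ 2) : ℂ) * f x‖ₑ
        ≤ ∫⁻ x : Rd d, ENNReal.ofReal (Real.exp (-(t * ‖x‖ ^ 2))) * ENNReal.ofReal M := by
          refine lintegral_mono fun x => ?_
          rw [← ofReal_norm, ← ENNReal.ofReal_mul (Real.exp_nonneg _), norm_mul, Complex.norm_real,
            gaussRem_of_one_lt ht, Real.norm_of_nonneg (Real.exp_nonneg _)]
          exact ENNReal.ofReal_le_ofReal (mul_le_mul_of_nonneg_left (hM x) (Real.exp_nonneg _))
      _ = ENNReal.ofReal (M * Real.pi ^ (d / 2 : ℝ)) * ‖t ^ (-(d / 2 : ℝ))‖ₑ := by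
          rw [lintegral_mul_const' _ _ ENNReal.ofReal_ne_top,
            ← ofReal_integral_eq_lintegral_ofReal (integrable_exp_neg_mul_sq_norm ht0)
              (.of_forall fun x => Real.exp_nonneg _), integral_exp_neg_mul_sq_norm ht0,
            ← ENNReal.ofReal_mul (by positivity), Real.enorm_of_nonneg (by positivity),
            ← ENNReal.ofReal_mul (by positivity), Real.div_rpow Real.pi_pos.le ht0.le,
            Real.rpow_neg ht0.le]
          congr 1
          ring

theorem integrable_gaussHat_mul (h : HasMixture W m B C) {X : Type*} [MeasurableSpace X]
    {ν : Measure X} [SFinite ν] {f : X → ℂ} (hf : Measurable f) (hfi : Integrable f ν)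
    {z : X → Rd d} (hz : Measurable z) {δ : ℝ} (hδ : 0 < δ) (hfδ : ∀ x, f x ≠ 0 → δ ≤ ‖z x‖) :
    Integrable (fun p : X × ℝ => (gaussHat p.2 (z p.1) : ℂ) * f p.1 * (m p.2 : ℂ))
      (ν.prod (volume.restrict (Ioi 0))) := by
  obtain ⟨K, hK0, hK⟩ := exists_gaussHat_le (d := d) hδ
  have key : ∀ (t s : ℝ), 0 < t → 0 ≤ s → (∀ ξ : Rd d, δ ≤ ‖ξ‖ → gaussHat t ξ ≤ K * s) →
      ∫⁻ x, ‖(gaussHat t (z x) : ℂ) * f x‖ₑ ∂ν ≤ (ENNReal.ofReal K * ∫⁻ x, ‖f x‖ₑ ∂ν) * ‖s‖ₑ := by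
    intro t s ht hs hle
    rw [← lintegral_const_mul' _ _ ENNReal.ofReal_ne_top, ← lintegral_mul_const' _ _ enorm_ne_top]
    refine lintegral_mono fun x => ?_
    by_cases hx : f x = 0
    · simp [hx]
    · rw [enorm_mul, mul_right_comm]
      gcongr
      rw [← ofReal_norm, Complex.norm_real, Real.norm_of_nonneg (gaussHat_nonneg ht _),
        Real.enorm_of_nonneg hs, ← ENNReal.ofReal_mul hK0]
      exact ENNReal.ofReal_le_ofReal (hle _ (hfδ x hx))
  refine h.integrable_prod (a := fun x t => (gaussHat t (z x) : ℂ) * f x) ?_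
    (K := ENNReal.ofReal K * ∫⁻ x, ‖f x‖ₑ ∂ν)
    (ENNReal.mul_ne_top ENNReal.ofReal_ne_top hfi.2.ne) ?_ ?_
  · exact (Complex.measurable_ofReal.comp (measurable_gaussHat.comp
      ((hz.comp measurable_fst).prodMk measurable_snd))).mul (hf.comp measurable_fst)
  · exact fun t ht ht1 => key t _ ht (sq_nonneg t) fun ξ hξ => (hK ξ hξ).1 t ht ht1
  · exact fun t ht => key t _ (by linarith) (by positivity) fun ξ hξ => (hK ξ hξ).2 t ht

end HasMixture

/-! ### The potential as a tempered distribution -/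

section Tempered

variable {d : ℕ}

theorem ae_ne_zero (hd : 0 < d) : ∀ᵐ x : Rd d, x ≠ 0 := by
  have : Nonempty (Fin d) := ⟨⟨0, hd⟩⟩
  exact compl_mem_ae_iff.2 (measure_singleton (0 : Rd d))

theorem compl_zero_ae_eq_univ (hd : 0 < d) : ({0}ᶜ : Set (Rd d)) =ᵐ[volume] univ := by
  filter_upwards [ae_ne_zero hd] with x hx
  exact eq_true hx

theorem integral_gaussRem_mul {t : ℝ} (ht : 0 ≤ t) (ht1 : t ≤ 1) {f : Rd d → ℂ}
    (hf : Measurable f) (hf0 : Integrable f)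
    (hf2 : Integrable fun x => ((‖x‖ ^ 2 : ℝ) : ℂ) * f x) :
    ∫ x, (gaussRem t (‖x‖ ^ 2) : ℂ) * f x = (∫ x, (Real.exp (-(t * ‖x‖ ^ 2)) : ℂ) * f x) -
      ((∫ x, f x) - t * ∫ x, ((‖x‖ ^ 2 : ℝ) : ℂ) * f x) := by
  have hE : Integrable fun x : Rd d => (Real.exp (-(t * ‖x‖ ^ 2)) : ℂ) * f x := by
    refine hf0.norm.mono' ?_ (.of_forall fun x => ?_)
    · exact ((Complex.measurable_ofReal.comp (Real.measurable_exp.comp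
        ((measurable_norm.pow_const 2).const_mul t).neg)).mul hf).aestronglyMeasurable
    · rw [norm_mul, Complex.norm_real, Real.norm_of_nonneg (Real.exp_nonneg _)]
      refine mul_le_of_le_one_left (norm_nonneg _) (Real.exp_le_one_iff.2 ?_)
      exact neg_nonpos.2 (by positivity)
  have e : ∀ x : Rd d, (gaussRem t (‖x‖ ^ 2) : ℂ) * f x =
      (Real.exp (-(t * ‖x‖ ^ 2)) : ℂ) * f x -
        (f x - (t : ℂ) * (((‖x‖ ^ 2 : ℝ) : ℂ) * f x)) := by
    intro x
    rw [gaussRem, if_pos ht1]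
    push_cast
    ring
  simp_rw [e]
  rw [integral_sub (g := fun x => f x - (t : ℂ) * (((‖x‖ ^ 2 : ℝ) : ℂ) * f x)) hE (hf0.sub (hf2.const_mul _)), integral_sub hf0 (hf2.const_mul _),
    integral_const_mul]

/-- The Fourier transform off the origin of the mixture with density `m`. -/
noncomputable def mixHat (m : ℝ → ℝ) (ξ : Rd d) : ℝ := ∫ t in Ioi 0, gaussHat t ξ * m t

namespace HasMixture

variable {W : Rd d → EReal} {m : ℝ → ℝ} {B C : ℝ}

theorem toReal_mul_ae_eq (h : HasMixture W m B C) (hd : 0 < d) (f : Rd d → ℂ) :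
    (fun x => ((W x).toReal : ℂ) * f x) =ᵐ[volume] fun x =>
      (∫ t in Ioi 0, (gaussRem t (‖x‖ ^ 2) : ℂ) * f x * (m t : ℂ)) +
        ((B : ℂ) * f x + (C : ℂ) * (((‖x‖ ^ 2 : ℝ) : ℂ) * f x)) := by
  filter_upwards [ae_ne_zero hd] with x hx
  have e : ∀ t : ℝ, (gaussRem t (‖x‖ ^ 2) : ℂ) * f x * (m t : ℂ) =
      ((gaussRem t (‖x‖ ^ 2) * m t : ℝ) : ℂ) * f x := fun t => by push_cast; ring
  simp_rw [e]
  rw [integral_mul_const, integral_complex_ofReal, h.toReal_eq x (h.ne_top x hx)]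
  push_cast
  ring

theorem integrable_toReal_mul (h : HasMixture W m B C) (hd : 0 < d) {f : Rd d → ℂ}
    (hf : Measurable f) {M : ℝ} (hM : ∀ x, ‖f x‖ ≤ M) (hf0 : Integrable f)
    (hf2 : Integrable fun x => ‖x‖ ^ 2 * ‖f x‖) (hf4 : Integrable fun x => ‖x‖ ^ 4 * ‖f x‖) :
    Integrable fun x => ((W x).toReal : ℂ) * f x := by
  refine Integrable.congr ?_ (h.toReal_mul_ae_eq hd f).symm
  refine (h.integrable_gaussRem_mul hf hM hf4).integral_prod_left.add
    ((hf0.const_mul _).add (Integrable.const_mul ?_ _))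
  refine hf2.mono' ?_ (.of_forall fun x => ?_)
  · exact ((Complex.measurable_ofReal.comp (measurable_norm.pow_const 2)).mul
      hf).aestronglyMeasurable
  · rw [norm_mul, Complex.norm_real, Real.norm_of_nonneg (by positivity)]

/-- The two vanishing moments remove both the polynomial `B + C|x|²` and the Taylor polynomials
inside `gaussRem`, leaving unregularized Gaussians. -/
theorem integral_toReal_mul_of_moments (h : HasMixture W m B C) (hd : 0 < d) {f : Rd d → ℂ}
    (hf : Measurable f) {M : ℝ} (hM : ∀ x, ‖f x‖ ≤ M) (hf0 : Integrable f)
    (hf2 : Integrable fun x => ((‖x‖ ^ 2 : ℝ) : ℂ) * f x)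
    (hf4 : Integrable fun x => ‖x‖ ^ 4 * ‖f x‖)
    (hm0 : ∫ x, f x = 0) (hm2 : ∫ x, ((‖x‖ ^ 2 : ℝ) : ℂ) * f x = 0) :
    ∫ x, ((W x).toReal : ℂ) * f x =
      ∫ t in Ioi 0, (∫ x, (Real.exp (-(t * ‖x‖ ^ 2)) : ℂ) * f x) * (m t : ℂ) := by
  have hi := h.integrable_gaussRem_mul hf hM hf4
  rw [integral_congr_ae (h.toReal_mul_ae_eq hd f), integral_add hi.integral_prod_left
    (g := fun x => (B : ℂ) * f x + (C : ℂ) * (((‖x‖ ^ 2 : ℝ) : ℂ) * f x))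
    ((hf0.const_mul _).add (hf2.const_mul _)), integral_add (hf0.const_mul _) (hf2.const_mul _),
    integral_const_mul, integral_const_mul, hm0, hm2, mul_zero, mul_zero, add_zero, add_zero,
    integral_integral_swap (f := fun (x : Rd d) (t : ℝ) =>
      (gaussRem t (‖x‖ ^ 2) : ℂ) * f x * (m t : ℂ)) hi]
  refine setIntegral_congr_fun measurableSet_Ioi fun t ht => ?_
  rw [integral_mul_const]
  congr 1
  by_cases ht1 : t ≤ 1
  · rw [integral_gaussRem_mul (mem_Ioi.1 ht).le ht1 hf hf0 hf2, hm0, hm2]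
    simp
  · simp_rw [gaussRem_of_one_lt (not_le.1 ht1)]

theorem exists_temperedDistribution (h : HasMixture W m B C) (hd : 0 < d) :
    ∃ T : 𝓢'(Rd d, ℂ), ∀ φ : 𝓢(Rd d, ℂ), Integrable (fun x => ((W x).toReal : ℂ) * φ x) ∧
      T φ = ∫ x, ((W x).toReal : ℂ) * φ x := by
  have hint : ∀ φ : 𝓢(Rd d, ℂ), Integrable (fun x => ((W x).toReal : ℂ) * φ x) := fun φ =>
    h.integrable_toReal_mul hd φ.continuous.measurable (fun x => SchwartzMap.norm_le_seminorm ℂ φ x)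
      φ.integrable (φ.integrable_pow_mul volume 2) (φ.integrable_pow_mul volume 4)
  set n := d + 5
  let w : Rd d → ℝ := fun x => (1 + ‖x‖) ^ (-(n : ℝ))
  have hw0 : ∀ x, 0 ≤ w x := fun x => by positivity
  have hwm : Measurable w := by fun_prop
  have hwi : ∀ k : ℕ, k ≤ 4 → Integrable fun x => ‖x‖ ^ k * ‖(w x : ℂ)‖ := by
    intro k hk
    have h1 : Integrable fun x : Rd d => (1 + ‖x‖) ^ (-(d + 1 : ℝ)) :=
      integrable_one_add_norm (by simp)
    refine h1.mono' ?_ (.of_forall fun x => ?_)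
    · exact ((measurable_norm.pow_const k).mul
        (Complex.measurable_ofReal.comp hwm).norm).aestronglyMeasurable
    · rw [norm_mul, norm_norm, Complex.norm_real, Real.norm_of_nonneg (hw0 x),
        Real.norm_of_nonneg (by positivity)]
      have h2 : (1 : ℝ) ≤ 1 + ‖x‖ := by linarith [norm_nonneg x]
      calc ‖x‖ ^ k * w x ≤ (1 + ‖x‖) ^ 4 * w x := by
            gcongr
            exact (pow_le_pow_left₀ (norm_nonneg x) (by linarith) k).trans
              (pow_le_pow_right₀ h2 hk)
        _ = (1 + ‖x‖) ^ (-(d + 1 : ℝ)) := by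
            simp only [w]
            rw [← Real.rpow_natCast, ← Real.rpow_add (by linarith)]
            congr 1
            simp only [n]
            push_cast
            ring
  have hw1 : ∀ x, ‖(w x : ℂ)‖ ≤ 1 := fun x => by
    rw [Complex.norm_real, Real.norm_of_nonneg (hw0 x)]
    exact Real.rpow_le_one_of_one_le_of_nonpos (by linarith [norm_nonneg x]) (by simp)
  have hWw : Integrable fun x => ((W x).toReal : ℂ) * (w x : ℂ) := by
    refine h.integrable_toReal_mul hd (Complex.measurable_ofReal.comp hwm) hw1 ?_
      (hwi 2 (by norm_num)) (hwi 4 (by norm_num))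
    refine (hwi 0 (by norm_num)).mono' (Complex.measurable_ofReal.comp hwm).aestronglyMeasurable
      (.of_forall fun x => by simp)
  let L : 𝓢(Rd d, ℂ) →L[ℂ] ℂ := by
    refine SchwartzMap.mkCLMtoNormedSpace (fun φ => ∫ x, ((W x).toReal : ℂ) * φ x)
      (fun φ ψ => ?_) (fun c φ => ?_) ⟨Finset.Iic (n, 0),
        2 ^ n * ∫ x, ‖((W x).toReal : ℂ) * (w x : ℂ)‖, by positivity, fun φ => ?_⟩
    · rw [← integral_add (hint φ) (hint ψ)]
      simp [mul_add]
    · simp only [smul_apply, smul_eq_mul, RingHom.id_apply]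
      rw [← integral_const_mul]
      congr 1
      ext x
      ring
    · refine (norm_integral_le_integral_norm _).trans ?_
      have h' : ∀ x, ‖φ x‖ ≤ w x * (2 ^ n * ((Finset.Iic (n, 0)).sup
          (fun m' : ℕ × ℕ => SchwartzMap.seminorm ℂ m'.1 m'.2) φ)) := by
        intro x
        simp only [w]
        rw [Real.rpow_neg (by positivity), ← div_eq_inv_mul, le_div_iff₀' (by positivity),
          Real.rpow_natCast]
        simpa using SchwartzMap.one_add_le_sup_seminorm_apply (𝕜 := ℂ) (m := (n, 0)) (k := n)
          (n := 0) le_rfl le_rfl φ x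
      calc ∫ x, ‖((W x).toReal : ℂ) * φ x‖
          ≤ ∫ x, ‖((W x).toReal : ℂ) * (w x : ℂ)‖ * (2 ^ n * ((Finset.Iic (n, 0)).sup
            (fun m' : ℕ × ℕ => SchwartzMap.seminorm ℂ m'.1 m'.2) φ)) := by
            refine integral_mono (hint φ).norm (hWw.norm.mul_const _) fun x => ?_
            simp only
            rw [norm_mul, norm_mul, mul_assoc]
            refine mul_le_mul_of_nonneg_left ?_ (norm_nonneg _)
            rw [Complex.norm_real (w x), Real.norm_of_nonneg (hw0 x)]
            exact h' x
        _ = _ := by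
            rw [integral_mul_const]
            unfold schwartzSeminormFamily
            ring
  exact ⟨ContinuousLinearMap.toPointwiseConvergenceCLM _ _ _ _ L, fun φ => ⟨hint φ, rfl⟩⟩

end HasMixture

end Tempered

/-- Letting `t → 0` gives `a = 0`; dividing by `t` and letting `t → 0` again gives `b = 0`. It
serves to read off two moments from an expansion in `t`. -/
theorem eq_zero_of_norm_sub_mul_le_sq {a b : ℂ} {K : ℝ}
    (h : ∀ t : ℝ, 0 < t → t ≤ 1 → ‖a - t * b‖ ≤ K * t ^ 2) : a = 0 ∧ b = 0 := by
  have hev : ∀ᶠ t : ℝ in nhdsWithin 0 (Ioi 0), 0 < t ∧ t ≤ 1 := by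
    filter_upwards [Ioc_mem_nhdsGT (zero_lt_one' ℝ)] with t ht using ht
  have hlim : ∀ {f : ℝ → ℝ}, Continuous f → Filter.Tendsto f (nhdsWithin 0 (Ioi 0)) (nhds (f 0)) :=
    fun hf => (hf.tendsto 0).mono_left nhdsWithin_le_nhds
  have ha : ‖a‖ ≤ K * 0 ^ 2 + 0 * ‖b‖ := by
    refine ge_of_tendsto (hlim (f := fun t => K * t ^ 2 + t * ‖b‖) (by fun_prop)) ?_
    filter_upwards [hev] with t ht
    have h1 := norm_sub_norm_le a (t * b)
    rw [norm_mul, Complex.norm_real, Real.norm_of_nonneg ht.1.le] at h1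
    linarith [h t ht.1 ht.2]
  have ha0 : a = 0 := norm_le_zero_iff.1 (by simpa using ha)
  have hb : ‖b‖ ≤ K * 0 := by
    refine ge_of_tendsto (hlim (f := fun t => K * t) (by fun_prop)) ?_
    filter_upwards [hev] with t ht
    have h1 := h t ht.1 ht.2
    rw [ha0, zero_sub, norm_neg, norm_mul, Complex.norm_real, Real.norm_of_nonneg ht.1.le] at h1
    exact le_of_mul_le_mul_left (by linarith) ht.1
  exact ⟨ha0, norm_le_zero_iff.1 (by simpa using hb)⟩

/-! ### The Fourier transform off the origin and its uniqueness -/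

section Fourier

variable {d : ℕ}

theorem exists_le_norm_of_zero_notMem_tsupport {f : Rd d → ℂ} (h : (0 : Rd d) ∉ tsupport f) :
    ∃ δ > 0, ∀ ξ, f ξ ≠ 0 → δ ≤ ‖ξ‖ := by
  obtain ⟨δ, hδ, hb⟩ := Metric.isOpen_iff.1 (isClosed_tsupport f).isOpen_compl 0 h
  refine ⟨δ, hδ, fun ξ hξ => not_lt.1 fun hlt => ?_⟩
  exact hb (by simpa using hlt) (subset_tsupport f hξ)

theorem integrable_sq_norm_mul (φ : 𝓢(Rd d, ℂ)) :
    Integrable fun x => ((‖x‖ ^ 2 : ℝ) : ℂ) * φ x := by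
  refine (φ.integrable_pow_mul volume 2).mono' ?_ (.of_forall fun x => ?_)
  · exact ((Complex.measurable_ofReal.comp (measurable_norm.pow_const 2)).mul
      φ.continuous.measurable).aestronglyMeasurable
  · rw [norm_mul, Complex.norm_real, Real.norm_of_nonneg (by positivity)]

/-- If `φ` vanishes near the origin, then its Fourier transform has vanishing integral and second
moment. -/
theorem integral_fourier_eq_zero {φ : 𝓢(Rd d, ℂ)} {δ : ℝ} (hδ : 0 < δ)
    (hφ : ∀ ξ, φ ξ ≠ 0 → δ ≤ ‖ξ‖) :
    ∫ x, 𝓕 φ x = 0 ∧ ∫ x, ((‖x‖ ^ 2 : ℝ) : ℂ) * 𝓕 φ x = 0 := by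
  obtain ⟨K, hK0, hK⟩ := exists_gaussHat_le (d := d) hδ
  have h4 := (𝓕 φ).integrable_pow_mul volume 4
  refine eq_zero_of_norm_sub_mul_le_sq
    (K := K * (∫ ξ, ‖φ ξ‖) + ∫ x, ‖x‖ ^ 4 * ‖𝓕 φ x‖) fun t ht ht1 => ?_
  -- The zeroth moment minus `t` times the second is the Gaussian integral of `𝓕 φ` minus that of
  -- its Taylor remainder. The first is `O(t²)` because `gaussHat t` decays on the support of `φ`,
  -- the second because of the fourth moment.
  have e := integral_gaussRem_mul ht.le ht1 (𝓕 φ).continuous.measurable (𝓕 φ).integrable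
    (integrable_sq_norm_mul (𝓕 φ))
  rw [integral_exp_mul_fourier ht] at e
  rw [← sub_sub_self (∫ ξ, (gaussHat t ξ : ℂ) * φ ξ)
    ((∫ x, 𝓕 φ x) - t * ∫ x, ((‖x‖ ^ 2 : ℝ) : ℂ) * 𝓕 φ x), ← e, add_mul]
  refine (norm_sub_le _ _).trans (add_le_add ?_ ?_)
  · rw [mul_right_comm, ← integral_const_mul]
    refine norm_integral_le_of_norm_le (φ.integrable.norm.const_mul _) (.of_forall fun ξ => ?_)
    rw [norm_mul, Complex.norm_real, Real.norm_of_nonneg (gaussHat_nonneg ht _)]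
    by_cases hξ : φ ξ = 0
    · simp [hξ]
    · exact mul_le_mul_of_nonneg_right ((hK ξ (hφ ξ hξ)).1 t ht ht1) (norm_nonneg _)
  · rw [← integral_mul_const]
    refine norm_integral_le_of_norm_le (h4.mul_const _) (.of_forall fun x => ?_)
    rw [norm_mul, Complex.norm_real, Real.norm_eq_abs]
    have := mul_le_mul_of_nonneg_right
      (abs_gaussRem_le_sq ht.le ht1 (sq_nonneg ‖x‖)) (norm_nonneg (𝓕 φ x))
    refine this.trans_eq (by ring)

namespace HasMixture

variable {W : Rd d → EReal} {m : ℝ → ℝ} {B C : ℝ}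

/-- Once the moments of `𝓕 φ` vanish, each Gaussian is moved to the frequency side. The support of
`φ` stays away from `0`, which is what allows the `t` integral to be taken inside. -/
theorem integral_toReal_mul_fourier (h : HasMixture W m B C) (hd : 0 < d) {φ : 𝓢(Rd d, ℂ)}
    (hφ : (0 : Rd d) ∉ tsupport φ) :
    ∫ x, ((W x).toReal : ℂ) * 𝓕 φ x = ∫ ξ, (mixHat m ξ : ℂ) * φ ξ := by
  obtain ⟨δ, hδ, hφδ⟩ := exists_le_norm_of_zero_notMem_tsupport hφ
  obtain ⟨hm0, hm2⟩ := integral_fourier_eq_zero hδ hφδ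
  rw [h.integral_toReal_mul_of_moments hd (𝓕 φ).continuous.measurable
    (fun x => SchwartzMap.norm_le_seminorm ℂ _ x) (𝓕 φ).integrable (integrable_sq_norm_mul _)
    ((𝓕 φ).integrable_pow_mul volume 4) hm0 hm2]
  have hi := h.integrable_gaussHat_mul (ν := volume) φ.continuous.measurable φ.integrable measurable_id hδ hφδ
  calc ∫ t in Ioi 0, (∫ x, (Real.exp (-(t * ‖x‖ ^ 2)) : ℂ) * 𝓕 φ x) * (m t : ℂ)
      = ∫ t in Ioi 0, ∫ ξ, (gaussHat t ξ : ℂ) * φ ξ * (m t : ℂ) := by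
        refine setIntegral_congr_fun measurableSet_Ioi fun t ht => ?_
        rw [integral_exp_mul_fourier ht, integral_mul_const]
    _ = ∫ ξ, ∫ t in Ioi 0, (gaussHat t ξ : ℂ) * φ ξ * (m t : ℂ) :=
        (integral_integral_swap (f := fun (ξ : Rd d) (t : ℝ) =>
          (gaussHat t ξ : ℂ) * φ ξ * (m t : ℂ)) hi).symm
    _ = ∫ ξ, (mixHat m ξ : ℂ) * φ ξ := by
        refine integral_congr_ae (.of_forall fun ξ => ?_)
        have e : ∀ t : ℝ, (gaussHat t ξ : ℂ) * φ ξ * (m t : ℂ) =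
            ((gaussHat t ξ * m t : ℝ) : ℂ) * φ ξ := fun t => by push_cast; ring
        simp_rw [e]
        rw [integral_mul_const, integral_complex_ofReal, mixHat]

/-- Fubini against the indicator of a ball about `ξ₀` of radius `‖ξ₀‖ / 2`, which keeps that same
distance from the origin. -/
theorem locallyIntegrableOn_mixHat (h : HasMixture W m B C) :
    LocallyIntegrableOn (mixHat (d := d) m) {0}ᶜ := by
  intro ξ₀ hξ₀
  have hδ : 0 < ‖ξ₀‖ / 2 := half_pos (norm_pos_iff.2 hξ₀)
  refine ⟨ball ξ₀ (‖ξ₀‖ / 2), mem_nhdsWithin_of_mem_nhds (ball_mem_nhds _ hδ), ?_⟩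
  have hi := (h.integrable_gaussHat_mul (ν := volume)
    (f := (ball ξ₀ (‖ξ₀‖ / 2)).indicator fun _ => (1 : ℂ))
    (measurable_const.indicator measurableSet_ball)
    (IntegrableOn.integrable_indicator (integrableOn_const measure_ball_lt_top.ne)
      measurableSet_ball) measurable_id hδ (fun ξ hξ => ?_)).integral_prod_left
  · refine ((hi.integrableOn (s := ball ξ₀ (‖ξ₀‖ / 2))).congr_fun (fun ξ hξ => ?_)
      measurableSet_ball).re (f := fun ξ => ((mixHat m ξ : ℝ) : ℂ))
    simp only [indicator_of_mem hξ, mul_one, id_eq, ← Complex.ofReal_mul]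
    rw [integral_complex_ofReal, mixHat]
  · have h1 : ξ ∈ ball ξ₀ (‖ξ₀‖ / 2) := by
      by_contra hn
      exact hξ (indicator_of_notMem hn _)
    rw [mem_ball, dist_comm, dist_eq_norm] at h1
    have := norm_sub_norm_le ξ₀ ξ
    simp only [id_eq]
    linarith

theorem isFourierOffZero_mixHat (h : HasMixture W m B C) (hd : 0 < d) :
    IsFourierOffZero W (mixHat m) := by
  obtain ⟨T, hT⟩ := h.exists_temperedDistribution hd
  refine ⟨h.locallyIntegrableOn_mixHat, T, hT, fun φ _ hφ => ?_⟩
  rw [TemperedDistribution.fourier_apply, (hT _).2, h.integral_toReal_mul_fourier hd hφ]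

end HasMixture

theorem integrable_mul_of_locallyIntegrableOn {g f : Rd d → ℝ} {U : Set (Rd d)}
    (hg : LocallyIntegrableOn g U) (hf : Continuous f) (hc : HasCompactSupport f)
    (hU : tsupport f ⊆ U) : Integrable fun x => f x * g x := by
  have h1 := (hg.integrableOn_compact_subset hU hc).continuousOn_mul hf.continuousOn hc
  exact (integrableOn_iff_integrable_of_support_subset fun x hx =>
    subset_tsupport f (left_ne_zero_of_mul hx)).1 h1

/-- Both distributions are integration against `W`, so the two functions have the same integral
against every smooth function with compact support off the origin. The fundamental lemma of the
calculus of variations concludes. -/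
theorem IsFourierOffZero.ae_eq (hd : 0 < d) {W : Rd d → EReal} {g g' : Rd d → ℝ}
    (h : IsFourierOffZero W g) (h' : IsFourierOffZero W g') : g =ᵐ[volume] g' := by
  obtain ⟨hg, T, hT, hTg⟩ := h
  obtain ⟨hg', T', hT', hTg'⟩ := h'
  have key := IsOpen.ae_eq_zero_of_integral_contDiff_smul_eq_zero (μ := volume)
    (isOpen_compl_singleton (x := (0 : Rd d))) (hg.sub hg') fun f hf hc hU => ?_
  · filter_upwards [key, ae_ne_zero hd] with x hx h0
    exact sub_eq_zero.1 (hx h0)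
  · have i1 := integrable_mul_of_locallyIntegrableOn hg hf.continuous hc hU
    have i2 := integrable_mul_of_locallyIntegrableOn hg' hf.continuous hc hU
    have hg₁ : HasCompactSupport (Complex.ofRealCLM ∘ f) := hc.comp_left rfl
    have hg₂ : ContDiff ℝ ((⊤ : ℕ∞) : WithTop ℕ∞) (Complex.ofRealCLM ∘ f) := by fun_prop
    set φ := hg₁.toSchwartzMap hg₂
    have hφ : (φ : Rd d → ℂ) = Complex.ofRealCLM ∘ f := rfl
    have h0 : (0 : Rd d) ∉ tsupport φ := fun h =>
      hU (closure_mono (fun x hx => by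
        intro hfx
        exact hx (by simp [hφ, hfx])) h) rfl
    have e1 := hTg φ (hφ ▸ hg₁) h0
    have e2 := hTg' φ (hφ ▸ hg₁) h0
    rw [TemperedDistribution.fourier_apply, (hT _).2] at e1
    rw [TemperedDistribution.fourier_apply, (hT' _).2, e1] at e2
    have e3 : ∀ k : Rd d → ℝ, ∫ ξ, (k ξ : ℂ) * φ ξ = ((∫ ξ, f ξ * k ξ : ℝ) : ℂ) := by
      intro k
      rw [← integral_complex_ofReal]
      refine integral_congr_ae (.of_forall fun ξ => ?_)
      simp [hφ, mul_comm]
    rw [e3, e3, Complex.ofReal_inj] at e2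
    simp only [Pi.sub_apply, smul_eq_mul, mul_sub]
    rw [integral_sub i1 i2, e2, sub_self]

end Fourier

/-! ### Quadratic forms of signed densities -/

/-- The density is the sign coming from the Hahn decomposition. It turns integrals against a signed
measure into Bochner integrals against its variation, where Fubini and dominated estimates are
available. -/
theorem exists_sign_integral_eq {X : Type*} [MeasurableSpace X] (μ : SignedMeasure X) :
    ∃ σ : X → ℝ, Measurable σ ∧ (∀ x, |σ x| ≤ 1) ∧
      ∀ (E : Type) [NormedAddCommGroup E] [NormedSpace ℝ E] (f : X → E),
        Integrable f μ.variation → ∫ᵛ x, f x ∂<•μ = ∫ x, σ x • f x ∂μ.variation := by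
  classical
  set α := μ.toJordanDecomposition.posPart
  set β := μ.toJordanDecomposition.negPart
  have hvar : μ.variation = α + β := μ.totalVariation_eq_variation.symm
  have hsub : α.toSignedMeasure - β.toSignedMeasure = μ := μ.toSignedMeasure_toJordanDecomposition
  obtain ⟨s, hs, hαs, hβs⟩ := μ.toJordanDecomposition.mutuallySingular
  refine ⟨s.piecewise (fun _ => -1) fun _ => 1,
    Measurable.piecewise hs measurable_const measurable_const, fun x => ?_, fun E _ _ f hf => ?_⟩
  · by_cases hx : x ∈ s <;> simp [hx]
  · have eα : (fun x => s.piecewise (fun _ => (-1 : ℝ)) (fun _ => 1) x • f x) =ᵐ[α] f := by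
      filter_upwards [measure_eq_zero_iff_ae_notMem.1 hαs] with x hx
      simp [hx]
    have eβ : (fun x => s.piecewise (fun _ => (-1 : ℝ)) (fun _ => 1) x • f x) =ᵐ[β]
        fun x => -f x := by
      filter_upwards [measure_eq_zero_iff_ae_notMem.1 hβs] with x hx
      have hx' : x ∈ s := not_notMem.1 hx
      simp [hx']
    rw [hvar] at hf ⊢
    obtain ⟨hα, hβ⟩ := integrable_add_measure.1 hf
    rw [integral_add_measure (hα.congr eα.symm) (hβ.neg.congr eβ.symm), integral_congr_ae eα,
      integral_congr_ae eβ, integral_neg, ← sub_eq_add_neg, ← integral_sub_toSignedMeasure hα hβ,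
      hsub]

section QuadraticForm

variable {d : ℕ} {ν : Measure (Rd d)} {σ : Rd d → ℝ} {R : ℝ}

theorem integrable_sign_mul (hσm : Measurable σ) (hσ : ∀ x, |σ x| ≤ 1) {E : Type*}
    [NormedAddCommGroup E] [NormedSpace ℝ E] {f : Rd d → E} (hf : Integrable f ν) :
    Integrable (fun x => σ x • f x) ν := by
  refine hf.norm.mono' (hσm.aestronglyMeasurable.smul hf.1) (.of_forall fun x => ?_)
  rw [norm_smul, Real.norm_eq_abs]
  exact mul_le_of_le_one_left (norm_nonneg _) (hσ x)

variable [IsFiniteMeasure ν]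

theorem integrable_sign (hσm : Measurable σ) (hσ : ∀ x, |σ x| ≤ 1) : Integrable σ ν := by
  simpa using integrable_sign_mul (ν := ν) hσm hσ (integrable_const (1 : ℝ))

theorem integrable_sq_norm_sub_mul_sign (hσm : Measurable σ) (hσ : ∀ x, |σ x| ≤ 1)
    (hν : ∀ᵐ x ∂ν, ‖x‖ ≤ R) :
    Integrable (fun p : Rd d × Rd d => ‖p.1 - p.2‖ ^ 2 * (σ p.1 * σ p.2)) (ν.prod ν) := by
  have h1 : ∀ᵐ p ∂ν.prod ν, ‖p.1‖ ≤ R := Measure.quasiMeasurePreserving_fst.ae hν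
  have h2 : ∀ᵐ p ∂ν.prod ν, ‖p.2‖ ≤ R := Measure.quasiMeasurePreserving_snd.ae hν
  refine (integrable_const ((R + R) ^ 2 * (1 * 1))).mono' ?_ ?_
  · exact ((((measurable_fst.sub measurable_snd).norm.pow_const 2)).mul
      ((hσm.comp measurable_fst).mul (hσm.comp measurable_snd))).aestronglyMeasurable
  · filter_upwards [h1, h2] with p hp1 hp2
    rw [norm_mul, norm_mul, Real.norm_of_nonneg (by positivity)]
    have := norm_sub_le p.1 p.2
    gcongr
    · linarith
    · exact hσ _
    · exact hσ _

theorem integral_sign_mul_sign (hσ0 : ∫ x, σ x ∂ν = 0) :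
    ∫ p : Rd d × Rd d, σ p.1 * σ p.2 ∂ν.prod ν = 0 := by
  rw [integral_prod_mul, hσ0, zero_mul]

/-- Expanding `|x - y|²`, the term in `|x|²` dies by zero mass in `y`, the inner product by zero
first moment, and the term in `|y|²` by zero mass in `x`. -/
theorem integral_sq_norm_sub_mul_sign (hσm : Measurable σ) (hσ : ∀ x, |σ x| ≤ 1)
    (hν : ∀ᵐ x ∂ν, ‖x‖ ≤ R) (hσ0 : ∫ x, σ x ∂ν = 0) (hσ1 : ∫ x, σ x • x ∂ν = 0) :
    ∫ p : Rd d × Rd d, ‖p.1 - p.2‖ ^ 2 * (σ p.1 * σ p.2) ∂ν.prod ν = 0 := by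
  have hi2 : Integrable (fun x : Rd d => ‖x‖ ^ 2) ν := by
    refine (integrable_const (R ^ 2)).mono' (by fun_prop) ?_
    filter_upwards [hν] with x hx
    rw [Real.norm_of_nonneg (by positivity)]
    gcongr
  have hs := integrable_sign (ν := ν) hσm hσ
  have hs2 := integrable_sign_mul hσm hσ hi2
  have hs1 := integrable_sign_mul hσm hσ (Integrable.id_of_ae_norm_le hν)
  rw [integral_prod _ (integrable_sq_norm_sub_mul_sign hσm hσ hν)]
  have key : ∀ x : Rd d, ∫ y, ‖x - y‖ ^ 2 * (σ x * σ y) ∂ν = σ x * ∫ y, σ y • ‖y‖ ^ 2 ∂ν := by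
    intro x
    have e : ∀ y : Rd d, ‖x - y‖ ^ 2 * (σ x * σ y) =
        ‖x‖ ^ 2 * σ x * σ y + (-2 * σ x) * ⟪x, σ y • y⟫_ℝ + σ x * (σ y • ‖y‖ ^ 2) := by
      intro y
      rw [norm_sub_sq_real, inner_smul_right, smul_eq_mul]
      ring
    simp_rw [e]
    rw [integral_add (f := fun y => ‖x‖ ^ 2 * σ x * σ y + (-2 * σ x) * ⟪x, σ y • y⟫_ℝ)
        ((hs.const_mul _).add ((hs1.const_inner x).const_mul _)) (hs2.const_mul _),
      integral_add (hs.const_mul _) ((hs1.const_inner x).const_mul _), integral_const_mul,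
      integral_const_mul, integral_const_mul, integral_inner hs1, hσ0, hσ1, inner_zero_right]
    ring
  simp_rw [key]
  rw [integral_mul_const, hσ0, zero_mul]

/-- The Fourier transform of the measure with density `σ` with respect to `ν`. -/
noncomputable def densityFourier (ν : Measure (Rd d)) (σ : Rd d → ℝ) (ξ : Rd d) : ℂ :=
  ∫ x, σ x • Complex.exp (((-2 * Real.pi * ⟪x, ξ⟫_ℝ : ℝ) : ℂ) * Complex.I) ∂ν

theorem measurable_phase : Measurable fun p : Rd d × Rd d =>
    Complex.exp (((-2 * Real.pi * ⟪p.1, p.2⟫_ℝ : ℝ) : ℂ) * Complex.I) := by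
  fun_prop

theorem measurable_densityFourier (hσm : Measurable σ) :
    Measurable (densityFourier ν σ) := by
  have h : Measurable fun p : Rd d × Rd d =>
      σ p.2 • Complex.exp (((-2 * Real.pi * ⟪p.2, p.1⟫_ℝ : ℝ) : ℂ) * Complex.I) := by
    have h1 : Measurable fun p : Rd d × Rd d =>
        Complex.exp (((-2 * Real.pi * ⟪p.2, p.1⟫_ℝ : ℝ) : ℂ) * Complex.I) := by
      fun_prop
    exact (hσm.comp measurable_snd).smul h1
  exact h.stronglyMeasurable.integral_prod_right'.measurable

theorem sq_norm_densityFourier (ξ : Rd d) :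
    ((‖densityFourier ν σ ξ‖ ^ 2 : ℝ) : ℂ) = ∫ p : Rd d × Rd d,
      Complex.exp (((-2 * Real.pi * ⟪p.1 - p.2, ξ⟫_ℝ : ℝ) : ℂ) * Complex.I) *
        ((σ p.1 * σ p.2 : ℝ) : ℂ) ∂ν.prod ν := by
  have e : ∀ p : Rd d × Rd d,
      Complex.exp (((-2 * Real.pi * ⟪p.1 - p.2, ξ⟫_ℝ : ℝ) : ℂ) * Complex.I) *
        ((σ p.1 * σ p.2 : ℝ) : ℂ) =
      (σ p.1 • Complex.exp (((-2 * Real.pi * ⟪p.1, ξ⟫_ℝ : ℝ) : ℂ) * Complex.I)) *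
        (starRingEnd ℂ) (σ p.2 •
          Complex.exp (((-2 * Real.pi * ⟪p.2, ξ⟫_ℝ : ℝ) : ℂ) * Complex.I)) := by
    intro p
    rw [Complex.real_smul, Complex.real_smul, map_mul, Complex.conj_ofReal, ← Complex.exp_conj,
      map_mul, Complex.conj_ofReal, Complex.conj_I, mul_mul_mul_comm, ← Complex.exp_add,
      inner_sub_left]
    push_cast
    rw [mul_comm]
    congr 2
    ring
  simp_rw [e]
  rw [integral_prod_mul (fun x => σ x • Complex.exp (((-2 * Real.pi * ⟪x, ξ⟫_ℝ : ℝ) : ℂ) *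
      Complex.I)) fun x => (starRingEnd ℂ) (σ x • Complex.exp (((-2 * Real.pi * ⟪x, ξ⟫_ℝ : ℝ) : ℂ) *
      Complex.I)), integral_conj, Complex.mul_conj', densityFourier]
  push_cast
  rfl

theorem norm_densityFourier_le (hσ : ∀ x, |σ x| ≤ 1) (ξ : Rd d) :
    ‖densityFourier ν σ ξ‖ ≤ ν.real univ := by
  refine (norm_integral_le_of_norm_le_const (C := 1) (.of_forall fun x => ?_)).trans_eq (one_mul _)
  rw [norm_smul, Complex.norm_exp_ofReal_mul_I, mul_one]
  exact hσ x

theorem integrable_gaussHat_mul_sq_norm (hσm : Measurable σ) (hσ : ∀ x, |σ x| ≤ 1) {t : ℝ}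
    (ht : 0 < t) : Integrable fun ξ => gaussHat t ξ * ‖densityFourier ν σ ξ‖ ^ 2 := by
  refine (integrable_gaussHat ht).mul_bdd (c := ν.real univ ^ 2)
    ((measurable_densityFourier hσm).norm.pow_const 2).aestronglyMeasurable
    (.of_forall fun ξ => ?_)
  rw [norm_pow, norm_norm]
  gcongr
  exact norm_densityFourier_le hσ ξ

/-- The Gaussian is written as the Fourier integral of `gaussHat t`, and the integral over pairs of
phases is `|μ̂|²`. Fubini applies because `gaussHat t` is integrable and `σ` is bounded. -/
theorem integral_exp_mul_sign (hσm : Measurable σ) (hσ : ∀ x, |σ x| ≤ 1) {t : ℝ} (ht : 0 < t) :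
    ∫ p : Rd d × Rd d, Real.exp (-(t * ‖p.1 - p.2‖ ^ 2)) * (σ p.1 * σ p.2) ∂ν.prod ν =
      ∫ ξ, gaussHat t ξ * ‖densityFourier ν σ ξ‖ ^ 2 := by
  have hs := integrable_sign (ν := ν) hσm hσ
  have hint : Integrable (fun q : (Rd d × Rd d) × Rd d =>
      (gaussHat t q.2 : ℂ) *
        Complex.exp (((-2 * Real.pi * ⟪q.1.1 - q.1.2, q.2⟫_ℝ : ℝ) : ℂ) * Complex.I) *
        ((σ q.1.1 * σ q.1.2 : ℝ) : ℂ)) ((ν.prod ν).prod volume) := by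
    refine ((hs.mul_prod hs).mul_prod (integrable_gaussHat (d := d) ht)).norm.mono' ?_
      (.of_forall fun q => ?_)
    · have h1 : Measurable fun ξ : Rd d => gaussHat t ξ :=
        measurable_gaussHat.comp (measurable_id.prodMk measurable_const)
      refine Measurable.aestronglyMeasurable (((Complex.measurable_ofReal.comp
        (h1.comp measurable_snd)).mul (measurable_phase.comp
          ((measurable_fst.fst.sub measurable_fst.snd).prodMk measurable_snd))).mul
        (Complex.measurable_ofReal.comp
          ((hσm.comp measurable_fst.fst).mul (hσm.comp measurable_fst.snd))))
    · rw [norm_mul, norm_mul, Complex.norm_exp_ofReal_mul_I, Complex.norm_real, Complex.norm_real,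
        norm_mul (σ _ * σ _), mul_one, mul_comm]
  have h := integral_integral_swap (f := fun (p : Rd d × Rd d) (ξ : Rd d) =>
      (gaussHat t ξ : ℂ) *
        Complex.exp (((-2 * Real.pi * ⟪p.1 - p.2, ξ⟫_ℝ : ℝ) : ℂ) * Complex.I) *
        ((σ p.1 * σ p.2 : ℝ) : ℂ)) hint
  have e1 : ∀ p : Rd d × Rd d, ∫ ξ, (gaussHat t ξ : ℂ) *
        Complex.exp (((-2 * Real.pi * ⟪p.1 - p.2, ξ⟫_ℝ : ℝ) : ℂ) * Complex.I) *
        ((σ p.1 * σ p.2 : ℝ) : ℂ) =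
      ((Real.exp (-(t * ‖p.1 - p.2‖ ^ 2)) * (σ p.1 * σ p.2) : ℝ) : ℂ) := by
    intro p
    rw [integral_mul_const, integral_gaussHat_mul_exp ht, ← Complex.ofReal_mul]
  have e2 : ∀ ξ : Rd d, ∫ p : Rd d × Rd d, (gaussHat t ξ : ℂ) *
        Complex.exp (((-2 * Real.pi * ⟪p.1 - p.2, ξ⟫_ℝ : ℝ) : ℂ) * Complex.I) *
        ((σ p.1 * σ p.2 : ℝ) : ℂ) ∂ν.prod ν =
      ((gaussHat t ξ * ‖densityFourier ν σ ξ‖ ^ 2 : ℝ) : ℂ) := by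
    intro ξ
    simp_rw [mul_assoc (gaussHat t ξ : ℂ)]
    rw [integral_const_mul, ← sq_norm_densityFourier, ← Complex.ofReal_mul]
  rw [integral_congr_ae (.of_forall e1), integral_congr_ae (.of_forall e2),
    integral_complex_ofReal, integral_complex_ofReal] at h
  exact Complex.ofReal_injective h

end QuadraticForm

/-! ### The Fourier representation of the energy -/

namespace HasMixture

variable {d : ℕ} {W : Rd d → EReal} {m : ℝ → ℝ} {B C : ℝ} {ν : Measure (Rd d)} [IsFiniteMeasure ν]
  {σ : Rd d → ℝ} {R : ℝ}

theorem ae_sub_ne_top (hW : IsGaussianLike W) (hνν : mutualPos W ν ν < ⊤) :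
    ∀ᵐ p ∂ν.prod ν, W (p.1 - p.2) ≠ ⊤ := by
  rw [hW.mutualPos_eq_lintegral_prod] at hνν
  filter_upwards [ae_lt_top hW.measurable_sub hνν.ne] with p hp h
  simp [h] at hp

/-- Finite energy enters here: the mixture is absolutely dominated by the positive part of `W` plus
a constant. -/
theorem integrable_gaussRem_mul_sign (h : HasMixture W m B C) (hW : IsGaussianLike W)
    (hσm : Measurable σ) (hσ : ∀ x, |σ x| ≤ 1) (hν : ∀ᵐ x ∂ν, ‖x‖ ≤ R)
    (hνν : mutualPos W ν ν < ⊤) :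
    Integrable (fun q : (Rd d × Rd d) × ℝ =>
      gaussRem q.2 (‖q.1.1 - q.1.2‖ ^ 2) * m q.2 * (σ q.1.1 * σ q.1.2))
      ((ν.prod ν).prod (volume.restrict (Ioi 0))) := by
  have hm1 : Measurable fun q : (Rd d × Rd d) × ℝ =>
      gaussRem q.2 (‖q.1.1 - q.1.2‖ ^ 2) * m q.2 :=
    (measurable_gaussRem.comp (measurable_snd.prodMk
      ((measurable_fst.fst.sub measurable_fst.snd).norm.pow_const 2))).mul
        (h.measurable.comp measurable_snd)
  have hm2 : Measurable fun q : (Rd d × Rd d) × ℝ => σ q.1.1 * σ q.1.2 :=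
    (hσm.comp measurable_fst.fst).mul (hσm.comp measurable_fst.snd)
  have hm3 : Measurable fun q : (Rd d × Rd d) × ℝ =>
      gaussRem q.2 (‖q.1.1 - q.1.2‖ ^ 2) * m q.2 * (σ q.1.1 * σ q.1.2) := hm1.mul hm2
  refine ⟨hm3.aestronglyMeasurable, ?_⟩
  rw [hasFiniteIntegral_iff_enorm, lintegral_prod _ hm3.enorm.aemeasurable]
  obtain ⟨K, hK⟩ := h.lintegral_le (R + R)
  have h1 : ∀ᵐ p ∂ν.prod ν, ‖p.1‖ ≤ R := Measure.quasiMeasurePreserving_fst.ae hν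
  have h2 : ∀ᵐ p ∂ν.prod ν, ‖p.2‖ ≤ R := Measure.quasiMeasurePreserving_snd.ae hν
  calc ∫⁻ p, (∫⁻ t in Ioi 0, ‖gaussRem t (‖p.1 - p.2‖ ^ 2) * m t * (σ p.1 * σ p.2)‖ₑ) ∂ν.prod ν
      ≤ ∫⁻ p, ((W (p.1 - p.2)).toENNReal + K) ∂ν.prod ν := by
        refine lintegral_mono_ae ?_
        filter_upwards [h1, h2] with p hp1 hp2
        refine le_trans (lintegral_mono fun t => ?_)
          (hK _ ((norm_sub_le p.1 p.2).trans (add_le_add hp1 hp2)))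
        rw [enorm_mul _ (σ p.1 * σ p.2)]
        refine mul_le_of_le_one_right' ?_
        rw [← ofReal_norm, ENNReal.ofReal_le_one, norm_mul]
        exact mul_le_one₀ (hσ _) (norm_nonneg _) (hσ _)
    _ < ⊤ := by
        rw [lintegral_add_right _ measurable_const, lintegral_const,
          ← hW.mutualPos_eq_lintegral_prod]
        exact ENNReal.add_lt_top.2 ⟨hνν, ENNReal.mul_lt_top ENNReal.coe_lt_top (measure_lt_top _ _)⟩

/-- Admissibility makes the regularization invisible, since the Taylor polynomial is affine in `|p.1
- p.2|²` and both of its terms integrate to zero. -/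
theorem integral_gaussRem_mul_sign (hσm : Measurable σ) (hσ : ∀ x, |σ x| ≤ 1)
    (hν : ∀ᵐ x ∂ν, ‖x‖ ≤ R) (hσ0 : ∫ x, σ x ∂ν = 0) (hσ1 : ∫ x, σ x • x ∂ν = 0) {t : ℝ}
    (ht : 0 < t) :
    ∫ p : Rd d × Rd d, gaussRem t (‖p.1 - p.2‖ ^ 2) * (σ p.1 * σ p.2) ∂ν.prod ν =
      ∫ ξ, gaussHat t ξ * ‖densityFourier ν σ ξ‖ ^ 2 := by
  rw [← integral_exp_mul_sign hσm hσ ht]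
  by_cases ht1 : t ≤ 1
  · have hs := integrable_sign (ν := ν) hσm hσ
    have hss : Integrable (fun p : Rd d × Rd d => σ p.1 * σ p.2) (ν.prod ν) := hs.mul_prod hs
    have h2 := integrable_sq_norm_sub_mul_sign hσm hσ hν
    have hE : Integrable (fun p : Rd d × Rd d =>
        Real.exp (-(t * ‖p.1 - p.2‖ ^ 2)) * (σ p.1 * σ p.2)) (ν.prod ν) := by
      refine hss.bdd_mul (c := 1) (by fun_prop) (.of_forall fun p => ?_)
      rw [Real.norm_of_nonneg (Real.exp_nonneg _)]
      exact Real.exp_le_one_iff.2 (neg_nonpos.2 (by positivity))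
    have e : ∀ p : Rd d × Rd d, gaussRem t (‖p.1 - p.2‖ ^ 2) * (σ p.1 * σ p.2) =
        Real.exp (-(t * ‖p.1 - p.2‖ ^ 2)) * (σ p.1 * σ p.2) -
          (σ p.1 * σ p.2 - t * (‖p.1 - p.2‖ ^ 2 * (σ p.1 * σ p.2))) := by
      intro p
      rw [gaussRem, if_pos ht1]
      ring
    simp_rw [e]
    rw [integral_sub (g := fun p : Rd d × Rd d =>
        σ p.1 * σ p.2 - t * (‖p.1 - p.2‖ ^ 2 * (σ p.1 * σ p.2))) hE (hss.sub (h2.const_mul _)),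
      integral_sub hss (h2.const_mul _), integral_const_mul, integral_sign_mul_sign hσ0,
      integral_sq_norm_sub_mul_sign hσm hσ hν hσ0 hσ1]
    simp
  · simp_rw [gaussRem_of_one_lt (not_le.1 ht1)]

theorem integral_toReal_mul_sign (h : HasMixture W m B C) (hW : IsGaussianLike W)
    (hσm : Measurable σ) (hσ : ∀ x, |σ x| ≤ 1) (hν : ∀ᵐ x ∂ν, ‖x‖ ≤ R)
    (hνν : mutualPos W ν ν < ⊤) (hσ0 : ∫ x, σ x ∂ν = 0) (hσ1 : ∫ x, σ x • x ∂ν = 0) :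
    Integrable (fun t => (∫ ξ, gaussHat t ξ * ‖densityFourier ν σ ξ‖ ^ 2) * m t)
      (volume.restrict (Ioi 0)) ∧
    ∫ p : Rd d × Rd d, (W (p.1 - p.2)).toReal * (σ p.1 * σ p.2) ∂ν.prod ν =
      ∫ t in Ioi 0, (∫ ξ, gaussHat t ξ * ‖densityFourier ν σ ξ‖ ^ 2) * m t := by
  have hF := h.integrable_gaussRem_mul_sign hW hσm hσ hν hνν
  have hs := integrable_sign (ν := ν) hσm hσ
  have hss : Integrable (fun p : Rd d × Rd d => σ p.1 * σ p.2) (ν.prod ν) := hs.mul_prod hs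
  have h2 := integrable_sq_norm_sub_mul_sign hσm hσ hν
  have e1 : ∀ t ∈ Ioi (0 : ℝ), ∫ p : Rd d × Rd d,
      gaussRem t (‖p.1 - p.2‖ ^ 2) * m t * (σ p.1 * σ p.2) ∂ν.prod ν =
      (∫ ξ, gaussHat t ξ * ‖densityFourier ν σ ξ‖ ^ 2) * m t := by
    intro t ht
    rw [← integral_gaussRem_mul_sign hσm hσ hν hσ0 hσ1 ht, ← integral_mul_const]
    refine integral_congr_ae (.of_forall fun p => ?_)
    ring
  have e2 : (fun p : Rd d × Rd d => (W (p.1 - p.2)).toReal * (σ p.1 * σ p.2)) =ᵐ[ν.prod ν]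
      fun p => (∫ t in Ioi 0, gaussRem t (‖p.1 - p.2‖ ^ 2) * m t * (σ p.1 * σ p.2)) +
        (B * (σ p.1 * σ p.2) + C * (‖p.1 - p.2‖ ^ 2 * (σ p.1 * σ p.2))) := by
    filter_upwards [ae_sub_ne_top hW hνν] with p hp
    rw [integral_mul_const, h.toReal_eq _ hp]
    ring
  refine ⟨hF.integral_prod_right.congr
    ((ae_restrict_iff' measurableSet_Ioi).2 (.of_forall e1)), ?_⟩
  rw [integral_congr_ae e2, integral_add hF.integral_prod_left
    (g := fun p : Rd d × Rd d => B * (σ p.1 * σ p.2) + C * (‖p.1 - p.2‖ ^ 2 * (σ p.1 * σ p.2)))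
    ((hss.const_mul _).add (h2.const_mul _)),
    integral_add (hss.const_mul _) (h2.const_mul _), integral_const_mul, integral_const_mul,
    integral_sign_mul_sign hσ0, integral_sq_norm_sub_mul_sign hσm hσ hν hσ0 hσ1, mul_zero,
    mul_zero, add_zero, add_zero,
    integral_integral_swap (f := fun (p : Rd d × Rd d) (t : ℝ) =>
      gaussRem t (‖p.1 - p.2‖ ^ 2) * m t * (σ p.1 * σ p.2)) hF]
  exact setIntegral_congr_fun measurableSet_Ioi e1

/-- The density `m` may change sign, but `gaussHat t |μ̂|²` is nonnegative. Absolute integrability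
in `(ξ, t)` therefore follows from that of the `t` integral alone, already known from the spatial
side. -/
theorem integral_mixHat_mul (h : HasMixture W m B C) (hW : IsGaussianLike W)
    (hσm : Measurable σ) (hσ : ∀ x, |σ x| ≤ 1) (hν : ∀ᵐ x ∂ν, ‖x‖ ≤ R)
    (hνν : mutualPos W ν ν < ⊤) (hσ0 : ∫ x, σ x ∂ν = 0) (hσ1 : ∫ x, σ x • x ∂ν = 0) :
    Integrable (fun ξ => mixHat m ξ * ‖densityFourier ν σ ξ‖ ^ 2) ∧
    ∫ p : Rd d × Rd d, (W (p.1 - p.2)).toReal * (σ p.1 * σ p.2) ∂ν.prod ν =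
      ∫ ξ, mixHat m ξ * ‖densityFourier ν σ ξ‖ ^ 2 := by
  obtain ⟨hi, he⟩ := h.integral_toReal_mul_sign hW hσm hσ hν hνν hσ0 hσ1
  have hG : Integrable (fun q : Rd d × ℝ =>
      gaussHat q.2 q.1 * ‖densityFourier ν σ q.1‖ ^ 2 * m q.2)
      (volume.prod (volume.restrict (Ioi 0))) := by
    have hmeas : Measurable fun q : Rd d × ℝ =>
        gaussHat q.2 q.1 * ‖densityFourier ν σ q.1‖ ^ 2 * m q.2 :=
      (measurable_gaussHat.mul
        (((measurable_densityFourier hσm).comp measurable_fst).norm.pow_const 2)).mul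
        (h.measurable.comp measurable_snd)
    refine (integrable_prod_iff' hmeas.aestronglyMeasurable).2
      ⟨(ae_restrict_iff' measurableSet_Ioi).2 (.of_forall fun t ht =>
        (integrable_gaussHat_mul_sq_norm (ν := ν) hσm hσ ht).mul_const (m t)), ?_⟩
    refine hi.norm.congr ((ae_restrict_iff' measurableSet_Ioi).2 (.of_forall fun t ht => ?_))
    simp only [norm_mul _ (m t)]
    rw [integral_mul_const]
    have h0 : ∀ ξ, 0 ≤ gaussHat t ξ * ‖densityFourier ν σ ξ‖ ^ 2 := fun ξ =>
      mul_nonneg (gaussHat_nonneg ht ξ) (by positivity)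
    congr 1
    rw [Real.norm_of_nonneg (integral_nonneg h0)]
    exact integral_congr_ae (.of_forall fun ξ => (Real.norm_of_nonneg (h0 ξ)).symm)
  have e : ∀ ξ, ∫ t in Ioi 0, gaussHat t ξ * ‖densityFourier ν σ ξ‖ ^ 2 * m t =
      mixHat m ξ * ‖densityFourier ν σ ξ‖ ^ 2 := by
    intro ξ
    rw [mixHat, ← integral_mul_const]
    refine integral_congr_ae (.of_forall fun t => ?_)
    ring
  refine ⟨hG.integral_prod_left.congr (.of_forall e), ?_⟩
  rw [he, ← integral_congr_ae (.of_forall e),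
    integral_integral_swap (f := fun (ξ : Rd d) (t : ℝ) =>
      gaussHat t ξ * ‖densityFourier ν σ ξ‖ ^ 2 * m t) hG]
  refine integral_congr_ae (.of_forall fun t => ?_)
  exact (integral_mul_const _ _).symm

theorem signedEnergy_eq (h : HasMixture W m B C) (hW : IsGaussianLike W) {R : ℝ≥0}
    {μ : SignedMeasure (Rd d)} (hμ : IsAdmissible W R μ) :
    Integrable (fun ξ => mixHat m ξ * ‖signedFourier μ ξ‖ ^ 2) ∧
      signedEnergy W μ = 1 / 2 * ∫ ξ, mixHat m ξ * ‖signedFourier μ ξ‖ ^ 2 := by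
  obtain ⟨-, hμR, hμE, hμ1, hμx⟩ := hμ
  have hν := ae_norm_le_of_closedBall_compl hμR
  have hfin : IsFiniteMeasure μ.variation := by
    rw [← μ.totalVariation_eq_variation]
    infer_instance
  have hνν := (hW.energy_lt_top_iff hν).1 hμE
  obtain ⟨σ, hσm, hσ, hI⟩ := exists_sign_integral_eq μ
  have hσ0 : ∫ x, σ x ∂μ.variation = 0 := by
    have h1 := hI ℝ (fun _ => 1) (integrable_const 1)
    rw [VectorMeasure.integral_const] at h1
    simpa [hμ1] using h1.symm
  have hσ1 : ∫ x, σ x • x ∂μ.variation = 0 := by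
    rw [← hI _ (fun x => x) (Integrable.id_of_ae_norm_le hν), hμx]
  have hF : ∀ ξ, signedFourier μ ξ = densityFourier μ.variation σ ξ := by
    intro ξ
    refine hI _ _ ((integrable_const (1 : ℝ)).mono' ?_ (.of_forall fun x => ?_))
    · exact Measurable.aestronglyMeasurable (by fun_prop)
    · rw [Complex.norm_exp_ofReal_mul_I]
  have hint := hW.integrable_prod hν hν hνν
  have hints : Integrable (fun p : Rd d × Rd d => (W (p.1 - p.2)).toReal * (σ p.1 * σ p.2))
      (μ.variation.prod μ.variation) := by
    refine hint.mul_bdd (c := 1) ((hσm.comp measurable_fst).mul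
      (hσm.comp measurable_snd)).aestronglyMeasurable (.of_forall fun p => ?_)
    rw [norm_mul]
    exact mul_le_one₀ (hσ _) (norm_nonneg _) (hσ _)
  have hints' : Integrable (fun p : Rd d × Rd d => (W (p.1 - p.2)).toReal * σ p.2)
      (μ.variation.prod μ.variation) :=
    hint.mul_bdd (c := 1) (hσm.comp measurable_snd).aestronglyMeasurable
      (.of_forall fun p => hσ _)
  have hE : signedEnergy W μ = 1 / 2 * ∫ p : Rd d × Rd d,
      (W (p.1 - p.2)).toReal * (σ p.1 * σ p.2) ∂μ.variation.prod μ.variation := by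
    have hae : ∀ᵐ x ∂μ.variation, ∫ᵛ y, (W (x - y)).toReal ∂<•μ =
        ∫ y, (W (x - y)).toReal * σ y ∂μ.variation := by
      filter_upwards [hint.prod_right_ae] with x hx
      rw [hI _ _ hx]
      simp only [smul_eq_mul, mul_comm]
    rw [signedEnergy, VectorMeasure.integral_congr_ae hae, hI _ _ hints'.integral_prod_left,
      integral_prod _ hints]
    congr 1
    refine integral_congr_ae (.of_forall fun x => ?_)
    simp only [smul_eq_mul]
    rw [← integral_const_mul]
    congr 1
    ext y
    ring
  simp_rw [hF]
  rw [hE]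
  obtain ⟨h1, h2⟩ := h.integral_mixHat_mul hW hσm hσ hν hνν hσ0 hσ1
  exact ⟨h1, by rw [h2]⟩

/-- Any representative `g` agrees almost everywhere with `mixHat m`, and the origin is a null set as
`d > 0`. The Fourier integral is thus twice the energy, and the two have the same sign. -/
theorem hasFourierLICRadius (h : HasMixture W m B C) (hW : IsGaussianLike W) (hd : 0 < d) :
    HasFourierLICRadius W := by
  have hg₀ := h.isFourierOffZero_mixHat hd
  refine ⟨⟨_, hg₀⟩, fun g hg => ?_⟩
  have hae := hg.ae_eq hd hg₀
  have key : ∀ (R : ℝ≥0) (μ : SignedMeasure (Rd d)), IsAdmissible W R μ →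
      Integrable (fun ξ => g ξ * ‖signedFourier μ ξ‖ ^ 2) ∧
        signedEnergy W μ = 1 / 2 * ∫ ξ in {0}ᶜ, g ξ * ‖signedFourier μ ξ‖ ^ 2 := by
    intro R μ hμ
    obtain ⟨h1, h2⟩ := h.signedEnergy_eq hW hμ
    have e : (fun ξ => mixHat m ξ * ‖signedFourier μ ξ‖ ^ 2) =ᵐ[volume]
        fun ξ => g ξ * ‖signedFourier μ ξ‖ ^ 2 := by
      filter_upwards [hae] with ξ hξ
      rw [hξ]
    rw [setIntegral_congr_set (compl_zero_ae_eq_univ hd), setIntegral_univ, h2,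
      integral_congr_ae e]
    exact ⟨h1.congr e, rfl⟩
  refine ⟨fun R μ hμ => (key R μ hμ).1.integrableOn, ?_⟩
  rw [hW.LICRadius_eq_energyRadius]
  refine iSup_congr fun R => iSup_congr_Prop (forall_congr' fun μ => forall_congr' fun hμ => ?_)
    fun _ => rfl
  rw [(key R μ hμ).2]
  exact mul_pos_iff_of_pos_left (by norm_num)

end HasMixture

/-! ### The theorem for both families of potentials -/

theorem theorem3p7 (d : ℕ) (hd : 0 < d) :
    (∀ a b : ℝ, -(d : ℝ) < b → b < a →
      LICRadius (Wab (d := d) a b) = energyRadius (Wab (d := d) a b) ∧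
      (a < 4 → HasFourierLICRadius (Wab (d := d) a b))) ∧
    (∀ b : ℝ, -(d : ℝ) < b → b ≠ 0 →
      LICRadius (Wbln (d := d) b) = energyRadius (Wbln (d := d) b) ∧
      (b < 4 → HasFourierLICRadius (Wbln (d := d) b))) := by
  refine ⟨fun a b hdb hab => ⟨(isGaussianLike_Wab hab).LICRadius_eq_energyRadius, fun ha => ?_⟩,
    fun b hdb hb0 => ⟨(isGaussianLike_Wbln hb0).LICRadius_eq_energyRadius, fun hb => ?_⟩⟩
  · obtain ⟨m, B, C, h⟩ := hasMixture_Wab hdb hab ha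
    exact h.hasFourierLICRadius (isGaussianLike_Wab hab) hd
  · obtain ⟨m, B, C, h⟩ := hasMixture_Wbln hdb hb0 hb
    exact h.hasFourierLICRadius (isGaussianLike_Wbln hb0) hd
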